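/- \textbf{Setting.} For a $\mathbb C$-linear category $\mathcal C$ put $$\operatorname{Tr}(\mathcal C)=\Bigl(\bigoplus_{X\in\mathcal C}\operatorname{End}_{\mathcal C}(X)\Bigr)\Big/\operatorname{span}_{\mathbb C}\{fg-gf \mid f:X\to Y,\ g:Y\to X\},$$ and write $[f]$ for the class of $f$. If $\mathcal C$ is a $\mathbb C$-linear monoidal category, $\operatorname{Tr}(\mathcal C)$ is a unital algebra with $[f][g]=[f\otimes g]$. If $F$ is a $\mathbb C$-linear action of $\mathcal C$ on a $\mathbb C$-linear category $\mathcal D$, then $\operatorname{Tr}(\mathcal D)$ is a $\operatorname{Tr}(\mathcal C)$-module via $[f]\cdot[\psi]=[F(X)(\psi)\circ F(f)_U]$ for $f\in\operatorname{End}(X)$, $\psi\in\operatorname{End}(U)$. Let $\mathcal H'$ be Khovanov's Heisenberg category: the additive $\mathbb C$-linear monoidal category generated by two objects $\mathsf P$, $\mathsf Q$ (identity strands oriented upwards and downwards) and, as morphisms, by the crossing $\mathsf{PP}\to\mathsf{PP}$ of two upward strands and the four oriented cups and caps $\mathbf 1\to\mathsf{QP}$, $\mathsf{PQ}\to\mathbf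 1$, $\mathbf 1\to\mathsf{PQ}$, $\mathsf{QP}\to\mathbf 1$; diagrams are taken up to planar isotopy (so the other crossings are the rotations of the given one) and subject to the relations: the crossing squares to the identity and satisfies the braid relation; the composite $\mathsf{PQ}\to\mathsf{QP}\to\mathsf{PQ}$ of sideways crossings is the identity; the composite $\mathsf{QP}\to\mathsf{PQ}\to\mathsf{QP}$ of sideways crossings equals the identity minus the composite $\mathsf{QP}\to\mathbf 1\to\mathsf{QP}$ of cap and cup; the counterclockwise circle $\mathbf 1\to\mathsf{QP}\to\mathbf 1$ equals $1$; and the left curl $\mathsf P\to\mathsf{QPP}\to\mathsf{QPP}\to\mathsf P$ equals $0$. Let $\mathcal H$ be the Karoubi envelope of $\mathcal H'$, with its induced monoidal structure. For $n\ge 0$ let $\mathbb C[S_n]\text{-mod}$ be the category of finite-dimensional $\mathbb C[S_n]$-modules, and embed $S_n\subset S_{n+1}$ as the stabilizer of the last letter. The category $\mathcal H'$ acts on $\bigoplus_n\mathbb C[S_n]\text{-mod}$: $\mathsf P$ acts by induction $\mathbb C[S_{n+1}]\otimes_{\mathbb C[S_n]}-$ and $\mathsf Q$ by restriction from $S_{n+1}$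 to $S_n$ (and by $0$ on $\mathbb C[S_0]\text{-mod}$); the cups and caps act by the units and counits of the two adjunctions between induction and restriction, namely $$m\mapsto 1\otimes m,\qquad a\otimes m\mapsto am,\qquad m\mapsto\sum_{x\in S_{n+1}/S_n}x\otimes x^{-1}m,\qquad a\otimes m\mapsto \operatorname{pr}(a)\,m,$$ where $\operatorname{pr}:\mathbb C[S_{n+1}]\to\mathbb C[S_n]$ is the linear map that is the identity on $S_n$ and kills $S_{n+1}\setminus S_n$; and the crossing acts on $\mathbb C[S_{n+2}]\otimes_{\mathbb C[S_n]}-$ by right multiplication of the first factor by the transposition of the last two letters. Hence $$V=\bigoplus_{n\ge 0}\operatorname{Tr}(\mathbb C[S_n]\text{-mod})=\operatorname{Tr}\Bigl(\bigoplus_{n\ge 0}\mathbb C[S_n]\text{-mod}\Bigr)$$ is a $\operatorname{Tr}(\mathcal H')$-module, and therefore a $\operatorname{Tr}(\mathcal H)$-module through the natural isomorphism $\operatorname{Tr}(\mathcal H)\cong\operatorname{Tr}(\mathcal H')$, $[f:(X,p)\to(X,p)]\mapsto[f:X\to X]$. \textbf{Proposition.} The $\operatorname{Tr}(\mathcal H)$-module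 $V$ is irreducible: $V\neq 0$, and the only $\operatorname{Tr}(\mathcal H)$-submodules of $V$ are $0$ and $V$. -/

import Mathlib

noncomputable section

open CategoryTheory

namespace HeisenbergTrace

/-! ### Induction and restriction along a homomorphism of (noncommutative) rings -/

section Induction

variable {B A : Type} [Ring B] [Ring A] (φ : B →+* A)

/-- The restriction of scalars of an `A`-module along `φ : B → A`. -/
def Res (_ : B →+* A) (M : Type) : Type := M

instance (M : Type) [AddCommGroup M] : AddCommGroup (Res φ M) := inferInstanceAs (AddCommGroup M)

instance (M : Type) [AddCommGroup M] [Module A M] : Module B (Res φ M) := Module.compHom M φ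

/-- An element of `M`, viewed in the restriction of `M`. -/
def Res.of {M : Type} [AddCommGroup M] : M →+ Res φ M := AddMonoidHom.id M

/-- An element of the restriction of `M`, viewed in `M`. -/
def Res.un {M : Type} [AddCommGroup M] : Res φ M →+ M := AddMonoidHom.id M

theorem Res.un_of {M : Type} [AddCommGroup M] (m : M) : Res.un φ (Res.of φ m) = m := rfl

theorem Res.of_un {M : Type} [AddCommGroup M] (m : Res φ M) : Res.of φ (Res.un φ m) = m := rfl

theorem Res.smul_of {M : Type} [AddCommGroup M] [Module A M] (b : B) (m : M) :
    b • Res.of φ m = Res.of φ (φ b • m) := rfl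

theorem Res.un_smul {M : Type} [AddCommGroup M] [Module A M] (b : B) (m : Res φ M) :
    Res.un φ (b • m) = φ b • Res.un φ m := rfl

/-- The relations `a φ(b) ⊗ m = a ⊗ b m` that define the balanced tensor product. -/
def indRel (M : Type) [AddCommGroup M] [Module B M] : Submodule A (TensorProduct ℤ A M) :=
  Submodule.span A {z | ∃ (a : A) (b : B) (m : M),
    z = TensorProduct.tmul ℤ (a * φ b) m - TensorProduct.tmul ℤ a (b • m)}

/-- The induced module `A ⊗_B M`, where `A` is an `(A, B)`-bimodule through `φ : B → A`. -/
def Ind (M : Type) [AddCommGroup M] [Module B M] : Type :=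
  TensorProduct ℤ A M ⧸ indRel φ M

variable (M : Type) [AddCommGroup M] [Module B M]

instance : AddCommGroup (Ind φ M) := inferInstanceAs (AddCommGroup (_ ⧸ indRel φ M))

instance : Module A (Ind φ M) := inferInstanceAs (Module A (_ ⧸ indRel φ M))

variable {M}

/-- The quotient map onto `A ⊗_B M`. -/
def Ind.quot : TensorProduct ℤ A M →ₗ[A] Ind φ M := (indRel φ M).mkQ

/-- The pure tensor `a ⊗ m` in `A ⊗_B M`. -/
def Ind.mk (a : A) (m : M) : Ind φ M := Ind.quot φ (TensorProduct.tmul ℤ a m)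

theorem Ind.mk_add (a : A) (m m' : M) : Ind.mk φ a (m + m') = Ind.mk φ a m + Ind.mk φ a m' := by
  simp [Ind.mk, TensorProduct.tmul_add]

theorem Ind.add_mk (a a' : A) (m : M) : Ind.mk φ (a + a') m = Ind.mk φ a m + Ind.mk φ a' m := by
  simp [Ind.mk, TensorProduct.add_tmul]

theorem Ind.zero_mk (m : M) : Ind.mk φ 0 m = 0 := by simp [Ind.mk]

theorem Ind.mk_zero (a : A) : Ind.mk φ a (0 : M) = 0 := by simp [Ind.mk]

theorem Ind.smul_mk (a a' : A) (m : M) : a • Ind.mk φ a' m = Ind.mk φ (a * a') m := by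
  rw [Ind.mk, ← map_smul, TensorProduct.smul_tmul', smul_eq_mul, Ind.mk]

theorem Ind.mk_smul (a : A) (b : B) (m : M) : Ind.mk φ a (b • m) = Ind.mk φ (a * φ b) m :=
  ((Submodule.Quotient.eq (indRel φ M)).2 (Submodule.subset_span ⟨a, b, m, rfl⟩)).symm

theorem Ind.mk_sum {ι : Type} (s : Finset ι) (a : A) (f : ι → M) :
    Ind.mk φ a (∑ i ∈ s, f i) = ∑ i ∈ s, Ind.mk φ a (f i) := by
  classical
  induction s using Finset.induction_on with
  | empty => simp [Ind.mk_zero]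
  | insert i s hi ih => rw [Finset.sum_insert hi, Finset.sum_insert hi, Ind.mk_add, ih]

theorem Ind.sum_mk {ι : Type} (s : Finset ι) (f : ι → A) (m : M) :
    Ind.mk φ (∑ i ∈ s, f i) m = ∑ i ∈ s, Ind.mk φ (f i) m := by
  classical
  induction s using Finset.induction_on with
  | empty => simp [Ind.zero_mk]
  | insert i s hi ih => rw [Finset.sum_insert hi, Finset.sum_insert hi, Ind.add_mk, ih]

theorem Ind.induction {p : Ind φ M → Prop} (z : Ind φ M) (h : ∀ a m, p (Ind.mk φ a m))
    (hadd : ∀ x y, p x → p y → p (x + y)) : p z := by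
  obtain ⟨t, rfl⟩ : ∃ t, Ind.quot φ t = z := (indRel φ M).mkQ_surjective z
  induction t using TensorProduct.induction_on with
  | zero =>
    have := h 0 0
    rwa [Ind.mk, TensorProduct.zero_tmul] at this
  | tmul a m => exact h a m
  | add x y hx hy => rw [map_add]; exact hadd _ _ hx hy

/-- The additive map out of `A ⊗ M` given by a biadditive map. -/
def Ind.preLift {A M N : Type} [Ring A] [AddCommGroup M] [AddCommGroup N] (f : A →+ M →+ N) :
    TensorProduct ℤ A M →+ N :=
  TensorProduct.liftAddHom f (fun r a m => by
    rw [map_zsmul, map_zsmul, AddMonoidHom.smul_apply])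

theorem Ind.preLift_tmul {A M N : Type} [Ring A] [AddCommGroup M] [AddCommGroup N]
    (f : A →+ M →+ N) (a : A) (m : M) : Ind.preLift f (TensorProduct.tmul ℤ a m) = f a m := rfl

/-- The additive map out of `A ⊗_B M` given by a balanced biadditive map. -/
def Ind.lift {N : Type} [AddCommGroup N] (f : A →+ M →+ N)
    (hf : ∀ a b m, f (a * φ b) m = f a (b • m)) : Ind φ M →+ N :=
  QuotientAddGroup.lift (indRel φ M).toAddSubgroup
    (Ind.preLift f) (by
      intro z hz
      have key : ∀ a : A, Ind.preLift f (a • z) = 0 := by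
        refine Submodule.span_induction (p := fun z _ => ∀ a : A,
          Ind.preLift f (a • z) = 0) ?_ ?_ ?_ ?_ hz
        · rintro _ ⟨a, b, m, rfl⟩ a'
          rw [smul_sub, map_sub, TensorProduct.smul_tmul', TensorProduct.smul_tmul',
            Ind.preLift_tmul, Ind.preLift_tmul, smul_eq_mul, smul_eq_mul,
            ← mul_assoc, hf, sub_self]
        · intro a; simp
        · intro x y _ _ hx hy a
          rw [smul_add, map_add, hx, hy, add_zero]
        · intro a x _ hx a'
          rw [smul_smul]; exact hx _
      have := key 1
      rwa [one_smul] at this)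

theorem Ind.lift_mk {N : Type} [AddCommGroup N] (f : A →+ M →+ N)
    (hf : ∀ a b m, f (a * φ b) m = f a (b • m)) (a : A) (m : M) :
    Ind.lift φ f hf (Ind.mk φ a m) = f a m := rfl

theorem Ind.smul_lift {N : Type} [AddCommGroup N] [Module A N] (f : A →+ M →+ N)
    (hf : ∀ a b m, f (a * φ b) m = f a (b • m)) (h : ∀ a a' m, f (a * a') m = a • f a' m)
    (a : A) (z : Ind φ M) : Ind.lift φ f hf (a • z) = a • Ind.lift φ f hf z := by
  induction z using Ind.induction with
  | h a' m => rw [Ind.smul_mk, Ind.lift_mk, Ind.lift_mk, h]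
  | hadd x y hx hy => rw [smul_add, map_add, map_add, hx, hy, smul_add]

/-- The `A`-linear map out of `A ⊗_B M` given by a map on `M` compatible with the `B`-action. -/
def Ind.liftₗ {N : Type} [AddCommGroup N] [Module A N] (f : M →+ N)
    (hf : ∀ b m, f (b • m) = φ b • f m) : Ind φ M →ₗ[A] N where
  toFun := Ind.lift φ ((AddMonoidHom.mk' (fun a => (DistribSMul.toAddMonoidHom N a).comp f)
    (fun a a' => by ext m; simp [add_smul]))) (fun a b m => by simp [hf, mul_smul])
  map_add' := map_add _
  map_smul' a z := Ind.smul_lift φ _ _ (fun a a' m => by simp [mul_smul]) a z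

theorem Ind.liftₗ_mk {N : Type} [AddCommGroup N] [Module A N] (f : M →+ N)
    (hf : ∀ b m, f (b • m) = φ b • f m) (a : A) (m : M) :
    Ind.liftₗ φ f hf (Ind.mk φ a m) = a • f m := rfl

/-- Induction of module maps: `1 ⊗ f`. -/
def Ind.map {N : Type} [AddCommGroup N] [Module B N] (f : M →ₗ[B] N) :
    Ind φ M →ₗ[A] Ind φ N :=
  Ind.liftₗ φ (AddMonoidHom.mk' (fun m => Ind.mk φ 1 (f m))
    (fun m m' => by rw [map_add, Ind.mk_add])) (fun b m => by
      simp [Ind.mk_smul, Ind.smul_mk])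

theorem Ind.map_mk {N : Type} [AddCommGroup N] [Module B N] (f : M →ₗ[B] N) (a : A) (m : M) :
    Ind.map φ f (Ind.mk φ a m) = Ind.mk φ a (f m) := by
  simp [Ind.map, Ind.liftₗ_mk, Ind.smul_mk]

/-- Restriction of module maps. -/
def Res.map {M N : Type} [AddCommGroup M] [Module A M] [AddCommGroup N] [Module A N]
    (f : M →ₗ[A] N) : Res φ M →ₗ[B] Res φ N where
  toFun m := Res.of φ (f (Res.un φ m))
  map_add' m m' := by rw [map_add, map_add, map_add]
  map_smul' b m := by rw [Res.un_smul, map_smul, RingHom.id_apply, Res.smul_of]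

theorem Res.map_of {M N : Type} [AddCommGroup M] [Module A M] [AddCommGroup N] [Module A N]
    (f : M →ₗ[A] N) (m : M) : Res.map φ f (Res.of φ m) = Res.of φ (f m) := rfl

instance [Module.Finite B M] : Module.Finite A (Ind φ M) := by
  obtain ⟨S, hS⟩ := (inferInstance : Module.Finite B M)
  classical
  refine ⟨⟨S.image (Ind.mk φ 1), ?_⟩⟩
  rw [eq_top_iff]
  rintro z -
  induction z using Ind.induction with
  | hadd x y hx hy => exact Submodule.add_mem _ hx hy
  | h a m =>
    have hm : m ∈ Submodule.span B (S : Set M) := hS ▸ Submodule.mem_top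
    have : ∀ a : A, Ind.mk φ a m ∈ Submodule.span A ((S.image (Ind.mk φ 1) : Finset _) : Set (Ind φ M)) := by
      refine Submodule.span_induction (p := fun m _ => ∀ a : A, Ind.mk φ a m ∈
        Submodule.span A ((S.image (Ind.mk φ 1) : Finset _) : Set (Ind φ M))) ?_ ?_ ?_ ?_ hm
      · intro m hm a
        have : Ind.mk φ a m = a • Ind.mk φ 1 m := by rw [Ind.smul_mk, mul_one]
        rw [this]
        exact Submodule.smul_mem _ _ (Submodule.subset_span
          (by simpa using ⟨m, hm, rfl⟩))
      · intro a; rw [Ind.mk_zero]; exact Submodule.zero_mem _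
      · intro x y _ _ hx hy a; rw [Ind.mk_add]; exact Submodule.add_mem _ (hx a) (hy a)
      · intro b x _ hx a; rw [Ind.mk_smul]; exact hx _
    exact this a

end Induction

/-! ### The tower of symmetric group algebras -/

/-- The group algebra `ℂ[S_n]`. -/
abbrev SymAlg (n : ℕ) : Type := MonoidAlgebra ℂ (Equiv.Perm (Fin n))

/-- The embedding `S_n → S_{n+1}` as the stabilizer of the last letter. -/
def permIncl (n : ℕ) : Equiv.Perm (Fin n) →* Equiv.Perm (Fin (n + 1)) :=
  Equiv.Perm.viaEmbeddingHom Fin.castSuccEmb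

theorem permIncl_castSucc {n : ℕ} (g : Equiv.Perm (Fin n)) (i : Fin n) :
    permIncl n g i.castSucc = (g i).castSucc :=
  Equiv.Perm.viaEmbedding_apply g Fin.castSuccEmb i

theorem permIncl_last {n : ℕ} (g : Equiv.Perm (Fin n)) :
    permIncl n g (Fin.last n) = Fin.last n :=
  Equiv.Perm.viaEmbedding_apply_of_notMem g Fin.castSuccEmb _ (by
    rintro ⟨i, hi⟩
    exact (Fin.castSucc_lt_last i).ne hi)

theorem permIncl_injective (n : ℕ) : Function.Injective (permIncl n) :=
  Equiv.Perm.viaEmbeddingHom_injective _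

theorem exists_permIncl {n : ℕ} (g : Equiv.Perm (Fin (n + 1))) (h : g (Fin.last n) = Fin.last n) :
    ∃ g', permIncl n g' = g := by
  have key : ∀ (g : Equiv.Perm (Fin (n + 1))), g (Fin.last n) = Fin.last n →
      ∀ i : Fin n, g i.castSucc ≠ Fin.last n := fun g h i hi =>
    (Fin.castSucc_lt_last i).ne (g.injective (hi.trans h.symm))
  have h' : g⁻¹ (Fin.last n) = Fin.last n := by rw [Equiv.Perm.inv_eq_iff_eq, h]
  refine ⟨⟨fun i => (g i.castSucc).castPred (key g h i),
    fun i => (g⁻¹ i.castSucc).castPred (key _ h' i), fun i => by simp, fun i => by simp⟩, ?_⟩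
  ext i
  induction i using Fin.lastCases with
  | last => rw [permIncl_last, h]
  | cast i => rw [permIncl_castSucc]; simp

/-- The inclusion of algebras `ℂ[S_n] → ℂ[S_{n+1}]`. -/
def incl (n : ℕ) : SymAlg n →+* SymAlg (n + 1) :=
  MonoidAlgebra.mapDomainRingHom ℂ (permIncl n)

theorem incl_single {n : ℕ} (g : Equiv.Perm (Fin n)) (c : ℂ) :
    incl n (MonoidAlgebra.single g c) = MonoidAlgebra.single (permIncl n g) c := by
  simp [incl]

/-- The projection `ℂ[S_{n+1}] → ℂ[S_n]` that kills the permutations outside `S_n`. -/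
def proj (n : ℕ) : SymAlg (n + 1) →+ SymAlg n where
  toFun x := MonoidAlgebra.comapDomain (permIncl n) (permIncl_injective n) x
  map_zero' := by ext; simp
  map_add' x y := by ext; simp

theorem proj_coeff {n : ℕ} (x : SymAlg (n + 1)) (g : Equiv.Perm (Fin n)) :
    (proj n x).coeff g = x.coeff (permIncl n g) := by
  simp [proj]

theorem proj_single_incl {n : ℕ} (g : Equiv.Perm (Fin n)) (c : ℂ) :
    proj n (MonoidAlgebra.single (permIncl n g) c) = MonoidAlgebra.single g c := by
  classical
  ext h
  rw [proj_coeff]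
  simp [MonoidAlgebra.coeff_single, Finsupp.single_apply, (permIncl_injective n).eq_iff]

theorem proj_single_of_ne {n : ℕ} (g : Equiv.Perm (Fin (n + 1))) (hg : g (Fin.last n) ≠ Fin.last n)
    (c : ℂ) : proj n (MonoidAlgebra.single g c) = 0 := by
  classical
  ext h
  rw [proj_coeff]
  rw [MonoidAlgebra.coeff_single, Finsupp.single_apply, if_neg]
  · rfl
  · rintro rfl
    exact hg (permIncl_last h)

theorem symAlg_induction {n : ℕ} {p : SymAlg n → Prop} (x : SymAlg n)
    (h : ∀ g c, p (MonoidAlgebra.single g c)) (hadd : ∀ x y, p x → p y → p (x + y)) : p x := by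
  induction x using MonoidAlgebra.induction_linear with
  | zero => simpa using h 1 0
  | add x y hx hy => exact hadd x y hx hy
  | single g c => exact h g c

theorem proj_incl {n : ℕ} (x : SymAlg n) : proj n (incl n x) = x := by
  induction x using symAlg_induction with
  | h g c => rw [incl_single, proj_single_incl]
  | hadd x y hx hy => rw [map_add, map_add, hx, hy]

theorem proj_one {n : ℕ} : proj n 1 = 1 := by
  have := proj_incl (1 : SymAlg n)
  rwa [map_one] at this

theorem proj_mul_incl {n : ℕ} (x : SymAlg (n + 1)) (y : SymAlg n) :
    proj n (x * incl n y) = proj n x * y := by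
  induction x using symAlg_induction with
  | hadd x x' hx hx' => rw [add_mul, map_add, hx, hx', map_add, add_mul]
  | h g c =>
    induction y using symAlg_induction with
    | hadd y y' hy hy' => rw [map_add, mul_add, map_add, hy, hy', mul_add]
    | h g' c' =>
      rw [incl_single, MonoidAlgebra.single_mul_single]
      by_cases hg : g (Fin.last n) = Fin.last n
      · obtain ⟨k, rfl⟩ := exists_permIncl g hg
        rw [← map_mul, proj_single_incl, proj_single_incl, MonoidAlgebra.single_mul_single]
      · rw [proj_single_of_ne _ hg, proj_single_of_ne, zero_mul]
        rwa [Equiv.Perm.mul_apply, permIncl_last]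

theorem proj_incl_mul {n : ℕ} (x : SymAlg n) (y : SymAlg (n + 1)) :
    proj n (incl n x * y) = x * proj n y := by
  induction y using symAlg_induction with
  | hadd y y' hy hy' => rw [mul_add, map_add, hy, hy', map_add, mul_add]
  | h g' c' =>
    induction x using symAlg_induction with
    | hadd x x' hx hx' => rw [map_add, add_mul, map_add, hx, hx', add_mul]
    | h g c =>
      rw [incl_single, MonoidAlgebra.single_mul_single]
      by_cases hg : g' (Fin.last n) = Fin.last n
      · obtain ⟨k, rfl⟩ := exists_permIncl g' hg
        rw [← map_mul, proj_single_incl, proj_single_incl, MonoidAlgebra.single_mul_single]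
      · rw [proj_single_of_ne _ hg, proj_single_of_ne, mul_zero]
        rw [Equiv.Perm.mul_apply]
        intro h
        exact hg ((permIncl n g).injective (h.trans (permIncl_last g).symm))

/-- The group element `g` of `ℂ[S_n]`. -/
abbrev elt {n : ℕ} (g : Equiv.Perm (Fin n)) : SymAlg n := MonoidAlgebra.single g 1

/-- The simple transposition of the last two letters, in `ℂ[S_{n+2}]`. -/
def lastSwap (n : ℕ) : SymAlg (n + 2) :=
  elt (Equiv.swap (Fin.last n).castSucc (Fin.last (n + 1)))

/-- The transposition of `i` and the last letter, in `ℂ[S_{n+1}]`; these are representatives of the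
left cosets of `S_n`. -/
def cosetRep {n : ℕ} (i : Fin (n + 1)) : SymAlg (n + 1) := elt (Equiv.swap i (Fin.last n))

theorem one_def' {n : ℕ} : (1 : SymAlg n) = elt 1 := rfl

theorem cosetRep_last {n : ℕ} : cosetRep (Fin.last n) = 1 := by
  simp [cosetRep, one_def']; rfl

theorem cosetRep_mul_self {n : ℕ} (i : Fin (n + 1)) : cosetRep i * cosetRep i = 1 := by
  simp [cosetRep, MonoidAlgebra.single_mul_single, Equiv.swap_mul_self]; rfl

theorem lastSwap_mul_self (n : ℕ) : lastSwap n * lastSwap n = 1 := by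
  simp [lastSwap, MonoidAlgebra.single_mul_single, Equiv.swap_mul_self]; rfl

theorem cosetRep_castSucc_last {n : ℕ} : cosetRep (Fin.last n).castSucc = lastSwap n := rfl

end HeisenbergTrace
end

noncomputable section

open CategoryTheory

namespace HeisenbergTrace

theorem elt_mul {n : ℕ} (g h : Equiv.Perm (Fin n)) (c : ℂ) :
    elt g * MonoidAlgebra.single h c = MonoidAlgebra.single (g * h) c := by
  rw [MonoidAlgebra.single_mul_single, one_mul]

theorem mul_elt {n : ℕ} (g h : Equiv.Perm (Fin n)) (c : ℂ) :
    MonoidAlgebra.single g c * elt h = MonoidAlgebra.single (g * h) c := by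
  rw [MonoidAlgebra.single_mul_single, mul_one]

theorem incl_proj_single {n : ℕ} (g : Equiv.Perm (Fin (n + 1))) (c : ℂ) :
    incl n (proj n (MonoidAlgebra.single g c)) =
      if g (Fin.last n) = Fin.last n then MonoidAlgebra.single g c else 0 := by
  split_ifs with h
  · obtain ⟨k, rfl⟩ := exists_permIncl g h
    rw [proj_single_incl, incl_single]
  · rw [proj_single_of_ne _ h, map_zero]

theorem incl_injective (n : ℕ) : Function.Injective (incl n) := fun x y h => by
  rw [← proj_incl x, h, proj_incl]

theorem sum_cosetRep {n : ℕ} (a : SymAlg (n + 1)) :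
    ∑ i, cosetRep i * incl n (proj n (cosetRep i * a)) = a := by
  induction a using symAlg_induction with
  | hadd x y hx hy =>
    simp only [mul_add, map_add, Finset.sum_add_distrib]
    rw [hx, hy]
  | h g c =>
    rw [Finset.sum_eq_single (g (Fin.last n))]
    · rw [cosetRep, elt_mul, incl_proj_single, if_pos, elt_mul, ← mul_assoc, Equiv.swap_mul_self,
        one_mul]
      simp
    · intro i _ hi
      rw [cosetRep, elt_mul, incl_proj_single, if_neg, mul_zero]
      rw [Equiv.Perm.mul_apply]
      intro h
      rw [Equiv.swap_apply_eq_iff, Equiv.swap_apply_right] at h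
      exact hi h.symm
    · simp

theorem sum_cosetRep' {n : ℕ} (a : SymAlg (n + 1)) :
    ∑ i, incl n (proj n (a * cosetRep i)) * cosetRep i = a := by
  induction a using symAlg_induction with
  | hadd x y hx hy =>
    simp only [add_mul, map_add, Finset.sum_add_distrib]
    rw [hx, hy]
  | h g c =>
    rw [Finset.sum_eq_single (g⁻¹ (Fin.last n))]
    · rw [cosetRep, mul_elt, incl_proj_single, if_pos, mul_elt, mul_assoc, Equiv.swap_mul_self,
        mul_one]
      simp
    · intro i _ hi
      rw [cosetRep, mul_elt, incl_proj_single, if_neg, zero_mul]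
      rw [Equiv.Perm.mul_apply, Equiv.swap_apply_right]
      rintro h
      exact hi (by rw [← h]; simp)
    · simp

theorem proj_cosetRep {n : ℕ} (i : Fin (n + 1)) :
    proj n (cosetRep i) = if i = Fin.last n then 1 else 0 := by
  split_ifs with h
  · rw [h, cosetRep_last, proj_one]
  · rw [cosetRep, elt, proj_single_of_ne]
    simpa using h

theorem proj_lastSwap (n : ℕ) : proj (n + 1) (lastSwap n) = 0 := by
  rw [← cosetRep_castSucc_last, proj_cosetRep, if_neg (Fin.castSucc_lt_last _).ne]

theorem incl_cosetRep {n : ℕ} (i : Fin (n + 1)) :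
    incl (n + 1) (cosetRep i) = elt (Equiv.swap i.castSucc (Fin.last n).castSucc) := by
  rw [cosetRep, incl_single]
  congr 1
  ext j
  induction j using Fin.lastCases with
  | last =>
    rw [permIncl_last, Equiv.swap_apply_of_ne_of_ne (Fin.castSucc_lt_last _).ne'
      (Fin.castSucc_lt_last _).ne']
  | cast j =>
    rw [permIncl_castSucc, Equiv.swap_apply_def, Equiv.swap_apply_def]
    simp only [Fin.castSucc_inj]
    split_ifs <;> rfl

theorem proj_swap_cosetRep_swap {n : ℕ} (i : Fin (n + 1)) :
    proj (n + 1) (lastSwap n * incl (n + 1) (cosetRep i) * lastSwap n) =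
      if i = Fin.last n then 1 else 0 := by
  split_ifs with h
  · rw [h, cosetRep_last, map_one, mul_one, lastSwap_mul_self, proj_one]
  · rw [incl_cosetRep, lastSwap, elt_mul, mul_elt, proj_single_of_ne]
    rw [Equiv.Perm.mul_apply, Equiv.Perm.mul_apply, Equiv.swap_apply_right, Equiv.swap_apply_right,
      Equiv.swap_apply_of_ne_of_ne]
    · exact (Fin.castSucc_lt_last _).ne
    · simpa using h
    · exact (Fin.castSucc_lt_last _).ne

theorem mackey {n : ℕ} (y : SymAlg (n + 2)) :
    ∑ i, incl (n + 1) (proj (n + 1) (y * incl (n + 1) (cosetRep i) * lastSwap n)) *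
      (lastSwap n * incl (n + 1) (cosetRep i)) + incl (n + 1) (proj (n + 1) y) = y := by
  induction y using symAlg_induction with
  | hadd x y hx hy =>
    simp only [add_mul, map_add, Finset.sum_add_distrib]
    nth_rewrite 3 [← hx]
    nth_rewrite 3 [← hy]
    abel
  | h g c =>
    have hval : ∀ i : Fin (n + 1), (g * Equiv.swap i.castSucc (Fin.last n).castSucc *
        Equiv.swap (Fin.last n).castSucc (Fin.last (n + 1))) (Fin.last (n + 1)) = g i.castSucc := by
      intro i
      rw [Equiv.Perm.mul_apply, Equiv.Perm.mul_apply, Equiv.swap_apply_right,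
        Equiv.swap_apply_right]
    have hterm : ∀ i : Fin (n + 1), incl (n + 1) (proj (n + 1)
        ((MonoidAlgebra.single g c : SymAlg (n + 2)) * incl (n + 1) (cosetRep i) * lastSwap n)) *
        (lastSwap n * incl (n + 1) (cosetRep i)) =
        if g i.castSucc = Fin.last (n + 1) then MonoidAlgebra.single g c else 0 := by
      intro i
      rw [incl_cosetRep, lastSwap, mul_elt, mul_elt, incl_proj_single, hval]
      split_ifs
      · rw [elt_mul, mul_elt]
        congr 1
        rw [mul_assoc, ← mul_assoc (Equiv.swap (Fin.last n).castSucc (Fin.last (n + 1))),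
          Equiv.swap_mul_self, one_mul, mul_assoc, Equiv.swap_mul_self, mul_one]
      · rw [zero_mul]
    simp only [hterm]
    rw [incl_proj_single]
    have := Fin.sum_univ_castSucc (fun j : Fin (n + 2) =>
      if g j = Fin.last (n + 1) then (MonoidAlgebra.single g c : SymAlg (n + 2)) else 0)
    rw [← this, Finset.sum_eq_single (g⁻¹ (Fin.last (n + 1)))]
    · simp
    · intro j _ hj
      rw [if_neg]
      rintro h
      exact hj (by rw [← h]; simp)
    · simp

theorem incl_proj_zero (y : SymAlg 1) : incl 0 (proj 0 y) = y := by
  induction y using symAlg_induction with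
  | hadd x y hx hy => rw [map_add, map_add, hx, hy]
  | h g c => rw [incl_proj_single, if_pos (Subsingleton.elim (α := Fin 1) _ _)]

theorem lastSwap_comm {n : ℕ} (h : SymAlg n) :
    lastSwap n * incl (n + 1) (incl n h) = incl (n + 1) (incl n h) * lastSwap n := by
  induction h using symAlg_induction with
  | hadd x y hx hy => rw [map_add, map_add, mul_add, add_mul, hx, hy]
  | h g c =>
    rw [incl_single, incl_single, lastSwap, elt_mul, mul_elt]
    congr 1
    rw [Equiv.mul_swap_eq_swap_mul, permIncl_last, permIncl_castSucc, permIncl_last]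

theorem lastSwap_braid (n : ℕ) :
    lastSwap (n + 1) * incl (n + 2) (lastSwap n) * lastSwap (n + 1) =
      incl (n + 2) (lastSwap n) * lastSwap (n + 1) * incl (n + 2) (lastSwap n) := by
  rw [← cosetRep_castSucc_last (n := n), incl_cosetRep, lastSwap, elt_mul, mul_elt, elt_mul,
    mul_elt]
  congr 1
  have hab : (Fin.last n).castSucc.castSucc ≠ (Fin.last (n + 1)).castSucc := by
    simp [Fin.ext_iff]
  have hbc : (Fin.last (n + 1)).castSucc ≠ Fin.last (n + 2) := by simp [Fin.ext_iff]
  have hac : (Fin.last n).castSucc.castSucc ≠ Fin.last (n + 2) := by simp [Fin.ext_iff]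
  generalize (Fin.last n).castSucc.castSucc = a at *
  generalize (Fin.last (n + 1)).castSucc = b at *
  generalize Fin.last (n + 2) = c at *
  refine Equiv.ext fun x => ?_
  simp only [Equiv.Perm.mul_apply, Equiv.swap_apply_def]
  split_ifs <;> simp_all

theorem proj_proj_cyclic {n : ℕ} (i : Fin (n + 1)) (j : Fin (n + 2)) :
    proj n (proj (n + 1) (cosetRep j * incl (n + 1) (cosetRep i) * lastSwap n)) =
      if j = i.castSucc then (if i = Fin.last n then 1 else 0) else 0 := by
  have hval : (Equiv.swap j (Fin.last (n + 1)) * Equiv.swap i.castSucc (Fin.last n).castSucc *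
      Equiv.swap (Fin.last n).castSucc (Fin.last (n + 1))) (Fin.last (n + 1)) =
      Equiv.swap j (Fin.last (n + 1)) i.castSucc := by
    rw [Equiv.Perm.mul_apply, Equiv.Perm.mul_apply, Equiv.swap_apply_right,
      Equiv.swap_apply_right]
  split_ifs with hj hi
  · subst hi hj
    rw [cosetRep_last, map_one, mul_one, cosetRep_castSucc_last, lastSwap_mul_self, proj_one,
      proj_one]
  · subst hj
    have h1 : (Equiv.swap i.castSucc (Fin.last (n + 1)) *
        Equiv.swap i.castSucc (Fin.last n).castSucc *
        Equiv.swap (Fin.last n).castSucc (Fin.last (n + 1))) =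
        permIncl (n + 1) (Equiv.swap i (Fin.last n)) := by
      have h2 : (elt (permIncl (n + 1) (Equiv.swap i (Fin.last n))) : SymAlg (n + 2)) = elt _ :=
        (incl_single _ _).symm.trans (incl_cosetRep i)
      have h3 := MonoidAlgebra.single_left_injective (one_ne_zero (α := ℂ)) h2
      rw [h3]
      have hab : i.castSucc ≠ (Fin.last n).castSucc := by simpa using hi
      have hac : i.castSucc ≠ Fin.last (n + 1) := (Fin.castSucc_lt_last _).ne
      have hbc : (Fin.last n).castSucc ≠ Fin.last (n + 1) := (Fin.castSucc_lt_last _).ne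
      generalize (Fin.last n).castSucc = b at *
      generalize Fin.last (n + 1) = c at *
      generalize i.castSucc = a at *
      have := Equiv.swap_mul_swap_mul_swap hab hac
      rw [← mul_left_inj (Equiv.swap b c), mul_assoc, Equiv.swap_mul_self, mul_one,
        ← mul_right_inj (Equiv.swap a c)]
      rw [← mul_assoc, Equiv.swap_mul_self, one_mul]
      ext x
      simp only [Equiv.Perm.mul_apply, Equiv.swap_apply_def]
      split_ifs <;> simp_all
    rw [incl_cosetRep, cosetRep, lastSwap, elt_mul, elt_mul, h1, proj_single_incl]
    rw [proj_single_of_ne]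
    simpa using hi
  · rw [incl_cosetRep, cosetRep, lastSwap, elt_mul, elt_mul, proj_single_of_ne, map_zero]
    rw [hval, Ne, Equiv.swap_apply_eq_iff, Equiv.swap_apply_right]
    exact fun h => hj h.symm

end HeisenbergTrace
end

noncomputable section

open CategoryTheory

namespace HeisenbergTrace

instance finite_res (n : ℕ) (M : Type) [AddCommGroup M] [Module (SymAlg (n + 1)) M]
    [Module.Finite (SymAlg (n + 1)) M] : Module.Finite (SymAlg n) (Res (incl n) M) := by
  let : Module (SymAlg n) (SymAlg (n + 1)) := Module.compHom _ (incl n)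
  let : Module (SymAlg (n + 1)) (Res (incl n) M) := inferInstanceAs (Module (SymAlg (n + 1)) M)
  have : Module.Finite (SymAlg (n + 1)) (Res (incl n) M) :=
    inferInstanceAs (Module.Finite (SymAlg (n + 1)) M)
  have : IsScalarTower (SymAlg n) (SymAlg (n + 1)) (Res (incl n) M) :=
    ⟨fun a b m => mul_smul (incl n a) b (m : M)⟩
  have : Module.Finite (SymAlg n) (SymAlg (n + 1)) := by
    classical
    refine ⟨⟨Finset.univ.image elt, ?_⟩⟩
    rw [eq_top_iff]
    rintro x -
    induction x using symAlg_induction with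
    | hadd x y hx hy => exact Submodule.add_mem _ hx hy
    | h g c =>
      have : (MonoidAlgebra.single g c : SymAlg (n + 1)) =
          (MonoidAlgebra.single 1 c : SymAlg n) • elt g := by
        change _ = incl n _ * _
        rw [incl_single, mul_elt, map_one, one_mul]
      rw [this]
      exact Submodule.smul_mem _ _ (Submodule.subset_span (by simp))
  exact Module.Finite.trans (SymAlg (n + 1)) (Res (incl n) M)

/-! ### The adjunction maps and the crossing, on the level of modules

With `Ind = ℂ[S_{n+1}] ⊗_{ℂ[S_n]} -` these are the maps induced by Khovanov's bimodule maps. -/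

section ModuleMaps

variable {n : ℕ} (M : Type) [AddCommGroup M]

/-- `M → Res Ind M`, `m ↦ 1 ⊗ m`. -/
def cupQPMap [Module (SymAlg n) M] : M →ₗ[SymAlg n] Res (incl n) (Ind (incl n) M) where
  toFun m := Res.of (incl n) (Ind.mk (incl n) 1 m)
  map_add' m m' := by rw [Ind.mk_add, map_add]
  map_smul' a m := by
    rw [Ind.mk_smul, one_mul, RingHom.id_apply, Res.smul_of, Ind.smul_mk, mul_one]

/-- `Ind Res M → M`, `a ⊗ m ↦ a m`. -/
def capPQMap [Module (SymAlg (n + 1)) M] :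
    Ind (incl n) (Res (incl n) M) →ₗ[SymAlg (n + 1)] M :=
  Ind.liftₗ (incl n) (Res.un (incl n)) (fun _ _ => rfl)

/-- `Res Ind M → M`, `a ⊗ m ↦ pr(a) m`, where `pr : ℂ[S_{n+1}] → ℂ[S_n]` is the projection. -/
def capQPMap [Module (SymAlg n) M] : Res (incl n) (Ind (incl n) M) →ₗ[SymAlg n] M where
  toFun z := Ind.lift (incl n)
    (AddMonoidHom.mk' (fun a => DistribSMul.toAddMonoidHom M (proj n a))
      (fun a a' => by ext m; simp [add_smul]))
    (fun a b m => by simp [proj_mul_incl, mul_smul]) (Res.un (incl n) z)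
  map_add' x y := by rw [map_add, map_add]
  map_smul' b z := by
    rw [Res.un_smul, RingHom.id_apply]
    generalize Res.un (incl n) z = w
    induction w using Ind.induction with
    | h a m =>
      rw [Ind.smul_mk, Ind.lift_mk, Ind.lift_mk]
      simp [proj_incl_mul, mul_smul]
    | hadd x y hx hy => rw [smul_add, map_add, map_add, hx, hy, smul_add]

variable {M} in
theorem sum_cosetRep_mk [Module (SymAlg (n + 1)) M] (a : SymAlg (n + 1)) (m : M) :
    ∑ i, Ind.mk (incl n) (cosetRep i) (Res.of (incl n) (cosetRep i • a • m)) =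
      ∑ i, Ind.mk (incl n) (a * cosetRep i) (Res.of (incl n) (cosetRep i • m)) := by
  have key : ∀ i : Fin (n + 1), Ind.mk (incl n) (a * cosetRep i)
      (Res.of (incl n) (cosetRep i • m)) = ∑ j, Ind.mk (incl n) (cosetRep j)
        (Res.of (incl n) (incl n (proj n (cosetRep j * (a * cosetRep i))) • cosetRep i • m)) := by
    intro i
    conv_lhs => rw [← sum_cosetRep (a * cosetRep i)]
    rw [Ind.sum_mk]
    refine Finset.sum_congr rfl fun j _ => ?_
    rw [← Res.smul_of, Ind.mk_smul]
  simp only [key]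
  rw [Finset.sum_comm]
  refine Finset.sum_congr rfl fun j _ => ?_
  rw [← Ind.mk_sum, ← map_sum]
  simp only [smul_smul, ← mul_assoc]
  rw [← Finset.sum_smul, sum_cosetRep']

/-- `M → Ind Res M`, `m ↦ ∑_x x ⊗ x⁻¹ m`, the sum over representatives `x` of the left cosets of
`S_n` in `S_{n+1}` (each chosen `x` is an involution). -/
def cupPQMap [Module (SymAlg (n + 1)) M] :
    M →ₗ[SymAlg (n + 1)] Ind (incl n) (Res (incl n) M) where
  toFun m := ∑ i, Ind.mk (incl n) (cosetRep i) (Res.of (incl n) (cosetRep i • m))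
  map_add' m m' := by
    rw [← Finset.sum_add_distrib]
    refine Finset.sum_congr rfl fun i _ => ?_
    rw [smul_add, map_add, Ind.mk_add]
  map_smul' a m := by
    rw [sum_cosetRep_mk, RingHom.id_apply, Finset.smul_sum]
    simp only [Ind.smul_mk]

/-- `M → Ind Ind M`, `m ↦ b s ⊗ 1 ⊗ m` for `b ∈ ℂ[S_{n+1}]`. -/
def crossAux [Module (SymAlg n) M] :
    SymAlg (n + 1) →+ M →+ Ind (incl (n + 1)) (Ind (incl n) M) :=
  AddMonoidHom.mk' (fun b => AddMonoidHom.mk'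
      (fun m => Ind.mk (incl (n + 1)) (incl (n + 1) b * lastSwap n) (Ind.mk (incl n) 1 m))
      (fun m m' => by rw [Ind.mk_add, Ind.mk_add]))
    (fun b b' => AddMonoidHom.ext fun m => by
      rw [AddMonoidHom.add_apply]
      change Ind.mk _ _ _ = Ind.mk _ _ _ + Ind.mk _ _ _
      rw [map_add, add_mul, Ind.add_mk])

variable {M} in
theorem crossAux_apply [Module (SymAlg n) M] (b : SymAlg (n + 1)) (m : M) : crossAux M b m =
    Ind.mk (incl (n + 1)) (incl (n + 1) b * lastSwap n) (Ind.mk (incl n) 1 m) := rfl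

/-- `Ind Ind M → Ind Ind M`, `a ⊗ b ⊗ m ↦ a b s ⊗ 1 ⊗ m` with `s` the last simple transposition. -/
def crossMap [Module (SymAlg n) M] : Ind (incl (n + 1)) (Ind (incl n) M) →ₗ[SymAlg (n + 2)]
    Ind (incl (n + 1)) (Ind (incl n) M) :=
  Ind.liftₗ (incl (n + 1))
    (Ind.lift (incl n) (crossAux M) (fun b h m => by
      rw [crossAux_apply, crossAux_apply, Ind.mk_smul, one_mul, map_mul, mul_assoc,
        ← lastSwap_comm, ← mul_assoc, ← Ind.mk_smul, Ind.smul_mk, mul_one]))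
    (fun b z => by
      induction z using Ind.induction with
      | h a m =>
        rw [Ind.smul_mk, Ind.lift_mk, Ind.lift_mk, crossAux_apply, crossAux_apply, Ind.smul_mk,
          map_mul, mul_assoc]
      | hadd x y hx hy => rw [smul_add, map_add, map_add, hx, hy, smul_add])

variable {M}

theorem cupQPMap_apply [Module (SymAlg n) M] (m : M) :
    cupQPMap M m = Res.of (incl n) (Ind.mk (incl n) 1 m) := rfl

theorem capPQMap_mk [Module (SymAlg (n + 1)) M] (a : SymAlg (n + 1)) (m : M) :
    capPQMap M (Ind.mk (incl n) a (Res.of (incl n) m)) = a • m := rfl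

theorem capQPMap_mk [Module (SymAlg n) M] (a : SymAlg (n + 1)) (m : M) :
    capQPMap M (Res.of (incl n) (Ind.mk (incl n) a m)) = proj n a • m := rfl

theorem cupPQMap_apply [Module (SymAlg (n + 1)) M] (m : M) : cupPQMap M m =
    ∑ i, Ind.mk (incl n) (cosetRep i) (Res.of (incl n) (cosetRep i • m)) := rfl

theorem crossMap_mk [Module (SymAlg n) M] (a : SymAlg (n + 2)) (b : SymAlg (n + 1)) (m : M) :
    crossMap M (Ind.mk (incl (n + 1)) a (Ind.mk (incl n) b m)) =
      Ind.mk (incl (n + 1)) (a * incl (n + 1) b * lastSwap n) (Ind.mk (incl n) 1 m) := by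
  rw [crossMap, Ind.liftₗ_mk, Ind.lift_mk, crossAux_apply, Ind.smul_mk, mul_assoc]

end ModuleMaps

end HeisenbergTrace
end

noncomputable section

open CategoryTheory

namespace HeisenbergTrace

theorem Ind.hom_ext {B A : Type} [Ring B] [Ring A] {φ : B →+* A} {M : Type} [AddCommGroup M]
    [Module B M] {N : Type} [AddCommGroup N] [Module A N] {f g : Ind φ M →ₗ[A] N}
    (h : ∀ a m, f (Ind.mk φ a m) = g (Ind.mk φ a m)) : f = g := by
  refine LinearMap.ext fun z => ?_
  induction z using Ind.induction with
  | h a m => exact h a m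
  | hadd x y hx hy => rw [map_add, map_add, hx, hy]

theorem Res.hom_ext {B A : Type} [Ring B] [Ring A] {φ : B →+* A} {M : Type} [AddCommGroup M]
    [Module A M] {N : Type} [AddCommGroup N] [Module B N] {f g : Res φ M →ₗ[B] N}
    (h : ∀ m, f (Res.of φ m) = g (Res.of φ m)) : f = g :=
  LinearMap.ext h

theorem Res.ind_hom_ext {B A C : Type} [Ring B] [Ring A] [Ring C] {φ : B →+* A} {ψ : C →+* A}
    {M : Type} [AddCommGroup M] [Module B M] {N : Type} [AddCommGroup N] [Module C N]
    {f g : Res ψ (Ind φ M) →ₗ[C] N}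
    (h : ∀ a m, f (Res.of ψ (Ind.mk φ a m)) = g (Res.of ψ (Ind.mk φ a m))) : f = g := by
  refine Res.hom_ext fun z => ?_
  induction z using Ind.induction with
  | h a m => exact h a m
  | hadd x y hx hy => rw [map_add, map_add, map_add, hx, hy]

instance {B A : Type} [Ring B] [Ring A] {φ : B →+* A} {M : Type} [AddCommGroup M]
    [Module B M] [Subsingleton M] : Subsingleton (Ind φ M) := by
  refine subsingleton_of_forall_eq 0 fun z => ?_
  induction z using Ind.induction with
  | h a m => rw [Subsingleton.elim m 0, Ind.mk_zero]
  | hadd x y hx hy => rw [hx, hy, add_zero]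

section ModuleMapIdentities

variable {n : ℕ}

section

variable {M N : Type} [AddCommGroup M] [AddCommGroup N]

theorem Ind.map_id [Module (SymAlg n) M] :
    Ind.map (incl n) (LinearMap.id : M →ₗ[SymAlg n] M) = LinearMap.id :=
  Ind.hom_ext fun _ _ => Ind.map_mk _ _ _ _

theorem Ind.map_comp {K : Type} [AddCommGroup K] [Module (SymAlg n) M] [Module (SymAlg n) N]
    [Module (SymAlg n) K] (f : M →ₗ[SymAlg n] N) (g : N →ₗ[SymAlg n] K) :
    Ind.map (incl n) (g ∘ₗ f) = Ind.map (incl n) g ∘ₗ Ind.map (incl n) f :=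
  Ind.hom_ext fun _ _ => by simp only [LinearMap.comp_apply, Ind.map_mk]

theorem Ind.map_add [Module (SymAlg n) M] [Module (SymAlg n) N] (f g : M →ₗ[SymAlg n] N) :
    Ind.map (incl n) (f + g) = Ind.map (incl n) f + Ind.map (incl n) g :=
  Ind.hom_ext fun _ _ => by simp only [LinearMap.add_apply, Ind.map_mk, Ind.mk_add]

theorem incl_algebraMap (c : ℂ) :
    incl n (algebraMap ℂ (SymAlg n) c) = algebraMap ℂ (SymAlg (n + 1)) c := by
  simp only [MonoidAlgebra.coe_algebraMap, Function.comp_apply, incl_single, map_one]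

theorem Ind.map_smul_apply [Module (SymAlg n) M] [Module (SymAlg n) N] (f g : M →ₗ[SymAlg n] N)
    (c : ℂ) (h : ∀ m, g m = algebraMap ℂ (SymAlg n) c • f m) (z : Ind (incl n) M) :
    Ind.map (incl n) g z = algebraMap ℂ (SymAlg (n + 1)) c • Ind.map (incl n) f z := by
  induction z using Ind.induction with
  | h a m => rw [Ind.map_mk, Ind.map_mk, Ind.smul_mk, h, Ind.mk_smul, incl_algebraMap,
      Algebra.commutes]
  | hadd x y hx hy => rw [_root_.map_add, _root_.map_add, hx, hy, smul_add]

theorem Res.map_smul_apply [Module (SymAlg (n + 1)) M] [Module (SymAlg (n + 1)) N]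
    (f g : M →ₗ[SymAlg (n + 1)] N) (c : ℂ) (h : ∀ m, g m = algebraMap ℂ (SymAlg (n + 1)) c • f m)
    (z : Res (incl n) M) :
    Res.map (incl n) g z = algebraMap ℂ (SymAlg n) c • Res.map (incl n) f z := by
  rw [← Res.of_un (incl n) z, Res.map_of, Res.map_of, Res.smul_of, incl_algebraMap, h]

theorem cupQPMap_natural [Module (SymAlg n) M] [Module (SymAlg n) N] (f : M →ₗ[SymAlg n] N) :
    cupQPMap N ∘ₗ f = Res.map (incl n) (Ind.map (incl n) f) ∘ₗ cupQPMap M :=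
  LinearMap.ext fun m => by
    simp only [LinearMap.comp_apply, cupQPMap_apply, Res.map_of, Ind.map_mk]

theorem capPQMap_natural [Module (SymAlg (n + 1)) M] [Module (SymAlg (n + 1)) N]
    (f : M →ₗ[SymAlg (n + 1)] N) :
    capPQMap N ∘ₗ Ind.map (incl n) (Res.map (incl n) f) = f ∘ₗ capPQMap M :=
  Ind.hom_ext fun a m => by
    rw [← Res.of_un (incl n) m]
    simp only [LinearMap.comp_apply, Ind.map_mk, Res.map_of, capPQMap_mk, map_smul]

theorem capQPMap_natural [Module (SymAlg n) M] [Module (SymAlg n) N] (f : M →ₗ[SymAlg n] N) :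
    capQPMap N ∘ₗ Res.map (incl n) (Ind.map (incl n) f) = f ∘ₗ capQPMap M :=
  Res.ind_hom_ext fun a m => by
    simp only [LinearMap.comp_apply, Ind.map_mk, Res.map_of, capQPMap_mk, map_smul]

theorem cupPQMap_natural [Module (SymAlg (n + 1)) M] [Module (SymAlg (n + 1)) N]
    (f : M →ₗ[SymAlg (n + 1)] N) :
    cupPQMap N ∘ₗ f = Ind.map (incl n) (Res.map (incl n) f) ∘ₗ cupPQMap M :=
  LinearMap.ext fun m => by
    simp only [LinearMap.comp_apply, cupPQMap_apply, map_sum, Ind.map_mk, Res.map_of, map_smul]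

theorem ind_ind_hom_ext [Module (SymAlg n) M] [Module (SymAlg (n + 2)) N]
    {f g : Ind (incl (n + 1)) (Ind (incl n) M) →ₗ[SymAlg (n + 2)] N}
    (h : ∀ a m, f (Ind.mk (incl (n + 1)) a (Ind.mk (incl n) 1 m)) =
      g (Ind.mk (incl (n + 1)) a (Ind.mk (incl n) 1 m))) : f = g :=
  Ind.hom_ext fun a z => by
    induction z using Ind.induction with
    | hadd x y hx hy => rw [Ind.mk_add, _root_.map_add, _root_.map_add, hx, hy]
    | h b m =>
      have : Ind.mk (incl n) b m = b • Ind.mk (incl n) 1 m := by rw [Ind.smul_mk, mul_one]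
      rw [this, Ind.mk_smul, h]

theorem crossMap_natural [Module (SymAlg n) M] [Module (SymAlg n) N] (f : M →ₗ[SymAlg n] N) :
    crossMap N ∘ₗ Ind.map (incl (n + 1)) (Ind.map (incl n) f) =
      Ind.map (incl (n + 1)) (Ind.map (incl n) f) ∘ₗ crossMap M :=
  ind_ind_hom_ext fun a m => by
    simp only [LinearMap.comp_apply, Ind.map_mk, crossMap_mk]

end

variable (M : Type) [AddCommGroup M]

theorem zigzag₁ [Module (SymAlg n) M] :
    capPQMap (Ind (incl n) M) ∘ₗ Ind.map (incl n) (cupQPMap M) = LinearMap.id :=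
  Ind.hom_ext fun a m => by
    rw [LinearMap.comp_apply, Ind.map_mk, cupQPMap_apply, capPQMap_mk, Ind.smul_mk, mul_one]
    rfl

theorem zigzag₂ [Module (SymAlg (n + 1)) M] :
    Res.map (incl n) (capPQMap M) ∘ₗ cupQPMap (Res (incl n) M) = LinearMap.id :=
  Res.hom_ext fun m => by
    rw [LinearMap.comp_apply, cupQPMap_apply, Res.map_of, capPQMap_mk, one_smul]
    rfl

theorem zigzag₃ [Module (SymAlg n) M] :
    Ind.map (incl n) (capQPMap M) ∘ₗ cupPQMap (Ind (incl n) M) = LinearMap.id :=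
  Ind.hom_ext fun a m => by
    rw [LinearMap.comp_apply, cupPQMap_apply, map_sum]
    simp only [Ind.smul_mk, Ind.map_mk, capQPMap_mk, Ind.mk_smul]
    rw [← Ind.sum_mk, sum_cosetRep]
    rfl

theorem zigzag₄ [Module (SymAlg (n + 1)) M] :
    capQPMap (Res (incl n) M) ∘ₗ Res.map (incl n) (cupPQMap M) = LinearMap.id :=
  Res.hom_ext fun m => by
    rw [LinearMap.comp_apply, Res.map_of, cupPQMap_apply, map_sum, map_sum]
    simp only [capQPMap_mk, proj_cosetRep, ite_smul, one_smul, zero_smul]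
    rw [Finset.sum_ite_eq' Finset.univ, if_pos (Finset.mem_univ _), cosetRep_last, one_smul]
    rfl

theorem crossMap_crossMap [Module (SymAlg n) M] : crossMap (n := n) M ∘ₗ crossMap M = LinearMap.id :=
  ind_ind_hom_ext fun a m => by
    rw [LinearMap.comp_apply, crossMap_mk, crossMap_mk, map_one, mul_one, mul_one, mul_assoc,
      lastSwap_mul_self, mul_one]
    rfl

theorem crossMap_braid [Module (SymAlg n) M] :
    crossMap (Ind (incl n) M) ∘ₗ Ind.map (incl (n + 2)) (crossMap M) ∘ₗ
        crossMap (Ind (incl n) M) =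
      Ind.map (incl (n + 2)) (crossMap M) ∘ₗ crossMap (Ind (incl n) M) ∘ₗ
        Ind.map (incl (n + 2)) (crossMap M) :=
  ind_ind_hom_ext fun a z => by
    induction z using Ind.induction with
    | hadd x y hx hy => simp only [Ind.mk_add, _root_.map_add, hx, hy]
    | h b m =>
      have h2 : Ind.mk (incl (n + 1)) 1 (Ind.mk (incl n) b m) =
          incl (n + 1) b • Ind.mk (incl (n + 1)) 1 (Ind.mk (incl n) 1 m) := by
        rw [Ind.smul_mk, mul_one, ← one_mul (incl (n + 1) b), ← Ind.mk_smul, Ind.smul_mk, mul_one]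
      rw [h2, Ind.mk_smul]
      generalize a * incl (n + 2) (incl (n + 1) b) = a
      have h3 : ∀ x : SymAlg (n + 2), Ind.mk (incl (n + 1)) x (Ind.mk (incl n) 1 m) =
          x • Ind.mk (incl (n + 1)) 1 (Ind.mk (incl n) 1 m) := fun x => by
        rw [Ind.smul_mk, mul_one]
      simp only [LinearMap.comp_apply, crossMap_mk, Ind.map_mk, map_one, mul_one]
      rw [h3 (1 * lastSwap n)]
      simp only [Ind.mk_smul, one_mul]
      rw [mul_assoc a, mul_assoc a, lastSwap_braid]
      simp only [mul_assoc]

theorem circle [Module (SymAlg n) M] : capQPMap (n := n) M ∘ₗ cupQPMap M = LinearMap.id :=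
  LinearMap.ext fun m => by
    rw [LinearMap.comp_apply, cupQPMap_apply, capQPMap_mk, proj_one, one_smul]
    rfl

theorem curl [Module (SymAlg n) M] :
    capQPMap (Ind (incl n) M) ∘ₗ Res.map (incl (n + 1)) (crossMap M) ∘ₗ
      cupQPMap (Ind (incl n) M) = 0 :=
  Ind.hom_ext fun a m => by
    rw [LinearMap.comp_apply, LinearMap.comp_apply, cupQPMap_apply, Res.map_of, crossMap_mk,
      capQPMap_mk, one_mul, proj_incl_mul, proj_lastSwap, mul_zero, zero_smul]
    rfl

/-- The sideways crossing `Ind Res → Res Ind`. -/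
def sideR [Module (SymAlg (n + 1)) M] : Ind (incl n) (Res (incl n) M) →ₗ[SymAlg (n + 1)]
    Res (incl (n + 1)) (Ind (incl (n + 1)) M) :=
  Res.map (incl (n + 1)) (Ind.map (incl (n + 1)) (capPQMap M) ∘ₗ crossMap (Res (incl n) M)) ∘ₗ
    cupQPMap (Ind (incl n) (Res (incl n) M))

variable {M} in
theorem sideR_mk [Module (SymAlg (n + 1)) M] (a : SymAlg (n + 1)) (m : M) :
    sideR M (Ind.mk (incl n) a (Res.of (incl n) m)) =
      Res.of (incl (n + 1)) (Ind.mk (incl (n + 1)) (incl (n + 1) a * lastSwap n) m) := by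
  rw [sideR, LinearMap.comp_apply, cupQPMap_apply, Res.map_of, LinearMap.comp_apply, crossMap_mk,
    Ind.map_mk, capPQMap_mk, one_mul, one_smul]

/-- The sideways crossing `Res Ind → Ind Res`. -/
def sideL [Module (SymAlg (n + 1)) M] : Res (incl (n + 1)) (Ind (incl (n + 1)) M)
    →ₗ[SymAlg (n + 1)] Ind (incl n) (Res (incl n) M) :=
  capQPMap (Ind (incl n) (Res (incl n) M)) ∘ₗ
    Res.map (incl (n + 1)) (crossMap (Res (incl n) M) ∘ₗ Ind.map (incl (n + 1)) (cupPQMap M))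

variable {M} in
theorem sideL_mk [Module (SymAlg (n + 1)) M] (y : SymAlg (n + 2)) (m : M) :
    sideL M (Res.of (incl (n + 1)) (Ind.mk (incl (n + 1)) y m)) =
      ∑ i, Ind.mk (incl n) (proj (n + 1) (y * incl (n + 1) (cosetRep i) * lastSwap n))
        (Res.of (incl n) (cosetRep i • m)) := by
  rw [sideL, LinearMap.comp_apply, Res.map_of, LinearMap.comp_apply, Ind.map_mk, cupPQMap_apply,
    Ind.mk_sum, map_sum, map_sum, map_sum]
  refine Finset.sum_congr rfl fun i _ => ?_
  rw [crossMap_mk, capQPMap_mk, Ind.smul_mk, mul_one]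

theorem sideL_sideR [Module (SymAlg (n + 1)) M] : sideL (n := n) M ∘ₗ sideR M = LinearMap.id :=
  Ind.hom_ext fun a m => by
    rw [← Res.of_un (incl n) m, LinearMap.comp_apply, sideR_mk, sideL_mk]
    simp only [mul_assoc, proj_incl_mul]
    simp only [← mul_assoc, proj_swap_cosetRep_swap]
    rw [Finset.sum_eq_single (Fin.last n)]
    · rw [if_pos rfl, mul_one, cosetRep_last, one_smul]
      rfl
    · intro i _ hi
      rw [if_neg hi, mul_zero, Ind.zero_mk]
    · simp

theorem sideR_sideL [Module (SymAlg (n + 1)) M] :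
    sideR (n := n) M ∘ₗ sideL M + cupQPMap M ∘ₗ capQPMap M = LinearMap.id :=
  Res.ind_hom_ext fun y m => by
    rw [LinearMap.add_apply, LinearMap.comp_apply, LinearMap.comp_apply, sideL_mk, map_sum,
      capQPMap_mk, cupQPMap_apply, Ind.mk_smul, one_mul]
    simp only [sideR_mk, Ind.mk_smul]
    rw [← map_sum, ← Ind.sum_mk, ← _root_.map_add, ← Ind.add_mk]
    simp only [mul_assoc]
    rw [LinearMap.id_apply]
    conv_rhs => rw [← mackey y]
    simp only [mul_assoc]

theorem cup_cap_zero [Module (SymAlg 0) M] :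
    cupQPMap (n := 0) M ∘ₗ capQPMap (n := 0) M = LinearMap.id :=
  Res.ind_hom_ext fun y m => by
    rw [LinearMap.comp_apply, capQPMap_mk, cupQPMap_apply, Ind.mk_smul, one_mul, incl_proj_zero]
    rfl

variable {M} in
theorem cyclic_right [Module (SymAlg (n + 2)) M] (m : M) :
    (Res.map (incl n) (Res.map (incl (n + 1)) (capPQMap M) ∘ₗ sideR (Res (incl (n + 1)) M)) ∘ₗ
      cupQPMap (Res (incl n) (Res (incl (n + 1)) M)))
        (Res.of (incl n) (Res.of (incl (n + 1)) m)) =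
      Res.of (incl n) (Res.of (incl (n + 1)) (lastSwap n • m)) := by
  rw [LinearMap.comp_apply, cupQPMap_apply, Res.map_of, LinearMap.comp_apply, sideR_mk,
    Res.map_of, capPQMap_mk, map_one, one_mul]

variable {M} in
theorem cyclic_left [Module (SymAlg (n + 2)) M] (m : M) :
    (capQPMap (Res (incl n) (Res (incl (n + 1)) M)) ∘ₗ
      Res.map (incl n) (sideL (Res (incl (n + 1)) M) ∘ₗ Res.map (incl (n + 1)) (cupPQMap M)))
        (Res.of (incl n) (Res.of (incl (n + 1)) m)) =
      Res.of (incl n) (Res.of (incl (n + 1)) (lastSwap n • m)) := by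
  rw [LinearMap.comp_apply, Res.map_of, LinearMap.comp_apply, Res.map_of, cupPQMap_apply]
  simp only [map_sum, sideL_mk, capQPMap_mk, proj_proj_cyclic]
  rw [Finset.sum_eq_single (Fin.last n).castSucc, Finset.sum_eq_single (Fin.last n)]
  · rw [if_pos rfl, if_pos rfl, one_smul, cosetRep_last, one_smul, cosetRep_castSucc_last]
  · intro i _ hi
    rw [if_neg, zero_smul]
    exact fun h => hi (by simpa using h.symm)
  · simp
  · intro j _ hj
    refine Finset.sum_eq_zero fun i _ => ?_
    split_ifs with h1 h2
    · subst h2; exact absurd h1 hj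
    · exact zero_smul _ _
    · exact zero_smul _ _
  · simp

theorem cyclic [Module (SymAlg (n + 2)) M] :
    Res.map (incl n) (Res.map (incl (n + 1)) (capPQMap M) ∘ₗ sideR (Res (incl (n + 1)) M)) ∘ₗ
      cupQPMap (Res (incl n) (Res (incl (n + 1)) M)) =
    capQPMap (Res (incl n) (Res (incl (n + 1)) M)) ∘ₗ
      Res.map (incl n) (sideL (Res (incl (n + 1)) M) ∘ₗ Res.map (incl (n + 1)) (cupPQMap M)) :=
  Res.hom_ext fun m => by
    rw [← Res.of_un (incl (n + 1)) m, cyclic_right, cyclic_left]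

end ModuleMapIdentities

end HeisenbergTrace
end

noncomputable section

open CategoryTheory

namespace HeisenbergTrace

/-! ### The category `⊕_n ℂ[S_n]-mod` -/

/-- An object of `⊕_n ℂ[S_n]-mod`: a sequence of finitely generated (equivalently, finite
dimensional) `ℂ[S_n]`-modules, almost all of them zero. -/
structure SymMod : Type 1 where
  /-- the component over `ℂ[S_n]` -/
  obj (n : ℕ) : FGModuleCat.{0} (SymAlg n)
  finite : ∃ N, ∀ n, N ≤ n → Subsingleton (obj n)

namespace SymMod

instance : Category SymMod where
  Hom M N := ∀ n, M.obj n ⟶ N.obj n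
  id M n := 𝟙 (M.obj n)
  comp f g n := f n ≫ g n

variable {M N K : SymMod}

@[ext] theorem hom_ext {f g : M ⟶ N} (h : ∀ n, f n = g n) : f = g := funext h

@[simp] theorem id_app (n : ℕ) : (𝟙 M : M ⟶ M) n = 𝟙 (M.obj n) := rfl

@[simp] theorem comp_app (f : M ⟶ N) (g : N ⟶ K) (n : ℕ) : (f ≫ g) n = f n ≫ g n := rfl

instance : Preadditive SymMod where
  homGroup M N := inferInstanceAs (AddCommGroup (∀ n, M.obj n ⟶ N.obj n))
  add_comp _ _ _ f f' g := by
    ext1 n; exact Preadditive.add_comp _ _ _ (f n) (f' n) (g n)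
  comp_add _ _ _ f g g' := by
    ext1 n; exact Preadditive.comp_add _ _ _ (f n) (g n) (g' n)

@[simp] theorem add_app (f g : M ⟶ N) (n : ℕ) : (f + g) n = f n + g n := rfl

@[simp] theorem zero_app (n : ℕ) : (0 : M ⟶ N) n = 0 := rfl

instance : Linear ℂ SymMod where
  homModule M N := inferInstanceAs (Module ℂ (∀ n, M.obj n ⟶ N.obj n))
  smul_comp _ _ _ c f g := by
    ext1 n; exact Linear.smul_comp _ _ _ c (f n) (g n)
  comp_smul _ _ _ f c g := by
    ext1 n; exact Linear.comp_smul _ _ _ (f n) c (g n)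

@[simp] theorem smul_app (c : ℂ) (f : M ⟶ N) (n : ℕ) : (c • f) n = c • f n := rfl

/-- The components of the induced object: `0` in degree `0`, `Ind M_n` in degree `n + 1`. -/
def indObj (M : SymMod) : ∀ n, FGModuleCat.{0} (SymAlg n)
  | 0 => FGModuleCat.of (SymAlg 0) PUnit
  | n + 1 => FGModuleCat.of (SymAlg (n + 1)) (Ind (incl n) (M.obj n))

instance (M : SymMod) : Subsingleton (indObj M 0) := inferInstanceAs (Subsingleton PUnit)

theorem zero_hom_ext {m : ℕ} {X Y : FGModuleCat.{0} (SymAlg m)} [Subsingleton X] (f g : X ⟶ Y) :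
    f = g :=
  FGModuleCat.hom_ext (LinearMap.ext fun x => by
    rw [Subsingleton.elim x 0]; exact (map_zero f.hom.hom).trans (map_zero g.hom.hom).symm)

theorem hom_zero_ext {m : ℕ} {X Y : FGModuleCat.{0} (SymAlg m)} [Subsingleton Y] (f g : X ⟶ Y) :
    f = g :=
  FGModuleCat.hom_ext (LinearMap.ext fun _ => Subsingleton.elim (α := Y) _ _)

/-- The induction functor `M ↦ ℂ[S_{n+1}] ⊗_{ℂ[S_n]} M`. -/
def ind : SymMod ⥤ SymMod where
  obj M :=
    { obj := indObj M
      finite := by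
        obtain ⟨N, hN⟩ := M.finite
        refine ⟨N + 1, fun n hn => ?_⟩
        obtain ⟨n, rfl⟩ : ∃ k, n = k + 1 := ⟨n - 1, by omega⟩
        have := hN n (by omega)
        exact inferInstanceAs (Subsingleton (Ind (incl n) (M.obj n))) }
  map f n := match n with
    | 0 => 𝟙 _
    | n + 1 => FGModuleCat.ofHom (Ind.map (incl n) (f n).hom.hom)
  map_id M := by
    ext1 n
    cases n with
    | zero => rfl
    | succ n => exact FGModuleCat.hom_ext Ind.map_id
  map_comp f g := by
    ext1 n
    cases n with
    | zero => rfl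
    | succ n => exact FGModuleCat.hom_ext (Ind.map_comp _ _)

/-- The restriction functor from `ℂ[S_{n+1}]`-modules to `ℂ[S_n]`-modules, which is zero on
`ℂ[S_0]`-modules. -/
def res : SymMod ⥤ SymMod where
  obj M :=
    { obj := fun n => FGModuleCat.of (SymAlg n) (Res (incl n) (M.obj (n + 1)))
      finite := by
        obtain ⟨N, hN⟩ := M.finite
        exact ⟨N, fun n hn => hN (n + 1) (by omega)⟩ }
  map f n := FGModuleCat.ofHom (Res.map (incl n) (f (n + 1)).hom.hom)
  map_id M := rfl
  map_comp f g := rfl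

instance : ind.Additive where
  map_add {M N f g} := by
    ext1 n
    cases n with
    | zero => exact zero_hom_ext (X := indObj M 0) _ _
    | succ n => exact FGModuleCat.hom_ext (Ind.map_add (f n).hom.hom (g n).hom.hom)

instance : ind.Linear ℂ where
  map_smul {M N} f c := by
    ext1 n
    cases n with
    | zero => exact zero_hom_ext (X := indObj M 0) _ _
    | succ n =>
      exact FGModuleCat.hom_ext (LinearMap.ext fun z =>
        Ind.map_smul_apply (f n).hom.hom (c • f n).hom.hom c (fun _ => rfl) z)

instance : res.Additive where
  map_add := rfl

instance : res.Linear ℂ where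
  map_smul {M N} f c := by
    ext1 n
    exact FGModuleCat.hom_ext (LinearMap.ext fun z =>
      Res.map_smul_apply (f (n + 1)).hom.hom (c • f (n + 1)).hom.hom c (fun _ => rfl) z)

/-- `1 → Res Ind`: the unit of the adjunction `Ind ⊣ Res`. -/
def cupQP : 𝟭 SymMod ⟶ ind ⋙ res where
  app M n := FGModuleCat.ofHom (cupQPMap (M.obj n))
  naturality M N f := by
    ext1 n
    exact FGModuleCat.hom_ext (cupQPMap_natural (f n).hom.hom)

/-- `Ind Res → 1`: the counit of the adjunction `Ind ⊣ Res`. -/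
def capPQ : res ⋙ ind ⟶ 𝟭 SymMod where
  app M n := match n with
    | 0 => 0
    | n + 1 => FGModuleCat.ofHom (capPQMap (M.obj (n + 1)))
  naturality M N f := by
    ext1 n
    cases n with
    | zero => exact zero_hom_ext (X := indObj (res.obj M) 0) _ _
    | succ n => exact FGModuleCat.hom_ext (capPQMap_natural (f (n + 1)).hom.hom)

/-- `Res Ind → 1`: the counit of the adjunction `Res ⊣ Ind`. -/
def capQP : ind ⋙ res ⟶ 𝟭 SymMod where
  app M n := FGModuleCat.ofHom (capQPMap (M.obj n))
  naturality M N f := by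
    ext1 n
    exact FGModuleCat.hom_ext (capQPMap_natural (f n).hom.hom)

/-- `1 → Ind Res`: the unit of the adjunction `Res ⊣ Ind`. -/
def cupPQ : 𝟭 SymMod ⟶ res ⋙ ind where
  app M n := match n with
    | 0 => 0
    | n + 1 => FGModuleCat.ofHom (cupPQMap (M.obj (n + 1)))
  naturality M N f := by
    ext1 n
    cases n with
    | zero => exact hom_zero_ext (Y := indObj (res.obj N) 0) _ _
    | succ n => exact FGModuleCat.hom_ext (cupPQMap_natural (f (n + 1)).hom.hom)

instance (M : SymMod) : Subsingleton (indObj (ind.obj M) 1) :=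
  inferInstanceAs (Subsingleton (Ind (incl 0) PUnit))

/-- The crossing `Ind Ind → Ind Ind`: right multiplication by the last simple transposition of
`S_{n+2}` on the bimodule `ℂ[S_{n+2}]`. -/
def cross : ind ⋙ ind ⟶ ind ⋙ ind where
  app M n := match n with
    | 0 => 𝟙 _
    | 1 => 𝟙 _
    | n + 2 => FGModuleCat.ofHom (crossMap (M.obj n))
  naturality M N f := by
    ext1 n
    match n with
    | 0 => exact zero_hom_ext (X := indObj (ind.obj M) 0) _ _
    | 1 => exact zero_hom_ext (X := indObj (ind.obj M) 1) _ _
    | n + 2 => exact FGModuleCat.hom_ext (crossMap_natural (f n).hom.hom)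

variable (M : SymMod)

theorem zigzag_P : ind.map (cupQP.app M) ≫ capPQ.app (ind.obj M) = 𝟙 (ind.obj M) := by
  ext1 n
  cases n with
  | zero => exact zero_hom_ext (X := indObj M 0) _ _
  | succ n => exact FGModuleCat.hom_ext (zigzag₁ (M.obj n))

theorem zigzag_Q : cupQP.app (res.obj M) ≫ res.map (capPQ.app M) = 𝟙 (res.obj M) := by
  ext1 n
  exact FGModuleCat.hom_ext (zigzag₂ (M.obj (n + 1)))

theorem zigzag_P' : cupPQ.app (ind.obj M) ≫ ind.map (capQP.app M) = 𝟙 (ind.obj M) := by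
  ext1 n
  cases n with
  | zero => exact zero_hom_ext (X := indObj M 0) _ _
  | succ n => exact FGModuleCat.hom_ext (zigzag₃ (M.obj n))

theorem zigzag_Q' : res.map (cupPQ.app M) ≫ capQP.app (res.obj M) = 𝟙 (res.obj M) := by
  ext1 n
  exact FGModuleCat.hom_ext (zigzag₄ (M.obj (n + 1)))

theorem cross_cross : cross.app M ≫ cross.app M = 𝟙 (ind.obj (ind.obj M)) := by
  ext1 n
  match n with
  | 0 => exact zero_hom_ext (X := indObj (ind.obj M) 0) _ _
  | 1 => exact zero_hom_ext (X := indObj (ind.obj M) 1) _ _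
  | n + 2 => exact FGModuleCat.hom_ext (crossMap_crossMap (M.obj n))

instance (M : SymMod) : Subsingleton (indObj (ind.obj (ind.obj M)) 1) :=
  inferInstanceAs (Subsingleton (Ind (incl 0) PUnit))

instance (M : SymMod) : Subsingleton (indObj (ind.obj (ind.obj M)) 2) :=
  inferInstanceAs (Subsingleton (Ind (incl 1) (Ind (incl 0) PUnit)))

theorem cross_braid : cross.app (ind.obj M) ≫ ind.map (cross.app M) ≫ cross.app (ind.obj M) =
    ind.map (cross.app M) ≫ cross.app (ind.obj M) ≫ ind.map (cross.app M) := by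
  ext1 n
  match n with
  | 0 => exact zero_hom_ext (X := indObj (ind.obj (ind.obj M)) 0) _ _
  | 1 => exact zero_hom_ext (X := indObj (ind.obj (ind.obj M)) 1) _ _
  | 2 => exact zero_hom_ext (X := indObj (ind.obj (ind.obj M)) 2) _ _
  | n + 3 => exact FGModuleCat.hom_ext (crossMap_braid (M.obj n))

theorem circle_eq : cupQP.app M ≫ capQP.app M = 𝟙 M := by
  ext1 n
  exact FGModuleCat.hom_ext (circle (M.obj n))

theorem curl_eq : cupQP.app (ind.obj M) ≫ res.map (cross.app M) ≫ capQP.app (ind.obj M) = 0 := by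
  ext1 n
  cases n with
  | zero => exact zero_hom_ext (X := indObj M 0) _ _
  | succ n => exact FGModuleCat.hom_ext (curl (M.obj n))

/-- The sideways crossing `Ind Res → Res Ind`. -/
def crossR (M : SymMod) : ind.obj (res.obj M) ⟶ res.obj (ind.obj M) :=
  cupQP.app (ind.obj (res.obj M)) ≫ res.map (cross.app (res.obj M) ≫ ind.map (capPQ.app M))

/-- The sideways crossing `Res Ind → Ind Res`. -/
def crossL (M : SymMod) : res.obj (ind.obj M) ⟶ ind.obj (res.obj M) :=
  res.map (ind.map (cupPQ.app M) ≫ cross.app (res.obj M)) ≫ capQP.app (ind.obj (res.obj M))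

theorem crossR_crossL : crossR M ≫ crossL M = 𝟙 _ := by
  ext1 n
  cases n with
  | zero => exact zero_hom_ext (X := indObj (res.obj M) 0) _ _
  | succ n => exact FGModuleCat.hom_ext (sideL_sideR (M.obj (n + 1)))

theorem crossL_crossR : crossL M ≫ crossR M +
    (capQP.app M ≫ cupQP.app M : res.obj (ind.obj M) ⟶ res.obj (ind.obj M)) = 𝟙 _ := by
  ext1 n
  cases n with
  | zero =>
    have h : (crossL M ≫ crossR M) 0 = 0 := by
      rw [comp_app, hom_zero_ext (Y := indObj (res.obj M) 0) (crossL M 0) 0]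
      exact Limits.zero_comp
    rw [add_app, h, zero_add]
    exact FGModuleCat.hom_ext (cup_cap_zero (M.obj 0))
  | succ n => exact FGModuleCat.hom_ext (sideR_sideL (M.obj (n + 1)))

theorem cyclic_eq : cupQP.app (res.obj (res.obj M)) ≫
      res.map (crossR (res.obj M) ≫ res.map (capPQ.app M)) =
    res.map (res.map (cupPQ.app M) ≫ crossL (res.obj M)) ≫ capQP.app (res.obj (res.obj M)) := by
  ext1 n
  exact FGModuleCat.hom_ext (cyclic (M.obj (n + 2)))

end SymMod

end HeisenbergTrace
end

noncomputable section

open CategoryTheory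

namespace HeisenbergTrace

/-! ### Khovanov's category `H'`

`H'` is presented as the additive `ℂ`-linear monoidal category generated by two objects `P`, `Q`,
by the crossing, the cups and the caps, subject to planar isotopy and to the local relations.
Tensor products of objects are kept bracketed and direct sums are adjoined formally; this is the
non-strict form of the strict additive category and is monoidally equivalent to it. -/

/-- Objects of `H'`: formal finite direct sums of bracketed words in `P` and `Q`. -/
inductive HPrime : Type
  | unit : HPrime
  | P : HPrime
  | Q : HPrime
  | tensor : HPrime → HPrime → HPrime
  | zero : HPrime
  | sum : HPrime → HPrime → HPrime

namespace HPrime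

local infixr:70 " ⊠ " => HPrime.tensor

/-- Formal morphisms of `H'`, before imposing relations. The composition `comp f g` is `g` placed
on top of `f`. -/
inductive Diag : HPrime → HPrime → Type
  | id (X : HPrime) : Diag X X
  | comp {X Y Z : HPrime} (f : Diag X Y) (g : Diag Y Z) : Diag X Z
  | whiskerLeft (X : HPrime) {Y Z : HPrime} (f : Diag Y Z) : Diag (X ⊠ Y) (X ⊠ Z)
  | whiskerRight {X Y : HPrime} (f : Diag X Y) (Z : HPrime) : Diag (X ⊠ Z) (Y ⊠ Z)
  | assoc (X Y Z : HPrime) : Diag ((X ⊠ Y) ⊠ Z) (X ⊠ Y ⊠ Z)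
  | assocInv (X Y Z : HPrime) : Diag (X ⊠ Y ⊠ Z) ((X ⊠ Y) ⊠ Z)
  | lunit (X : HPrime) : Diag (unit ⊠ X) X
  | lunitInv (X : HPrime) : Diag X (unit ⊠ X)
  | runit (X : HPrime) : Diag (X ⊠ unit) X
  | runitInv (X : HPrime) : Diag X (X ⊠ unit)
  | zero (X Y : HPrime) : Diag X Y
  | add {X Y : HPrime} (f g : Diag X Y) : Diag X Y
  | smul {X Y : HPrime} (c : ℂ) (f : Diag X Y) : Diag X Y
  | inl (X Y : HPrime) : Diag X (sum X Y)
  | inr (X Y : HPrime) : Diag Y (sum X Y)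
  | fst (X Y : HPrime) : Diag (sum X Y) X
  | snd (X Y : HPrime) : Diag (sum X Y) Y
  /-- the crossing of two upward strands -/
  | cross : Diag (P ⊠ P) (P ⊠ P)
  /-- the cup whose right end points up -/
  | cupQP : Diag unit (Q ⊠ P)
  /-- the cap joining an upward strand on the left to a downward strand on the right -/
  | capPQ : Diag (P ⊠ Q) unit
  /-- the cup whose left end points up -/
  | cupPQ : Diag unit (P ⊠ Q)
  /-- the cap joining a downward strand on the left to an upward strand on the right -/
  | capQP : Diag (Q ⊠ P) unit

namespace Diag

local infixr:60 " ⊚ " => Diag.comp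

/-- The clockwise rotation of `f : P ⊗ X → Y ⊗ P` to `X ⊗ Q → Q ⊗ Y`: the lower left end is bent up
by a cup and the upper right end is bent down by a cap. -/
def rotR {X Y : HPrime} (f : Diag (P ⊠ X) (Y ⊠ P)) : Diag (X ⊠ Q) (Q ⊠ Y) :=
  lunitInv (X ⊠ Q) ⊚ whiskerRight cupQP (X ⊠ Q) ⊚ assoc Q P (X ⊠ Q) ⊚
    whiskerLeft Q (assocInv P X Q ⊚ whiskerRight f Q ⊚ assoc Y P Q ⊚ whiskerLeft Y capPQ ⊚ runit Y)

/-- The counterclockwise rotation of `f : X ⊗ P → P ⊗ Y` to `Q ⊗ X → Y ⊗ Q`: the lower right end is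
bent up by a cup and the upper left end is bent down by a cap. -/
def rotL {X Y : HPrime} (f : Diag (X ⊠ P) (P ⊠ Y)) : Diag (Q ⊠ X) (Y ⊠ Q) :=
  whiskerLeft Q (runitInv X ⊚ whiskerLeft X cupPQ ⊚ assocInv X P Q ⊚ whiskerRight f Q ⊚
    assoc P Y Q) ⊚ assocInv Q P (Y ⊠ Q) ⊚ whiskerRight capQP (Y ⊠ Q) ⊚ lunit (Y ⊠ Q)

/-- The sideways crossing `PQ → QP`. -/
def crossPQ : Diag (P ⊠ Q) (Q ⊠ P) := rotR cross

/-- The sideways crossing `QP → PQ`. -/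
def crossQP : Diag (Q ⊠ P) (P ⊠ Q) := rotL cross

/-- The relations of `H'`. -/
inductive Rel : {X Y : HPrime} → Diag X Y → Diag X Y → Prop
  -- congruence
  | refl {X Y : HPrime} (f : Diag X Y) : Rel f f
  | symm {X Y : HPrime} {f g : Diag X Y} : Rel f g → Rel g f
  | trans {X Y : HPrime} {f g h : Diag X Y} : Rel f g → Rel g h → Rel f h
  | comp_congr {X Y Z : HPrime} {f f' : Diag X Y} {g g' : Diag Y Z} :
      Rel f f' → Rel g g' → Rel (f ⊚ g) (f' ⊚ g')
  | whiskerLeft_congr (X : HPrime) {Y Z : HPrime} {f f' : Diag Y Z} :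
      Rel f f' → Rel (whiskerLeft X f) (whiskerLeft X f')
  | whiskerRight_congr {X Y : HPrime} {f f' : Diag X Y} (Z : HPrime) :
      Rel f f' → Rel (whiskerRight f Z) (whiskerRight f' Z)
  | add_congr {X Y : HPrime} {f f' g g' : Diag X Y} :
      Rel f f' → Rel g g' → Rel (add f g) (add f' g')
  | smul_congr {X Y : HPrime} (c : ℂ) {f f' : Diag X Y} : Rel f f' → Rel (smul c f) (smul c f')
  -- `ℂ`-linear category
  | id_comp {X Y : HPrime} (f : Diag X Y) : Rel (id X ⊚ f) f
  | comp_id {X Y : HPrime} (f : Diag X Y) : Rel (f ⊚ id Y) f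
  | comp_assoc {X Y Z W : HPrime} (f : Diag X Y) (g : Diag Y Z) (h : Diag Z W) :
      Rel ((f ⊚ g) ⊚ h) (f ⊚ g ⊚ h)
  | add_assoc {X Y : HPrime} (f g h : Diag X Y) : Rel (add (add f g) h) (add f (add g h))
  | add_comm {X Y : HPrime} (f g : Diag X Y) : Rel (add f g) (add g f)
  | zero_add {X Y : HPrime} (f : Diag X Y) : Rel (add (zero X Y) f) f
  | one_smul {X Y : HPrime} (f : Diag X Y) : Rel (smul 1 f) f
  | zero_smul {X Y : HPrime} (f : Diag X Y) : Rel (smul 0 f) (zero X Y)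
  | mul_smul {X Y : HPrime} (c d : ℂ) (f : Diag X Y) : Rel (smul (c * d) f) (smul c (smul d f))
  | smul_add {X Y : HPrime} (c : ℂ) (f g : Diag X Y) :
      Rel (smul c (add f g)) (add (smul c f) (smul c g))
  | add_smul {X Y : HPrime} (c d : ℂ) (f : Diag X Y) :
      Rel (smul (c + d) f) (add (smul c f) (smul d f))
  | add_comp {X Y Z : HPrime} (f f' : Diag X Y) (g : Diag Y Z) :
      Rel (add f f' ⊚ g) (add (f ⊚ g) (f' ⊚ g))
  | comp_add {X Y Z : HPrime} (f : Diag X Y) (g g' : Diag Y Z) :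
      Rel (f ⊚ add g g') (add (f ⊚ g) (f ⊚ g'))
  | smul_comp {X Y Z : HPrime} (c : ℂ) (f : Diag X Y) (g : Diag Y Z) :
      Rel (smul c f ⊚ g) (smul c (f ⊚ g))
  | comp_smul {X Y Z : HPrime} (c : ℂ) (f : Diag X Y) (g : Diag Y Z) :
      Rel (f ⊚ smul c g) (smul c (f ⊚ g))
  -- bilinear monoidal structure
  | whiskerLeft_id (X Y : HPrime) : Rel (whiskerLeft X (id Y)) (id (X ⊠ Y))
  | id_whiskerRight (X Y : HPrime) : Rel (whiskerRight (id X) Y) (id (X ⊠ Y))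
  | whiskerLeft_comp (X : HPrime) {Y Z W : HPrime} (f : Diag Y Z) (g : Diag Z W) :
      Rel (whiskerLeft X (f ⊚ g)) (whiskerLeft X f ⊚ whiskerLeft X g)
  | comp_whiskerRight {X Y Z : HPrime} (f : Diag X Y) (g : Diag Y Z) (W : HPrime) :
      Rel (whiskerRight (f ⊚ g) W) (whiskerRight f W ⊚ whiskerRight g W)
  | exchange {X Y Z W : HPrime} (f : Diag X Y) (g : Diag Z W) :
      Rel (whiskerLeft X g ⊚ whiskerRight f W) (whiskerRight f Z ⊚ whiskerLeft Y g)
  | whiskerLeft_add (X : HPrime) {Y Z : HPrime} (f g : Diag Y Z) :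
      Rel (whiskerLeft X (add f g)) (add (whiskerLeft X f) (whiskerLeft X g))
  | add_whiskerRight {X Y : HPrime} (f g : Diag X Y) (Z : HPrime) :
      Rel (whiskerRight (add f g) Z) (add (whiskerRight f Z) (whiskerRight g Z))
  | whiskerLeft_smul (X : HPrime) {Y Z : HPrime} (c : ℂ) (f : Diag Y Z) :
      Rel (whiskerLeft X (smul c f)) (smul c (whiskerLeft X f))
  | smul_whiskerRight {X Y : HPrime} (c : ℂ) (f : Diag X Y) (Z : HPrime) :
      Rel (whiskerRight (smul c f) Z) (smul c (whiskerRight f Z))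
  | assoc_assocInv (X Y Z : HPrime) : Rel (assoc X Y Z ⊚ assocInv X Y Z) (id _)
  | assocInv_assoc (X Y Z : HPrime) : Rel (assocInv X Y Z ⊚ assoc X Y Z) (id _)
  | lunit_lunitInv (X : HPrime) : Rel (lunit X ⊚ lunitInv X) (id _)
  | lunitInv_lunit (X : HPrime) : Rel (lunitInv X ⊚ lunit X) (id _)
  | runit_runitInv (X : HPrime) : Rel (runit X ⊚ runitInv X) (id _)
  | runitInv_runit (X : HPrime) : Rel (runitInv X ⊚ runit X) (id _)
  | assoc_naturality_left {X X' : HPrime} (f : Diag X X') (Y Z : HPrime) :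
      Rel (whiskerRight (whiskerRight f Y) Z ⊚ assoc X' Y Z)
        (assoc X Y Z ⊚ whiskerRight f (Y ⊠ Z))
  | assoc_naturality_middle (X : HPrime) {Y Y' : HPrime} (f : Diag Y Y') (Z : HPrime) :
      Rel (whiskerRight (whiskerLeft X f) Z ⊚ assoc X Y' Z)
        (assoc X Y Z ⊚ whiskerLeft X (whiskerRight f Z))
  | assoc_naturality_right (X Y : HPrime) {Z Z' : HPrime} (f : Diag Z Z') :
      Rel (whiskerLeft (X ⊠ Y) f ⊚ assoc X Y Z')
        (assoc X Y Z ⊚ whiskerLeft X (whiskerLeft Y f))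
  | lunit_naturality {X Y : HPrime} (f : Diag X Y) :
      Rel (whiskerLeft unit f ⊚ lunit Y) (lunit X ⊚ f)
  | runit_naturality {X Y : HPrime} (f : Diag X Y) :
      Rel (whiskerRight f unit ⊚ runit Y) (runit X ⊚ f)
  | pentagon (X Y Z W : HPrime) :
      Rel (whiskerRight (assoc X Y Z) W ⊚ assoc X (Y ⊠ Z) W ⊚ whiskerLeft X (assoc Y Z W))
        (assoc (X ⊠ Y) Z W ⊚ assoc X Y (Z ⊠ W))
  | triangle (X Y : HPrime) :
      Rel (assoc X unit Y ⊚ whiskerLeft X (lunit Y)) (whiskerRight (runit X) Y)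
  -- direct sums and the zero object
  | inl_fst (X Y : HPrime) : Rel (inl X Y ⊚ fst X Y) (id X)
  | inl_snd (X Y : HPrime) : Rel (inl X Y ⊚ snd X Y) (zero X Y)
  | inr_fst (X Y : HPrime) : Rel (inr X Y ⊚ fst X Y) (zero Y X)
  | inr_snd (X Y : HPrime) : Rel (inr X Y ⊚ snd X Y) (id Y)
  | sum_total (X Y : HPrime) :
      Rel (add (fst X Y ⊚ inl X Y) (snd X Y ⊚ inr X Y)) (id (sum X Y))
  | id_zero : Rel (id HPrime.zero) (zero HPrime.zero HPrime.zero)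
  -- planar isotopy: straightening of strands, and rotation invariance of the crossing
  | zigzag_P : Rel (runitInv P ⊚ whiskerLeft P cupQP ⊚ assocInv P Q P ⊚ whiskerRight capPQ P ⊚
      lunit P) (id P)
  | zigzag_Q : Rel (lunitInv Q ⊚ whiskerRight cupQP Q ⊚ assoc Q P Q ⊚ whiskerLeft Q capPQ ⊚
      runit Q) (id Q)
  | zigzag_P' : Rel (lunitInv P ⊚ whiskerRight cupPQ P ⊚ assoc P Q P ⊚ whiskerLeft P capQP ⊚
      runit P) (id P)
  | zigzag_Q' : Rel (runitInv Q ⊚ whiskerLeft Q cupPQ ⊚ assocInv Q P Q ⊚ whiskerRight capQP Q ⊚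
      lunit Q) (id Q)
  | cyclic : Rel (rotR crossPQ) (rotL crossQP)
  -- the local relations
  | cross_cross : Rel (cross ⊚ cross) (id (P ⊠ P))
  | braid : Rel (whiskerRight cross P ⊚ assoc P P P ⊚ whiskerLeft P cross ⊚ assocInv P P P ⊚
        whiskerRight cross P)
      (assoc P P P ⊚ whiskerLeft P cross ⊚ assocInv P P P ⊚ whiskerRight cross P ⊚ assoc P P P ⊚
        whiskerLeft P cross ⊚ assocInv P P P)
  | crossQP_crossPQ : Rel (add (crossQP ⊚ crossPQ) (capQP ⊚ cupQP)) (id (Q ⊠ P))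
  | crossPQ_crossQP : Rel (crossPQ ⊚ crossQP) (id (P ⊠ Q))
  | circle : Rel (cupQP ⊚ capQP) (id unit)
  | curl : Rel (lunitInv P ⊚ whiskerRight cupQP P ⊚ assoc Q P P ⊚ whiskerLeft Q cross ⊚
      assocInv Q P P ⊚ whiskerRight capQP P ⊚ lunit P) (zero P P)

instance setoid (X Y : HPrime) : Setoid (Diag X Y) :=
  ⟨Rel, ⟨Rel.refl, Rel.symm, Rel.trans⟩⟩

end Diag

open Diag

instance category : Category HPrime where
  Hom X Y := Quotient (Diag.setoid X Y)
  id X := ⟦Diag.id X⟧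
  comp := Quotient.map₂ Diag.comp fun _ _ hf _ _ hg => Rel.comp_congr hf hg
  id_comp := by rintro X Y ⟨f⟩; exact Quotient.sound (Rel.id_comp f)
  comp_id := by rintro X Y ⟨f⟩; exact Quotient.sound (Rel.comp_id f)
  assoc := by rintro X Y Z W ⟨f⟩ ⟨g⟩ ⟨h⟩; exact Quotient.sound (Rel.comp_assoc f g h)

/-- The morphism of `H'` represented by a formal morphism. -/
def toHom {X Y : HPrime} (f : Diag X Y) : X ⟶ Y := Quotient.mk _ f

theorem toHom_comp {X Y Z : HPrime} (f : Diag X Y) (g : Diag Y Z) :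
    toHom (f.comp g) = toHom f ≫ toHom g := rfl

theorem toHom_eq {X Y : HPrime} {f g : Diag X Y} (h : Rel f g) : toHom f = toHom g :=
  Quotient.sound h

theorem toHom_surjective {X Y : HPrime} (f : X ⟶ Y) : ∃ f', toHom f' = f :=
  Quotient.exists_rep f

section

variable (X Y : HPrime)

instance : Zero (X ⟶ Y) := ⟨toHom (Diag.zero X Y)⟩

instance : Add (X ⟶ Y) := ⟨Quotient.map₂ Diag.add fun _ _ hf _ _ hg => Rel.add_congr hf hg⟩

instance : SMul ℂ (X ⟶ Y) := ⟨fun c => Quotient.map (Diag.smul c) fun _ _ hf => Rel.smul_congr c hf⟩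

instance : AddCommMonoid (X ⟶ Y) where
  add_assoc := by rintro ⟨f⟩ ⟨g⟩ ⟨h⟩; exact Quotient.sound (Rel.add_assoc f g h)
  zero_add := by rintro ⟨f⟩; exact Quotient.sound (Rel.zero_add f)
  add_zero := by rintro ⟨f⟩; exact Quotient.sound ((Rel.add_comm _ _).trans (Rel.zero_add f))
  add_comm := by rintro ⟨f⟩ ⟨g⟩; exact Quotient.sound (Rel.add_comm f g)
  nsmul := nsmulRec

theorem hom_zero_smul {X Y : HPrime} (f : X ⟶ Y) : (0 : ℂ) • f = 0 := by
  obtain ⟨f, rfl⟩ := toHom_surjective f; exact toHom_eq (Rel.zero_smul f)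

theorem hom_mul_smul {X Y : HPrime} (c d : ℂ) (f : X ⟶ Y) : (c * d) • f = c • d • f := by
  obtain ⟨f, rfl⟩ := toHom_surjective f; exact toHom_eq (Rel.mul_smul c d f)

instance homModule : Module ℂ (X ⟶ Y) where
  one_smul := by rintro ⟨f⟩; exact Quotient.sound (Rel.one_smul f)
  mul_smul := hom_mul_smul
  smul_add := by rintro c ⟨f⟩ ⟨g⟩; exact Quotient.sound (Rel.smul_add c f g)
  add_smul := by rintro c d ⟨f⟩; exact Quotient.sound (Rel.add_smul c d f)
  zero_smul := hom_zero_smul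
  smul_zero c := by
    conv_lhs => rw [← hom_zero_smul (0 : X ⟶ Y), ← hom_mul_smul, mul_zero]
    exact hom_zero_smul _

end

instance preadditive : Preadditive HPrime where
  homGroup X Y := Module.addCommMonoidToAddCommGroup ℂ
  add_comp := by rintro X Y Z ⟨f⟩ ⟨f'⟩ ⟨g⟩; exact Quotient.sound (Rel.add_comp f f' g)
  comp_add := by rintro X Y Z ⟨f⟩ ⟨g⟩ ⟨g'⟩; exact Quotient.sound (Rel.comp_add f g g')

instance linear : Linear ℂ HPrime where
  homModule := homModule
  smul_comp := by rintro X Y Z c ⟨f⟩ ⟨g⟩; exact Quotient.sound (Rel.smul_comp c f g)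
  comp_smul := by rintro X Y Z ⟨f⟩ c ⟨g⟩; exact Quotient.sound (Rel.comp_smul c f g)

instance monoidalStruct : MonoidalCategoryStruct HPrime where
  tensorObj := HPrime.tensor
  tensorUnit := HPrime.unit
  whiskerLeft X _ _ := Quotient.map (Diag.whiskerLeft X) fun _ _ h => Rel.whiskerLeft_congr X h
  whiskerRight f Z :=
    Quotient.map (fun f => Diag.whiskerRight f Z) (fun _ _ h => Rel.whiskerRight_congr Z h) f
  associator X Y Z := ⟨toHom (Diag.assoc X Y Z), toHom (Diag.assocInv X Y Z),
    toHom_eq (Rel.assoc_assocInv X Y Z), toHom_eq (Rel.assocInv_assoc X Y Z)⟩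
  leftUnitor X := ⟨toHom (Diag.lunit X), toHom (Diag.lunitInv X),
    toHom_eq (Rel.lunit_lunitInv X), toHom_eq (Rel.lunitInv_lunit X)⟩
  rightUnitor X := ⟨toHom (Diag.runit X), toHom (Diag.runitInv X),
    toHom_eq (Rel.runit_runitInv X), toHom_eq (Rel.runitInv_runit X)⟩

open MonoidalCategory

theorem whiskerLeft_comp' (X : HPrime) {Y Z W : HPrime} (f : Y ⟶ Z) (g : Z ⟶ W) :
    X ◁ (f ≫ g) = X ◁ f ≫ X ◁ g := by
  obtain ⟨f, rfl⟩ := toHom_surjective f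
  obtain ⟨g, rfl⟩ := toHom_surjective g
  exact toHom_eq (Rel.whiskerLeft_comp X f g)

theorem comp_whiskerRight' {X Y Z : HPrime} (f : X ⟶ Y) (g : Y ⟶ Z) (W : HPrime) :
    (f ≫ g) ▷ W = f ▷ W ≫ g ▷ W := by
  obtain ⟨f, rfl⟩ := toHom_surjective f
  obtain ⟨g, rfl⟩ := toHom_surjective g
  exact toHom_eq (Rel.comp_whiskerRight f g W)

theorem exchange' {X Y Z W : HPrime} (f : X ⟶ Y) (g : Z ⟶ W) :
    X ◁ g ≫ f ▷ W = f ▷ Z ≫ Y ◁ g := by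
  obtain ⟨f, rfl⟩ := toHom_surjective f
  obtain ⟨g, rfl⟩ := toHom_surjective g
  exact toHom_eq (Rel.exchange f g)

theorem assoc_left' {X X' : HPrime} (f : X ⟶ X') (Y Z : HPrime) :
    f ▷ Y ▷ Z ≫ (α_ X' Y Z).hom = (α_ X Y Z).hom ≫ f ▷ (Y ⊗ Z) := by
  obtain ⟨f, rfl⟩ := toHom_surjective f
  exact toHom_eq (Rel.assoc_naturality_left f Y Z)

theorem assoc_middle' (X : HPrime) {Y Y' : HPrime} (f : Y ⟶ Y') (Z : HPrime) :
    (X ◁ f) ▷ Z ≫ (α_ X Y' Z).hom = (α_ X Y Z).hom ≫ X ◁ f ▷ Z := by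
  obtain ⟨f, rfl⟩ := toHom_surjective f
  exact toHom_eq (Rel.assoc_naturality_middle X f Z)

theorem assoc_right' (X Y : HPrime) {Z Z' : HPrime} (f : Z ⟶ Z') :
    (X ⊗ Y) ◁ f ≫ (α_ X Y Z').hom = (α_ X Y Z).hom ≫ X ◁ Y ◁ f := by
  obtain ⟨f, rfl⟩ := toHom_surjective f
  exact toHom_eq (Rel.assoc_naturality_right X Y f)

instance monoidal : MonoidalCategory HPrime where
  id_tensorHom_id X Y := by
    change (𝟙 X ▷ Y) ≫ (X ◁ 𝟙 Y) = _
    rw [show 𝟙 X ▷ Y = 𝟙 (X ⊗ Y) from toHom_eq (Rel.id_whiskerRight X Y),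
      show X ◁ 𝟙 Y = 𝟙 (X ⊗ Y) from toHom_eq (Rel.whiskerLeft_id X Y), Category.id_comp]
  tensorHom_comp_tensorHom f₁ f₂ g₁ g₂ := by
    change (f₁ ▷ _ ≫ _ ◁ f₂) ≫ (g₁ ▷ _ ≫ _ ◁ g₂) = (f₁ ≫ g₁) ▷ _ ≫ _ ◁ (f₂ ≫ g₂)
    rw [whiskerLeft_comp', comp_whiskerRight', Category.assoc, Category.assoc,
      ← Category.assoc (_ ◁ f₂), exchange', Category.assoc]
  whiskerLeft_id X Y := toHom_eq (Rel.whiskerLeft_id X Y)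
  id_whiskerRight X Y := toHom_eq (Rel.id_whiskerRight X Y)
  associator_naturality {X₁ X₂ X₃ Y₁ Y₂ Y₃} f₁ f₂ f₃ := by
    change ((f₁ ▷ _ ≫ _ ◁ f₂) ▷ _ ≫ _ ◁ f₃) ≫ _ = _ ≫ f₁ ▷ _ ≫ _ ◁ (f₂ ▷ _ ≫ _ ◁ f₃)
    rw [comp_whiskerRight', whiskerLeft_comp', Category.assoc, assoc_right', Category.assoc,
      ← Category.assoc ((_ ◁ f₂) ▷ _), assoc_middle', Category.assoc,
      ← Category.assoc (f₁ ▷ _ ▷ _), assoc_left', Category.assoc]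
  leftUnitor_naturality := by
    rintro X Y ⟨f⟩; exact toHom_eq (Rel.lunit_naturality f)
  rightUnitor_naturality := by
    rintro X Y ⟨f⟩; exact toHom_eq (Rel.runit_naturality f)
  pentagon X Y Z W := toHom_eq (Rel.pentagon X Y Z W)
  triangle X Y := toHom_eq (Rel.triangle X Y)

theorem whiskerLeft_smul' (X : HPrime) {Y Z : HPrime} (c : ℂ) (f : Y ⟶ Z) :
    X ◁ (c • f) = c • X ◁ f := by
  obtain ⟨f, rfl⟩ := toHom_surjective f
  exact toHom_eq (Rel.whiskerLeft_smul X c f)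

theorem smul_whiskerRight' {X Y : HPrime} (c : ℂ) (f : X ⟶ Y) (Z : HPrime) :
    (c • f) ▷ Z = c • f ▷ Z := by
  obtain ⟨f, rfl⟩ := toHom_surjective f
  exact toHom_eq (Rel.smul_whiskerRight c f Z)

instance : MonoidalPreadditive HPrime where
  whiskerLeft_zero {X Y Z} := by
    rw [← zero_smul ℂ (0 : Y ⟶ Z), whiskerLeft_smul', zero_smul]
  zero_whiskerRight {X Y Z} := by
    rw [← zero_smul ℂ (0 : Y ⟶ Z), smul_whiskerRight', zero_smul]
  whiskerLeft_add {X Y Z} f g := by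
    obtain ⟨f, rfl⟩ := toHom_surjective f
    obtain ⟨g, rfl⟩ := toHom_surjective g
    exact toHom_eq (Rel.whiskerLeft_add X f g)
  add_whiskerRight {X Y Z} f g := by
    obtain ⟨f, rfl⟩ := toHom_surjective f
    obtain ⟨g, rfl⟩ := toHom_surjective g
    exact toHom_eq (Rel.add_whiskerRight f g X)

instance : MonoidalLinear ℂ HPrime where
  whiskerLeft_smul X _ _ c f := whiskerLeft_smul' X c f
  smul_whiskerRight c _ _ f X := smul_whiskerRight' c f X

end HPrime

end HeisenbergTrace
end

noncomputable section

open CategoryTheory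

namespace HeisenbergTrace

/-! ### The action of `H'` on `⊕_n ℂ[S_n]-mod` -/

namespace SymMod

/-- The componentwise direct sum of two objects. -/
def prodObj (M N : SymMod) : SymMod where
  obj n := FGModuleCat.of (SymAlg n) (M.obj n × N.obj n)
  finite := by
    obtain ⟨a, ha⟩ := M.finite
    obtain ⟨b, hb⟩ := N.finite
    refine ⟨max a b, fun n hn => ?_⟩
    have := ha n (by omega)
    have := hb n (by omega)
    exact inferInstanceAs (Subsingleton (M.obj n × N.obj n))

/-- The direct sum of two morphisms. -/
def prodMap {M M' N N' : SymMod} (f : M ⟶ M') (g : N ⟶ N') : prodObj M N ⟶ prodObj M' N' :=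
  fun n => FGModuleCat.ofHom ((f n).hom.hom.prodMap (g n).hom.hom)

theorem prodMap_id (M N : SymMod) : prodMap (𝟙 M) (𝟙 N) = 𝟙 (prodObj M N) := rfl

theorem prodMap_comp {M M' M'' N N' N'' : SymMod} (f : M ⟶ M') (f' : M' ⟶ M'') (g : N ⟶ N')
    (g' : N' ⟶ N'') : prodMap (f ≫ f') (g ≫ g') = prodMap f g ≫ prodMap f' g' := rfl

theorem prodMap_add {M M' N N' : SymMod} (f f' : M ⟶ M') (g g' : N ⟶ N') :
    prodMap (f + f') (g + g') = prodMap f g + prodMap f' g' := rfl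

theorem prodMap_smul {M M' N N' : SymMod} (c : ℂ) (f : M ⟶ M') (g : N ⟶ N') :
    prodMap (c • f) (c • g) = c • prodMap f g := rfl

/-- The zero object. -/
def zeroObj : SymMod where
  obj n := FGModuleCat.of (SymAlg n) PUnit
  finite := ⟨0, fun _ _ => inferInstanceAs (Subsingleton PUnit)⟩

theorem zeroObj_ext {M : SymMod} (f g : M ⟶ zeroObj) : f = g := by
  ext1 n
  have : Subsingleton (zeroObj.obj n) := inferInstanceAs (Subsingleton PUnit)
  exact hom_zero_ext _ _

/-- The zero functor. -/
def zeroFunctor : SymMod ⥤ SymMod where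
  obj _ := zeroObj
  map _ := 𝟙 _

/-- The direct sum of two functors. -/
def sumFunctor (F G : SymMod ⥤ SymMod) : SymMod ⥤ SymMod where
  obj M := prodObj (F.obj M) (G.obj M)
  map f := prodMap (F.map f) (G.map f)
  map_id M := (congrArg₂ prodMap (F.map_id M) (G.map_id M)).trans (prodMap_id _ _)
  map_comp f g := (congrArg₂ prodMap (F.map_comp f g) (G.map_comp f g)).trans (prodMap_comp _ _ _ _)

end SymMod

namespace HPrime

open SymMod

/-- The endofunctor of `⊕_n ℂ[S_n]-mod` assigned to an object of `H'`: `P` acts by induction, `Q`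
by restriction, and the tensor product by composition. -/
def functor : HPrime → (SymMod ⥤ SymMod)
  | unit => 𝟭 SymMod
  | P => ind
  | Q => res
  | tensor X Y => functor Y ⋙ functor X
  | zero => zeroFunctor
  | sum X Y => sumFunctor (functor X) (functor Y)

instance functor_additive (X : HPrime) : (functor X).Additive := by
  induction X with
  | unit => exact inferInstanceAs (𝟭 SymMod).Additive
  | P => exact inferInstanceAs ind.Additive
  | Q => exact inferInstanceAs res.Additive
  | tensor X Y hX hY => exact inferInstanceAs (functor Y ⋙ functor X).Additive
  | zero => exact ⟨fun {_ _ _ _} => zeroObj_ext _ _⟩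
  | sum X Y hX hY =>
    exact ⟨fun {M N f g} => (congrArg₂ prodMap (functor X).map_add (functor Y).map_add).trans
      (prodMap_add _ _ _ _)⟩

instance functor_linear (X : HPrime) : (functor X).Linear ℂ := by
  induction X with
  | unit => exact inferInstanceAs ((𝟭 SymMod).Linear ℂ)
  | P => exact inferInstanceAs (ind.Linear ℂ)
  | Q => exact inferInstanceAs (res.Linear ℂ)
  | tensor X Y hX hY => exact inferInstanceAs ((functor Y ⋙ functor X).Linear ℂ)
  | zero => exact ⟨fun _ _ => zeroObj_ext _ _⟩
  | sum X Y hX hY =>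
    exact ⟨fun {M N} f c => (congrArg₂ prodMap ((functor X).map_smul c f)
      ((functor Y).map_smul c f)).trans (prodMap_smul _ _ _)⟩

/-- The natural transformation assigned to a formal morphism. -/
def eval : {X Y : HPrime} → Diag X Y → (functor X ⟶ functor Y)
  | _, _, .id X => 𝟙 (functor X)
  | _, _, .comp f g => eval f ≫ eval g
  | _, _, .whiskerLeft X f => Functor.whiskerRight (eval f) (functor X)
  | _, _, .whiskerRight f Z => Functor.whiskerLeft (functor Z) (eval f)
  | _, _, .assoc X Y Z => (Functor.associator (functor Z) (functor Y) (functor X)).inv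
  | _, _, .assocInv X Y Z => (Functor.associator (functor Z) (functor Y) (functor X)).hom
  | _, _, .lunit X => (Functor.rightUnitor (functor X)).hom
  | _, _, .lunitInv X => (Functor.rightUnitor (functor X)).inv
  | _, _, .runit X => (Functor.leftUnitor (functor X)).hom
  | _, _, .runitInv X => (Functor.leftUnitor (functor X)).inv
  | _, _, .zero _ _ => 0
  | _, _, .add f g => eval f + eval g
  | _, _, .smul c f => c • eval f
  | _, _, .inl X Y =>
    { app := fun M n => FGModuleCat.ofHom (LinearMap.inl (SymAlg n) ((functor X).obj M |>.obj n)
        ((functor Y).obj M |>.obj n))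
      naturality := fun M N f => by
        ext1 n
        exact FGModuleCat.hom_ext (LinearMap.ext fun x =>
          Prod.ext rfl (map_zero ((functor Y).map f n).hom.hom).symm) }
  | _, _, .inr X Y =>
    { app := fun M n => FGModuleCat.ofHom (LinearMap.inr (SymAlg n) ((functor X).obj M |>.obj n)
        ((functor Y).obj M |>.obj n))
      naturality := fun M N f => by
        ext1 n
        exact FGModuleCat.hom_ext (LinearMap.ext fun x =>
          Prod.ext (map_zero ((functor X).map f n).hom.hom).symm rfl) }
  | _, _, .fst X Y =>
    { app := fun M n => FGModuleCat.ofHom (LinearMap.fst (SymAlg n) ((functor X).obj M |>.obj n)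
        ((functor Y).obj M |>.obj n)) }
  | _, _, .snd X Y =>
    { app := fun M n => FGModuleCat.ofHom (LinearMap.snd (SymAlg n) ((functor X).obj M |>.obj n)
        ((functor Y).obj M |>.obj n)) }
  | _, _, .cross => SymMod.cross
  | _, _, .cupQP => SymMod.cupQP
  | _, _, .capPQ => SymMod.capPQ
  | _, _, .cupPQ => SymMod.cupPQ
  | _, _, .capQP => SymMod.capQP

theorem eval_rotR_app {X Y : HPrime} (f : Diag (P.tensor X) (Y.tensor P)) (M : SymMod) :
    (eval (Diag.rotR f)).app M = SymMod.cupQP.app ((functor X).obj (res.obj M)) ≫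
      res.map ((eval f).app (res.obj M) ≫ (functor Y).map (SymMod.capPQ.app M)) := by
  simp [Diag.rotR, eval, functor]
  rfl

theorem eval_rotL_app {X Y : HPrime} (f : Diag (X.tensor P) (P.tensor Y)) (M : SymMod) :
    (eval (Diag.rotL f)).app M = res.map ((functor X).map (SymMod.cupPQ.app M) ≫
      (eval f).app (res.obj M)) ≫ SymMod.capQP.app ((functor Y).obj (res.obj M)) := by
  simp [Diag.rotL, eval, functor]
  rfl

theorem eval_crossPQ_app (M : SymMod) : (eval Diag.crossPQ).app M = crossR M :=
  eval_rotR_app _ M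

theorem eval_crossQP_app (M : SymMod) : (eval Diag.crossQP).app M = crossL M :=
  eval_rotL_app _ M

theorem eval_sound {X Y : HPrime} {f g : Diag X Y} (h : Diag.Rel f g) : eval f = eval g := by
  induction h with
  | refl => rfl
  | symm _ ih => exact ih.symm
  | trans _ _ ih₁ ih₂ => exact ih₁.trans ih₂
  | comp_congr _ _ ih₁ ih₂ => simp only [eval, ih₁, ih₂]
  | whiskerLeft_congr _ _ ih => exact congrArg (fun t => Functor.whiskerRight t _) ih
  | whiskerRight_congr _ _ ih => exact congrArg (fun t => Functor.whiskerLeft _ t) ih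
  | add_congr _ _ ih₁ ih₂ => simp only [eval, ih₁, ih₂]
  | smul_congr _ _ ih => simp only [eval, ih]
  | id_comp => simp [eval]
  | comp_id => simp [eval]
  | comp_assoc => simp [eval]
  | add_assoc => exact add_assoc _ _ _
  | add_comm => exact add_comm _ _
  | zero_add => exact zero_add _
  | one_smul => exact one_smul _ _
  | zero_smul => exact zero_smul _ _
  | mul_smul => exact mul_smul _ _ _
  | smul_add => exact smul_add _ _ _
  | add_smul => exact add_smul _ _ _
  | add_comp => exact Preadditive.add_comp _ _ _ _ _ _
  | comp_add => exact Preadditive.comp_add _ _ _ _ _ _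
  | smul_comp => exact Linear.smul_comp _ _ _ _ _ _
  | comp_smul => exact Linear.comp_smul _ _ _ _ _ _
  | whiskerLeft_id X => exact NatTrans.ext (funext fun M => (functor X).map_id _)
  | id_whiskerRight => rfl
  | whiskerLeft_comp X => exact NatTrans.ext (funext fun M => (functor X).map_comp _ _)
  | comp_whiskerRight => rfl
  | exchange f g => exact NatTrans.ext (funext fun M => (eval f).naturality ((eval g).app M))
  | whiskerLeft_add X => exact NatTrans.ext (funext fun M => (functor X).map_add)
  | add_whiskerRight => rfl
  | whiskerLeft_smul X => exact NatTrans.ext (funext fun M => (functor X).map_smul _ _)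
  | smul_whiskerRight => rfl
  | assoc_assocInv => ext M : 2; simp [eval, functor]
  | assocInv_assoc => ext M : 2; simp [eval, functor]
  | lunit_lunitInv => ext M : 2; simp [eval, functor]
  | lunitInv_lunit => exact NatTrans.ext (funext fun M => Category.comp_id _)
  | runit_runitInv => ext M : 2; simp [eval, functor]
  | runitInv_runit => exact NatTrans.ext (funext fun M => Category.comp_id _)
  | assoc_naturality_left => ext M : 2; simp [eval, functor]
  | assoc_naturality_middle => ext M : 2; simp [eval, functor]
  | assoc_naturality_right => ext M : 2; simp [eval, functor]
  | lunit_naturality => ext M : 2; simp [eval, functor]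
  | runit_naturality => ext M : 2; simp [eval, functor]
  | pentagon => ext M : 2; simp [eval, functor]
  | triangle => ext M : 2; simp [eval, functor]
  | inl_fst => rfl
  | inl_snd => rfl
  | inr_fst => rfl
  | inr_snd => rfl
  | sum_total X Y =>
    refine NatTrans.ext (funext fun M => SymMod.hom_ext fun n => FGModuleCat.hom_ext
      (LinearMap.ext fun x => Prod.ext ?_ ?_))
    · exact add_zero x.1
    · exact zero_add x.2
  | id_zero =>
    refine NatTrans.ext (funext fun M => ?_)
    exact zeroObj_ext _ _
  | zigzag_P => ext M : 2; simpa [eval, functor] using SymMod.zigzag_P M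
  | zigzag_Q => ext M : 2; simpa [eval, functor] using SymMod.zigzag_Q M
  | zigzag_P' => ext M : 2; simpa [eval, functor] using SymMod.zigzag_P' M
  | zigzag_Q' => ext M : 2; simpa [eval, functor] using SymMod.zigzag_Q' M
  | cyclic =>
    ext M : 2
    rw [eval_rotR_app, eval_rotL_app, eval_crossPQ_app, eval_crossQP_app]
    exact SymMod.cyclic_eq M
  | cross_cross => ext M : 2; exact SymMod.cross_cross M
  | braid => ext M : 2; simpa [eval, functor] using SymMod.cross_braid M
  | crossQP_crossPQ =>
    ext M : 2
    change (eval Diag.crossQP).app M ≫ (eval Diag.crossPQ).app M + _ = _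
    rw [eval_crossPQ_app, eval_crossQP_app]
    exact SymMod.crossL_crossR M
  | crossPQ_crossQP =>
    ext M : 2
    change (eval Diag.crossPQ).app M ≫ (eval Diag.crossQP).app M = _
    rw [eval_crossPQ_app, eval_crossQP_app]
    exact SymMod.crossR_crossL M
  | circle => ext M : 2; exact SymMod.circle_eq M
  | curl => exact NatTrans.ext (funext fun M => by
      have h := SymMod.curl_eq M
      simp [eval, functor]
      exact h)

/-- The natural transformation assigned to a morphism of `H'`. -/
def natTrans {X Y : HPrime} (f : X ⟶ Y) : functor X ⟶ functor Y :=
  Quotient.lift eval (fun _ _ h => eval_sound h) f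

open MonoidalCategory

/-- The action of `H'` on `⊕_n ℂ[S_n]-mod`. -/
instance action : MonoidalLeftAction HPrime SymMod where
  actionObj X M := (functor X).obj M
  actionHomLeft f M := (natTrans f).app M
  actionHomRight X _ _ g := (functor X).map g
  actionAssocIso X Y M := Iso.refl ((functor X).obj ((functor Y).obj M))
  actionUnitIso M := Iso.refl M
  actionHom_def _ _ := rfl
  actionHomRight_id X M := (functor X).map_id M
  id_actionHomLeft X M := rfl
  actionHom_comp := by
    rintro X Y Z M N K ⟨f⟩ ⟨f'⟩ g g'
    change (eval f ≫ eval f').app M ≫ (functor Z).map (g ≫ g') =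
      ((eval f).app M ≫ (functor Y).map g) ≫ (eval f').app N ≫ (functor Z).map g'
    simp
  actionAssocIso_hom_naturality := by
    rintro X Y Z W M N ⟨f⟩ ⟨g⟩ h
    change (((eval f).app ((functor Z).obj M) ≫ (functor Y).map ((eval g).app M)) ≫
      (functor Y).map ((functor W).map h)) ≫ 𝟙 _ = 𝟙 _ ≫ (eval f).app ((functor Z).obj M) ≫
        (functor Y).map ((eval g).app M ≫ (functor W).map h)
    simp
  actionUnitIso_hom_naturality f := (Category.id_comp f).trans (Category.comp_id f).symm
  whiskerLeft_actionHomLeft := by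
    rintro X Y Z ⟨f⟩ M
    change (functor X).map ((eval f).app M) = 𝟙 _ ≫ (functor X).map ((eval f).app M) ≫ 𝟙 _
    simp
  whiskerRight_actionHomLeft := by
    rintro X Y Z ⟨f⟩ M
    change (eval f).app ((functor Z).obj M) = 𝟙 _ ≫ (eval f).app ((functor Z).obj M) ≫ 𝟙 _
    simp
  associator_actionHom X Y Z M := by
    change 𝟙 _ ≫ 𝟙 _ ≫ (functor X).map (𝟙 _) = 𝟙 _ ≫ 𝟙 _
    simp
  leftUnitor_actionHom X M := by
    change 𝟙 _ = 𝟙 _ ≫ 𝟙 _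
    simp
  rightUnitor_actionHom X M := by
    change 𝟙 _ = 𝟙 _ ≫ (functor X).map (𝟙 _)
    simp

end HPrime

end HeisenbergTrace
end

noncomputable section

open CategoryTheory MonoidalCategory

namespace HeisenbergTrace

/-! ### The trace of a linear category -/

section Trace

universe w v u v' u'

variable (k : Type w) [CommRing k]
variable (C : Type u) [Category.{v} C] [Preadditive C] [Linear k C]
variable (D : Type u') [Category.{v'} D] [Preadditive D] [Linear k D]

open Classical in
/-- The element `fg - gf` of `⊕_X End X`, for `f : X ⟶ Y` and `g : Y ⟶ X`. -/
def traceRelator {X Y : C} (f : X ⟶ Y) (g : Y ⟶ X) : DirectSum C fun X : C => (X ⟶ X) :=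
  DirectSum.lof k C (fun X : C => (X ⟶ X)) X (f ≫ g) -
    DirectSum.lof k C (fun X : C => (X ⟶ X)) Y (g ≫ f)

/-- The span of the elements `fg - gf`. -/
def traceRelations : Submodule k (DirectSum C fun X : C => (X ⟶ X)) :=
  Submodule.span k {z | ∃ (X Y : C) (f : X ⟶ Y) (g : Y ⟶ X), z = traceRelator k C f g}

/-- The trace `(⊕_X End X) / span {fg - gf}` of a `k`-linear category. -/
def Tr : Type (max u v) := (DirectSum C fun X : C => (X ⟶ X)) ⧸ traceRelations k C

namespace Tr

instance : AddCommGroup (Tr k C) :=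
  inferInstanceAs (AddCommGroup ((DirectSum C fun X : C => (X ⟶ X)) ⧸ traceRelations k C))

instance : Module k (Tr k C) :=
  inferInstanceAs (Module k ((DirectSum C fun X : C => (X ⟶ X)) ⧸ traceRelations k C))

open Classical in
/-- The class of an endomorphism, as a linear map. -/
def ofₗ (X : C) : (X ⟶ X) →ₗ[k] Tr k C :=
  (traceRelations k C).mkQ ∘ₗ DirectSum.lof k C (fun X : C => (X ⟶ X)) X

variable {C D}

/-- The class `[f]` of an endomorphism `f`. -/
def of {X : C} (f : X ⟶ X) : Tr k C := ofₗ k C X f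

variable {k}

theorem of_add {X : C} (f g : X ⟶ X) : of k (f + g) = of k f + of k g := (ofₗ k C X).map_add f g

theorem of_smul {X : C} (c : k) (f : X ⟶ X) : of k (c • f) = c • of k f :=
  (ofₗ k C X).map_smul c f

theorem of_comp_comm {X Y : C} (f : X ⟶ Y) (g : Y ⟶ X) : of k (f ≫ g) = of k (g ≫ f) :=
  (Submodule.Quotient.eq _).2 (Submodule.subset_span ⟨X, Y, f, g, rfl⟩)

/-- Conjugate endomorphisms have the same class. -/
theorem of_conj {X Y : C} (e : X ≅ Y) {f : X ⟶ X} {g : Y ⟶ Y} (h : f ≫ e.hom = e.hom ≫ g) :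
    of k f = of k g := by
  have : f = e.hom ≫ g ≫ e.inv := by rw [← Category.assoc, ← h]; simp
  rw [this, of_comp_comm]
  simp

variable {M : Type*} [AddCommGroup M] [Module k M]

open Classical in
/-- A family of linear maps `End X → M` with the trace property factors through the trace. -/
def lift (φ : ∀ X : C, (X ⟶ X) →ₗ[k] M)
    (hφ : ∀ {X Y : C} (f : X ⟶ Y) (g : Y ⟶ X), φ X (f ≫ g) = φ Y (g ≫ f)) : Tr k C →ₗ[k] M :=
  (traceRelations k C).liftQ (DirectSum.toModule k C M φ) (Submodule.span_le.2 (by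
    rintro z ⟨X, Y, f, g, rfl⟩
    simp only [SetLike.mem_coe, LinearMap.mem_ker, traceRelator, map_sub, DirectSum.toModule_lof,
      hφ, sub_self]))

@[simp] theorem lift_of (φ : ∀ X : C, (X ⟶ X) →ₗ[k] M)
    (hφ : ∀ {X Y : C} (f : X ⟶ Y) (g : Y ⟶ X), φ X (f ≫ g) = φ Y (g ≫ f)) {X : C} (f : X ⟶ X) :
    lift φ hφ (of k f) = φ X f := by
  classical
  change DirectSum.toModule k C M φ (DirectSum.lof k C (fun X : C => (X ⟶ X)) X f) = φ X f
  rw [DirectSum.toModule_lof]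

theorem hom_ext {φ ψ : Tr k C →ₗ[k] M} (h : ∀ {X : C} (f : X ⟶ X), φ (of k f) = ψ (of k f)) :
    φ = ψ := by
  classical
  refine LinearMap.ext fun z => ?_
  obtain ⟨z, rfl⟩ := Submodule.mkQ_surjective _ z
  refine LinearMap.congr_fun (f := φ ∘ₗ (traceRelations k C).mkQ)
    (g := ψ ∘ₗ (traceRelations k C).mkQ) (DirectSum.linearMap_ext k fun X => ?_) z
  exact LinearMap.ext fun f => h f

theorem induction {p : Tr k C → Prop} (z : Tr k C) (hof : ∀ {X : C} (f : X ⟶ X), p (of k f))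
    (hzero : p 0) (hadd : ∀ x y, p x → p y → p (x + y)) : p z := by
  classical
  obtain ⟨z, rfl⟩ := Submodule.mkQ_surjective _ z
  induction z using DirectSum.induction_on with
  | zero => exact hzero
  | of X f => exact hof f
  | add x y hx hy => exact hadd _ _ hx hy

/-- Descending a family of bilinear maps with the trace property in the second variable. -/
def liftRight (φ : ∀ (X : C) (Y : D), (X ⟶ X) →ₗ[k] (Y ⟶ Y) →ₗ[k] M)
    (h₂ : ∀ {X : C} (h : X ⟶ X) {Y Y' : D} (f : Y ⟶ Y') (g : Y' ⟶ Y),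
      φ X Y h (f ≫ g) = φ X Y' h (g ≫ f)) (X : C) : (X ⟶ X) →ₗ[k] Tr k D →ₗ[k] M where
  toFun f := lift (fun Y => φ X Y f) (h₂ f)
  map_add' f g := hom_ext fun h => by
    rw [lift_of, LinearMap.add_apply, lift_of, lift_of, map_add, LinearMap.add_apply]
  map_smul' c f := hom_ext fun h => by
    rw [lift_of, RingHom.id_apply, LinearMap.smul_apply, lift_of, map_smul, LinearMap.smul_apply]

theorem liftRight_of (φ : ∀ (X : C) (Y : D), (X ⟶ X) →ₗ[k] (Y ⟶ Y) →ₗ[k] M)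
    (h₂ : ∀ {X : C} (h : X ⟶ X) {Y Y' : D} (f : Y ⟶ Y') (g : Y' ⟶ Y),
      φ X Y h (f ≫ g) = φ X Y' h (g ≫ f)) {X : C} (f : X ⟶ X) {Y : D} (g : Y ⟶ Y) :
    liftRight φ h₂ X f (of k g) = φ X Y f g :=
  lift_of (fun Y => φ X Y f) (h₂ f) g

theorem liftRight_comm (φ : ∀ (X : C) (Y : D), (X ⟶ X) →ₗ[k] (Y ⟶ Y) →ₗ[k] M)
    (h₁ : ∀ {X X' : C} (f : X ⟶ X') (g : X' ⟶ X) {Y : D} (h : Y ⟶ Y),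
      φ X Y (f ≫ g) h = φ X' Y (g ≫ f) h)
    (h₂ : ∀ {X : C} (h : X ⟶ X) {Y Y' : D} (f : Y ⟶ Y') (g : Y' ⟶ Y),
      φ X Y h (f ≫ g) = φ X Y' h (g ≫ f)) {X X' : C} (f : X ⟶ X') (g : X' ⟶ X) :
    liftRight φ h₂ X (f ≫ g) = liftRight φ h₂ X' (g ≫ f) :=
  hom_ext fun h => by rw [liftRight_of, liftRight_of, h₁]

/-- A family of bilinear maps with the trace property in both variables factors through the
traces. -/
def lift₂ (φ : ∀ (X : C) (Y : D), (X ⟶ X) →ₗ[k] (Y ⟶ Y) →ₗ[k] M)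
    (h₁ : ∀ {X X' : C} (f : X ⟶ X') (g : X' ⟶ X) {Y : D} (h : Y ⟶ Y),
      φ X Y (f ≫ g) h = φ X' Y (g ≫ f) h)
    (h₂ : ∀ {X : C} (h : X ⟶ X) {Y Y' : D} (f : Y ⟶ Y') (g : Y' ⟶ Y),
      φ X Y h (f ≫ g) = φ X Y' h (g ≫ f)) : Tr k C →ₗ[k] Tr k D →ₗ[k] M :=
  lift (liftRight φ h₂) (liftRight_comm φ h₁ h₂)

theorem lift₂_of (φ : ∀ (X : C) (Y : D), (X ⟶ X) →ₗ[k] (Y ⟶ Y) →ₗ[k] M)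
    (h₁ : ∀ {X X' : C} (f : X ⟶ X') (g : X' ⟶ X) {Y : D} (h : Y ⟶ Y),
      φ X Y (f ≫ g) h = φ X' Y (g ≫ f) h)
    (h₂ : ∀ {X : C} (h : X ⟶ X) {Y Y' : D} (f : Y ⟶ Y') (g : Y' ⟶ Y),
      φ X Y h (f ≫ g) = φ X Y' h (g ≫ f)) {X : C} (f : X ⟶ X) {Y : D} (g : Y ⟶ Y) :
    lift₂ φ h₁ h₂ (of k f) (of k g) = φ X Y f g := by
  have h := lift_of (liftRight φ h₂) (liftRight_comm φ h₁ h₂) f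
  exact (LinearMap.congr_fun h _).trans (liftRight_of φ h₂ f g)

end Tr

/-! ### The algebra structure on the trace of a monoidal category -/

section Algebra

variable {k C}
variable [MonoidalCategory C] [MonoidalPreadditive C] [MonoidalLinear k C]

theorem tensorHom_add {X X' Y Y' : C} (f : X ⟶ X') (g g' : Y ⟶ Y') :
    f ⊗ₘ (g + g') = f ⊗ₘ g + f ⊗ₘ g' := by
  simp [MonoidalCategory.tensorHom_def]

theorem add_tensorHom {X X' Y Y' : C} (f f' : X ⟶ X') (g : Y ⟶ Y') :
    (f + f') ⊗ₘ g = f ⊗ₘ g + f' ⊗ₘ g := by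
  simp [MonoidalCategory.tensorHom_def]

theorem tensorHom_smul {X X' Y Y' : C} (c : k) (f : X ⟶ X') (g : Y ⟶ Y') :
    f ⊗ₘ (c • g) = c • (f ⊗ₘ g) := by
  simp [MonoidalCategory.tensorHom_def]

theorem smul_tensorHom {X X' Y Y' : C} (c : k) (f : X ⟶ X') (g : Y ⟶ Y') :
    (c • f) ⊗ₘ g = c • (f ⊗ₘ g) := by
  simp [MonoidalCategory.tensorHom_def]

namespace Tr

variable (k) in
/-- The bilinear map `(f, g) ↦ [f ⊗ g]`. -/
def tensorClass (X Y : C) : (X ⟶ X) →ₗ[k] (Y ⟶ Y) →ₗ[k] Tr k C :=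
  LinearMap.mk₂ k (fun f g => of k (f ⊗ₘ g))
    (fun f f' g => by rw [add_tensorHom, of_add]) (fun c f g => by rw [smul_tensorHom, of_smul])
    (fun f g g' => by rw [tensorHom_add, of_add]) (fun c f g => by rw [tensorHom_smul, of_smul])

theorem tensorClass_left {X X' : C} (f : X ⟶ X') (g : X' ⟶ X) {Y : C} (h : Y ⟶ Y) :
    tensorClass k X Y (f ≫ g) h = tensorClass k X' Y (g ≫ f) h := by
  have := of_comp_comm (k := k) (f ⊗ₘ h) (g ⊗ₘ 𝟙 Y)
  rw [tensorHom_comp_tensorHom, tensorHom_comp_tensorHom, Category.comp_id,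
    Category.id_comp] at this
  exact this

theorem tensorClass_right {X : C} (h : X ⟶ X) {Y Y' : C} (f : Y ⟶ Y') (g : Y' ⟶ Y) :
    tensorClass k X Y h (f ≫ g) = tensorClass k X Y' h (g ≫ f) := by
  have := of_comp_comm (k := k) (h ⊗ₘ f) (𝟙 X ⊗ₘ g)
  rw [tensorHom_comp_tensorHom, tensorHom_comp_tensorHom, Category.comp_id,
    Category.id_comp] at this
  exact this

variable (k C) in
/-- The multiplication `[f][g] = [f ⊗ g]` on the trace of a monoidal linear category. -/
def mulₗ : Tr k C →ₗ[k] Tr k C →ₗ[k] Tr k C :=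
  lift₂ (tensorClass k) tensorClass_left tensorClass_right

instance : Mul (Tr k C) := ⟨fun x y => mulₗ k C x y⟩

instance : One (Tr k C) := ⟨of k (𝟙 (𝟙_ C))⟩

theorem of_mul_of {X Y : C} (f : X ⟶ X) (g : Y ⟶ Y) : of k f * of k g = of k (f ⊗ₘ g) :=
  lift₂_of (tensorClass k) tensorClass_left tensorClass_right f g

theorem one_def : (1 : Tr k C) = of k (𝟙 (𝟙_ C)) := rfl

theorem mul_add' (x y z : Tr k C) : x * (y + z) = x * y + x * z := (mulₗ k C x).map_add y z

theorem add_mul' (x y z : Tr k C) : (x + y) * z = x * z + y * z :=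
  LinearMap.congr_fun ((mulₗ k C).map_add x y) z

theorem mul_zero' (x : Tr k C) : x * 0 = 0 := (mulₗ k C x).map_zero

theorem zero_mul' (x : Tr k C) : 0 * x = 0 := LinearMap.congr_fun (mulₗ k C).map_zero x

instance : Ring (Tr k C) where
  __ := (inferInstance : AddCommGroup (Tr k C))
  left_distrib := mul_add'
  right_distrib := add_mul'
  zero_mul := zero_mul'
  mul_zero := mul_zero'
  mul_assoc x y z := by
    induction x using induction with
    | hzero => simp only [zero_mul']
    | hadd x x' hx hx' => simp only [add_mul', hx, hx']
    | hof f =>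
      induction y using induction with
      | hzero => simp only [zero_mul', mul_zero']
      | hadd y y' hy hy' => simp only [add_mul', mul_add', hy, hy']
      | hof g =>
        induction z using induction with
        | hzero => simp only [mul_zero']
        | hadd z z' hz hz' => simp only [mul_add', hz, hz']
        | hof h =>
          simp only [of_mul_of]
          exact of_conj (α_ _ _ _) (associator_naturality f g h)
  one_mul x := by
    induction x using induction with
    | hzero => exact mul_zero' _
    | hadd x y hx hy => rw [mul_add', hx, hy]
    | hof f =>
      rw [one_def, of_mul_of]
      exact of_conj (λ_ _) (by simp)
  mul_one x := by
    induction x using induction with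
    | hzero => exact zero_mul' _
    | hadd x y hx hy => rw [add_mul', hx, hy]
    | hof f =>
      rw [one_def, of_mul_of]
      exact of_conj (ρ_ _) (by simp)

instance : Algebra k (Tr k C) :=
  Algebra.ofModule (fun c x y => LinearMap.congr_fun ((mulₗ k C).map_smul c x) y)
    (fun c x y => (mulₗ k C x).map_smul c y)

end Tr

end Algebra

/-! ### The module attached to a linear action of a monoidal category -/

section Action

open MonoidalLeftAction

variable [MonoidalCategory C]

/-- A linear categorical action: an action of a monoidal category which is linear in morphisms
of both variables. -/
class IsLinearAction [MonoidalLeftAction C D] : Prop where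
  add_actionHomLeft {X Y : C} (f g : X ⟶ Y) (U : D) : (f + g) ⊵ₗ U = f ⊵ₗ U + g ⊵ₗ U
  smul_actionHomLeft {X Y : C} (c : k) (f : X ⟶ Y) (U : D) : (c • f) ⊵ₗ U = c • f ⊵ₗ U
  actionHomRight_add (X : C) {U W : D} (f g : U ⟶ W) : X ⊴ₗ (f + g) = X ⊴ₗ f + X ⊴ₗ g
  actionHomRight_smul (X : C) {U W : D} (c : k) (f : U ⟶ W) : X ⊴ₗ (c • f) = c • X ⊴ₗ f

variable [MonoidalLeftAction C D] [IsLinearAction k C D]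

open IsLinearAction

variable {C D} in
/-- The bilinear map `(f, ψ) ↦ [F(X)(ψ) ∘ F(f)_U]`, where `F` denotes the action. -/
def Tr.actionClass (X : C) (U : D) : (X ⟶ X) →ₗ[k] (U ⟶ U) →ₗ[k] Tr k D :=
  LinearMap.mk₂ k (fun f ψ => Tr.of k (f ⊵ₗ U ≫ X ⊴ₗ ψ))
    (fun f f' ψ => by rw [add_actionHomLeft k, Preadditive.add_comp, Tr.of_add])
    (fun c f ψ => by rw [smul_actionHomLeft, Linear.smul_comp, Tr.of_smul])
    (fun f ψ ψ' => by rw [actionHomRight_add k, Preadditive.comp_add, Tr.of_add])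
    (fun c f ψ => by rw [actionHomRight_smul, Linear.comp_smul, Tr.of_smul])

variable {C D} in
theorem Tr.actionClass_left {X X' : C} (f : X ⟶ X') (g : X' ⟶ X) {U : D} (ψ : U ⟶ U) :
    Tr.actionClass k X U (f ≫ g) ψ = Tr.actionClass k X' U (g ≫ f) ψ := by
  have := Tr.of_comp_comm (k := k) (f ⊙ₗₘ ψ) (g ⊙ₗₘ 𝟙 U)
  rw [← actionHom_comp, ← actionHom_comp, Category.comp_id, Category.id_comp, actionHom_def,
    actionHom_def] at this
  exact this

variable {C D} in
theorem Tr.actionClass_right {X : C} (f : X ⟶ X) {U W : D} (ψ : U ⟶ W) (ψ' : W ⟶ U) :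
    Tr.actionClass k X U f (ψ ≫ ψ') = Tr.actionClass k X W f (ψ' ≫ ψ) := by
  have := Tr.of_comp_comm (k := k) (f ⊙ₗₘ ψ) (𝟙 X ⊙ₗₘ ψ')
  rw [← actionHom_comp, ← actionHom_comp, Category.comp_id, Category.id_comp, actionHom_def,
    actionHom_def] at this
  exact this

/-- The action `[f] [ψ] = [F(X)(ψ) ∘ F(f)_U]` of the trace of `C` on the trace of `D`, for
`f : X ⟶ X` and `ψ : U ⟶ U`. -/
def Tr.actₗ : Tr k C →ₗ[k] Tr k D →ₗ[k] Tr k D :=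
  Tr.lift₂ (Tr.actionClass k) (Tr.actionClass_left k) (Tr.actionClass_right k)

theorem Tr.actₗ_of {X : C} {U : D} (f : X ⟶ X) (ψ : U ⟶ U) :
    Tr.actₗ k C D (Tr.of k f) (Tr.of k ψ) = Tr.of k (f ⊵ₗ U ≫ X ⊴ₗ ψ) :=
  Tr.lift₂_of (Tr.actionClass k) (Tr.actionClass_left k) (Tr.actionClass_right k) f ψ

variable [MonoidalPreadditive C] [MonoidalLinear k C]

/-- The module over the algebra `Tr C` attached to a linear action of `C` on `D`. -/
abbrev Tr.actionModule : Module (Tr k C) (Tr k D) where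
  smul x z := Tr.actₗ k C D x z
  smul_zero x := (Tr.actₗ k C D x).map_zero
  smul_add x := (Tr.actₗ k C D x).map_add
  zero_smul z := LinearMap.congr_fun (Tr.actₗ k C D).map_zero z
  add_smul x y z := LinearMap.congr_fun ((Tr.actₗ k C D).map_add x y) z
  one_smul z := by
    refine LinearMap.congr_fun (f := Tr.actₗ k C D 1) (g := LinearMap.id) (Tr.hom_ext ?_) z
    intro U ψ
    rw [Tr.one_def, Tr.actₗ_of]
    exact Tr.of_conj (λₗ U) (by simp)
  mul_smul x y z := by
    induction x using Tr.induction with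
    | hzero =>
      change Tr.actₗ k C D (0 * y) z = Tr.actₗ k C D 0 _
      rw [zero_mul, map_zero]
      rfl
    | hadd x x' hx hx' =>
      change Tr.actₗ k C D (x * y) z = Tr.actₗ k C D x (Tr.actₗ k C D y z) at hx
      change Tr.actₗ k C D (x' * y) z = Tr.actₗ k C D x' (Tr.actₗ k C D y z) at hx'
      change Tr.actₗ k C D ((x + x') * y) z = Tr.actₗ k C D (x + x') (Tr.actₗ k C D y z)
      rw [add_mul, map_add, map_add, LinearMap.add_apply, LinearMap.add_apply, hx, hx']
    | hof f =>
      induction y using Tr.induction with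
      | hzero =>
        change Tr.actₗ k C D (_ * 0) z = Tr.actₗ k C D _ (Tr.actₗ k C D 0 z)
        rw [mul_zero, map_zero, LinearMap.zero_apply, map_zero]
      | hadd y y' hy hy' =>
        change Tr.actₗ k C D (_ * y) z = Tr.actₗ k C D _ (Tr.actₗ k C D y z) at hy
        change Tr.actₗ k C D (_ * y') z = Tr.actₗ k C D _ (Tr.actₗ k C D y' z) at hy'
        change Tr.actₗ k C D (_ * (y + y')) z = Tr.actₗ k C D _ (Tr.actₗ k C D (y + y') z)
        rw [mul_add, map_add, map_add, LinearMap.add_apply, LinearMap.add_apply, map_add, hy, hy']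
      | hof g =>
        refine LinearMap.congr_fun (f := Tr.actₗ k C D (Tr.of k f * Tr.of k g))
          (g := Tr.actₗ k C D (Tr.of k f) ∘ₗ Tr.actₗ k C D (Tr.of k g)) (Tr.hom_ext ?_) z
        intro U ψ
        rw [LinearMap.comp_apply, Tr.of_mul_of, Tr.actₗ_of, Tr.actₗ_of, Tr.actₗ_of]
        refine Tr.of_conj (αₗ _ _ U) ?_
        rw [← actionHom_def, ← actionHom_def, ← actionHom_def]
        exact actionAssocIso_hom_naturality f g ψ

end Action

end Trace

namespace HPrime

open SymMod

instance : IsLinearAction ℂ HPrime SymMod where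
  add_actionHomLeft := by rintro X Y ⟨f⟩ ⟨g⟩ U; rfl
  smul_actionHomLeft := by rintro X Y c ⟨f⟩ U; rfl
  actionHomRight_add X _ _ _ _ := (functor X).map_add
  actionHomRight_smul X _ _ c f := (functor X).map_smul c f

end HPrime

end HeisenbergTrace
end

noncomputable section

open CategoryTheory MonoidalCategory

namespace HeisenbergTrace

/-! ### The Karoubi envelope of a monoidal linear category -/

namespace KaroubiEnvelope

open Idempotents

universe w v u

variable {k : Type w} [CommRing k] {C : Type u} [Category.{v} C]

section Linear

variable [Preadditive C] [Linear k C]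

instance (P Q : Karoubi C) : SMul k (P ⟶ Q) where
  smul c f := ⟨c • f.f, by rw [Linear.smul_comp, Linear.comp_smul, f.comm]⟩

theorem smul_f {P Q : Karoubi C} (c : k) (f : P ⟶ Q) : (c • f).f = c • f.f := rfl

/-- The `k`-module structure on morphisms. -/
abbrev homModule (P Q : Karoubi C) : Module k (P ⟶ Q) where
  one_smul f := Karoubi.hom_ext _ _ (one_smul k f.f)
  mul_smul c d f := Karoubi.hom_ext _ _ (mul_smul c d f.f)
  smul_zero c := Karoubi.hom_ext _ _ (smul_zero (A := P.X ⟶ Q.X) c)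
  smul_add c f g := Karoubi.hom_ext _ _ (smul_add c f.f g.f)
  add_smul c d f := Karoubi.hom_ext _ _ (add_smul c d f.f)
  zero_smul f := Karoubi.hom_ext _ _ (zero_smul k f.f)

instance : Linear k (Karoubi C) where
  homModule := homModule
  smul_comp _ _ _ c f g := Karoubi.hom_ext _ _ (Linear.smul_comp _ _ _ c f.f g.f)
  comp_smul _ _ _ f c g := Karoubi.hom_ext _ _ (Linear.comp_smul _ _ _ f.f c g.f)

end Linear

section Monoidal

variable [MonoidalCategory C]

section Idempotent

variable {W X Y Z : C} {w : W ⟶ W} {x : X ⟶ X} {y : Y ⟶ Y} {z : Z ⟶ Z}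

theorem idem_pentagon (hw : w ≫ w = w) (hx : x ≫ x = x) (hy : y ≫ y = y) (hz : z ≫ z = z) :
    ((((w ⊗ₘ x) ⊗ₘ y) ≫ (α_ W X Y).hom) ⊗ₘ z) ≫
        (((w ⊗ₘ (x ⊗ₘ y)) ⊗ₘ z) ≫ (α_ W (X ⊗ Y) Z).hom) ≫
          (w ⊗ₘ (((x ⊗ₘ y) ⊗ₘ z) ≫ (α_ X Y Z).hom)) =
      ((((w ⊗ₘ x) ⊗ₘ y) ⊗ₘ z) ≫ (α_ (W ⊗ X) Y Z).hom) ≫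
        ((w ⊗ₘ x) ⊗ₘ (y ⊗ₘ z)) ≫ (α_ W X (Y ⊗ Z)).hom := by
  have e₁ : (((w ⊗ₘ x) ⊗ₘ y) ≫ (α_ W X Y).hom) ⊗ₘ z =
      (((w ⊗ₘ x) ⊗ₘ y) ⊗ₘ z) ≫ (α_ W X Y).hom ▷ Z := by
    rw [← tensorHom_id, tensorHom_comp_tensorHom, Category.comp_id]
  have e₂ : w ⊗ₘ (((x ⊗ₘ y) ⊗ₘ z) ≫ (α_ X Y Z).hom) =
      (w ⊗ₘ ((x ⊗ₘ y) ⊗ₘ z)) ≫ W ◁ (α_ X Y Z).hom := by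
    rw [← id_tensorHom, tensorHom_comp_tensorHom, Category.comp_id]
  have e₃ : (α_ W X Y).hom ▷ Z ≫ ((w ⊗ₘ (x ⊗ₘ y)) ⊗ₘ z) =
      (((w ⊗ₘ x) ⊗ₘ y) ⊗ₘ z) ≫ (α_ W X Y).hom ▷ Z := by
    rw [← tensorHom_id, tensorHom_comp_tensorHom, tensorHom_comp_tensorHom,
      associator_naturality, Category.comp_id, Category.id_comp]
  have e₄ : (((w ⊗ₘ x) ⊗ₘ y) ⊗ₘ z) ≫ (((w ⊗ₘ x) ⊗ₘ y) ⊗ₘ z) = (((w ⊗ₘ x) ⊗ₘ y) ⊗ₘ z) := by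
    simp only [tensorHom_comp_tensorHom, hw, hx, hy, hz]
  rw [e₁, e₂]
  simp only [Category.assoc]
  rw [← associator_naturality_assoc (w ⊗ₘ x) y z, reassoc_of% e₃, reassoc_of% e₄,
    reassoc_of% e₄, ← associator_naturality_assoc w (x ⊗ₘ y) z, reassoc_of% e₃, reassoc_of% e₄,
    pentagon]

theorem idem_triangle (hx : x ≫ x = x) (hy : y ≫ y = y) :
    (((x ⊗ₘ 𝟙 (𝟙_ C)) ⊗ₘ y) ≫ (α_ X (𝟙_ C) Y).hom) ≫
        (x ⊗ₘ ((𝟙 (𝟙_ C) ⊗ₘ y) ≫ (λ_ Y).hom)) =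
      ((x ⊗ₘ 𝟙 (𝟙_ C)) ≫ (ρ_ X).hom) ⊗ₘ y := by
  have e₁ : ((x ⊗ₘ 𝟙 (𝟙_ C)) ≫ (ρ_ X).hom) ⊗ₘ y =
      ((x ⊗ₘ 𝟙 (𝟙_ C)) ⊗ₘ y) ≫ (ρ_ X).hom ▷ Y := by
    rw [← tensorHom_id, tensorHom_comp_tensorHom, Category.comp_id]
  have e₂ : x ⊗ₘ ((𝟙 (𝟙_ C) ⊗ₘ y) ≫ (λ_ Y).hom) =
      (x ⊗ₘ (𝟙 (𝟙_ C) ⊗ₘ y)) ≫ X ◁ (λ_ Y).hom := by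
    rw [← id_tensorHom, tensorHom_comp_tensorHom, Category.comp_id]
  have e₄ : ((x ⊗ₘ 𝟙 (𝟙_ C)) ⊗ₘ y) ≫ ((x ⊗ₘ 𝟙 (𝟙_ C)) ⊗ₘ y) = ((x ⊗ₘ 𝟙 (𝟙_ C)) ⊗ₘ y) := by
    simp only [tensorHom_comp_tensorHom, hx, hy, Category.comp_id]
  rw [e₁, e₂, Category.assoc, ← associator_naturality_assoc, reassoc_of% e₄, triangle]

end Idempotent

/-- The tensor product `(X, p) ⊗ (Y, q) = (X ⊗ Y, p ⊗ q)`. -/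
def tensorObj (P Q : Karoubi C) : Karoubi C :=
  ⟨P.X ⊗ Q.X, P.p ⊗ₘ Q.p, by rw [tensorHom_comp_tensorHom, P.idem, Q.idem]⟩

/-- The tensor product of morphisms. -/
def tensorHom {P P' Q Q' : Karoubi C} (f : P ⟶ P') (g : Q ⟶ Q') :
    tensorObj P Q ⟶ tensorObj P' Q' :=
  ⟨f.f ⊗ₘ g.f, by
    change (P.p ⊗ₘ Q.p) ≫ (f.f ⊗ₘ g.f) ≫ (P'.p ⊗ₘ Q'.p) = _
    rw [tensorHom_comp_tensorHom, tensorHom_comp_tensorHom, f.comm, g.comm]⟩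

/-- An isomorphism of underlying objects that intertwines the idempotents gives an isomorphism. -/
def mkIso {P Q : Karoubi C} (e : P.X ≅ Q.X) (h : P.p ≫ e.hom = e.hom ≫ Q.p) : P ≅ Q where
  hom := ⟨P.p ≫ e.hom, by rw [Category.assoc, ← h, P.idem_assoc, P.idem_assoc]⟩
  inv := ⟨Q.p ≫ e.inv, by
    have h' : Q.p ≫ e.inv = e.inv ≫ P.p := by rw [Iso.comp_inv_eq, Category.assoc, h]; simp
    rw [Category.assoc, ← h', Q.idem_assoc, Q.idem_assoc]⟩
  hom_inv_id := Karoubi.hom_ext _ _ (by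
    change (P.p ≫ e.hom) ≫ Q.p ≫ e.inv = P.p
    rw [Category.assoc, ← reassoc_of% h]; simp)
  inv_hom_id := Karoubi.hom_ext _ _ (by
    have h' : Q.p ≫ e.inv = e.inv ≫ P.p := by rw [Iso.comp_inv_eq, Category.assoc, h]; simp
    change (Q.p ≫ e.inv) ≫ P.p ≫ e.hom = Q.p
    rw [Category.assoc, ← reassoc_of% h']; simp)

instance monoidalStruct : MonoidalCategoryStruct (Karoubi C) where
  tensorObj := tensorObj
  tensorHom := tensorHom
  whiskerLeft P _ _ f := tensorHom (𝟙 P) f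
  whiskerRight f Q := tensorHom f (𝟙 Q)
  tensorUnit := (toKaroubi C).obj (𝟙_ C)
  associator P Q R := mkIso (P := tensorObj (tensorObj P Q) R) (Q := tensorObj P (tensorObj Q R))
    (α_ P.X Q.X R.X) (associator_naturality P.p Q.p R.p)
  leftUnitor P := mkIso (P := tensorObj ((toKaroubi C).obj (𝟙_ C)) P) (λ_ P.X) (by
    change (𝟙 (𝟙_ C) ⊗ₘ P.p) ≫ (λ_ P.X).hom = (λ_ P.X).hom ≫ P.p
    rw [id_tensorHom, leftUnitor_naturality])
  rightUnitor P := mkIso (P := tensorObj P ((toKaroubi C).obj (𝟙_ C))) (ρ_ P.X) (by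
    change (P.p ⊗ₘ 𝟙 (𝟙_ C)) ≫ (ρ_ P.X).hom = (ρ_ P.X).hom ≫ P.p
    rw [tensorHom_id, rightUnitor_naturality])

theorem tensorHom_f {P P' Q Q' : Karoubi C} (f : P ⟶ P') (g : Q ⟶ Q') :
    (f ⊗ₘ g).f = f.f ⊗ₘ g.f := rfl

theorem whiskerLeft_f (P : Karoubi C) {Q Q' : Karoubi C} (g : Q ⟶ Q') :
    (P ◁ g).f = P.p ⊗ₘ g.f := rfl

theorem whiskerRight_f {P P' : Karoubi C} (f : P ⟶ P') (Q : Karoubi C) :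
    (f ▷ Q).f = f.f ⊗ₘ Q.p := rfl

instance monoidal : MonoidalCategory (Karoubi C) where
  tensorHom_def {P P' Q Q'} f g := Karoubi.hom_ext _ _ (by
    change f.f ⊗ₘ g.f = (f.f ⊗ₘ Q.p) ≫ (P'.p ⊗ₘ g.f)
    rw [tensorHom_comp_tensorHom, Karoubi.comp_p, Karoubi.p_comp])
  id_tensorHom_id P Q := rfl
  tensorHom_comp_tensorHom f₁ f₂ g₁ g₂ :=
    Karoubi.hom_ext _ _ (tensorHom_comp_tensorHom f₁.f f₂.f g₁.f g₂.f)
  whiskerLeft_id P Q := rfl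
  id_whiskerRight P Q := rfl
  associator_naturality {P₁ P₂ P₃ Q₁ Q₂ Q₃} f₁ f₂ f₃ := Karoubi.hom_ext _ _ (by
    change ((f₁.f ⊗ₘ f₂.f) ⊗ₘ f₃.f) ≫ ((Q₁.p ⊗ₘ Q₂.p) ⊗ₘ Q₃.p) ≫ (α_ Q₁.X Q₂.X Q₃.X).hom =
      (((P₁.p ⊗ₘ P₂.p) ⊗ₘ P₃.p) ≫ (α_ P₁.X P₂.X P₃.X).hom) ≫ (f₁.f ⊗ₘ (f₂.f ⊗ₘ f₃.f))
    rw [Category.assoc, ← associator_naturality, ← Category.assoc, ← Category.assoc]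
    simp only [tensorHom_comp_tensorHom, Karoubi.comp_p, Karoubi.p_comp])
  leftUnitor_naturality {P Q} f := Karoubi.hom_ext _ _ (by
    change (𝟙 (𝟙_ C) ⊗ₘ f.f) ≫ (𝟙 (𝟙_ C) ⊗ₘ Q.p) ≫ (λ_ Q.X).hom =
      ((𝟙 (𝟙_ C) ⊗ₘ P.p) ≫ (λ_ P.X).hom) ≫ f.f
    rw [id_tensorHom, id_tensorHom, id_tensorHom, leftUnitor_naturality, leftUnitor_naturality,
      leftUnitor_naturality_assoc, Category.assoc, Karoubi.comp_p, Karoubi.p_comp])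
  rightUnitor_naturality {P Q} f := Karoubi.hom_ext _ _ (by
    change (f.f ⊗ₘ 𝟙 (𝟙_ C)) ≫ (Q.p ⊗ₘ 𝟙 (𝟙_ C)) ≫ (ρ_ Q.X).hom =
      ((P.p ⊗ₘ 𝟙 (𝟙_ C)) ≫ (ρ_ P.X).hom) ≫ f.f
    rw [tensorHom_id, tensorHom_id, tensorHom_id, rightUnitor_naturality, rightUnitor_naturality,
      rightUnitor_naturality_assoc, Category.assoc, Karoubi.comp_p, Karoubi.p_comp])
  pentagon W X Y Z := Karoubi.hom_ext _ _ (idem_pentagon W.idem X.idem Y.idem Z.idem)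
  triangle X Y := Karoubi.hom_ext _ _ (idem_triangle X.idem Y.idem)

variable [Preadditive C] [MonoidalPreadditive C]

instance : MonoidalPreadditive (Karoubi C) where
  whiskerLeft_zero {P Q R} := Karoubi.hom_ext _ _ (by
    rw [whiskerLeft_f]
    change P.p ⊗ₘ (0 : Q.X ⟶ R.X) = 0
    simp [MonoidalCategory.tensorHom_def])
  zero_whiskerRight {P Q R} := Karoubi.hom_ext _ _ (by
    rw [whiskerRight_f]
    change (0 : Q.X ⟶ R.X) ⊗ₘ P.p = 0
    simp [MonoidalCategory.tensorHom_def])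
  whiskerLeft_add f g := Karoubi.hom_ext _ _ (tensorHom_add _ f.f g.f)
  add_whiskerRight f g := Karoubi.hom_ext _ _ (add_tensorHom f.f g.f _)

variable [Linear k C] [MonoidalLinear k C]

instance : MonoidalLinear k (Karoubi C) where
  whiskerLeft_smul _ _ _ c f := Karoubi.hom_ext _ _ (tensorHom_smul c _ f.f)
  smul_whiskerRight c _ _ f _ := Karoubi.hom_ext _ _ (smul_tensorHom c f.f _)

end Monoidal

section TraceMap

variable [Preadditive C] [Linear k C]

variable (k) in
/-- The linear map `End (X, p) → Tr C`, `f ↦ [f]`. -/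
def traceClass (P : Karoubi C) : (P ⟶ P) →ₗ[k] Tr k C where
  toFun f := Tr.of k f.f
  map_add' f g := Tr.of_add f.f g.f
  map_smul' c f := Tr.of_smul c f.f

theorem traceClass_comm {P Q : Karoubi C} (f : P ⟶ Q) (g : Q ⟶ P) :
    traceClass k P (f ≫ g) = traceClass k Q (g ≫ f) :=
  Tr.of_comp_comm f.f g.f

variable (k C) in
/-- The natural map `Tr (Kar C) → Tr C`, which forgets the idempotents. -/
def traceMapₗ : Tr k (Karoubi C) →ₗ[k] Tr k C := Tr.lift (traceClass k) traceClass_comm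

theorem traceClass_apply {P : Karoubi C} (f : P ⟶ P) : traceClass k P f = Tr.of k f.f := rfl

theorem traceMapₗ_of {P : Karoubi C} (f : P ⟶ P) : traceMapₗ k C (Tr.of k f) = Tr.of k f.f := by
  rw [← traceClass_apply]
  rw [traceMapₗ, Tr.lift_of]

variable [MonoidalCategory C] [MonoidalPreadditive C] [MonoidalLinear k C]

variable (k C) in
/-- The natural map `Tr (Kar C) → Tr C` as a homomorphism of algebras. -/
def traceMap : Tr k (Karoubi C) →ₐ[k] Tr k C :=
  AlgHom.ofLinearMap (traceMapₗ k C) (traceMapₗ_of (𝟙 (𝟙_ (Karoubi C)))) (fun x y => by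
    induction x using Tr.induction with
    | hzero => rw [zero_mul, map_zero, zero_mul]
    | hadd x x' hx hx' => rw [add_mul, map_add, map_add, add_mul, hx, hx']
    | hof f =>
      induction y using Tr.induction with
      | hzero => rw [mul_zero, map_zero, mul_zero]
      | hadd y y' hy hy' => rw [mul_add, map_add, map_add, mul_add, hy, hy']
      | hof g => rw [Tr.of_mul_of, traceMapₗ_of, traceMapₗ_of, traceMapₗ_of, Tr.of_mul_of]; rfl)

end TraceMap

end KaroubiEnvelope

end HeisenbergTrace
end

noncomputable section

open CategoryTheory

namespace HeisenbergTrace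

/-! ### The Heisenberg category and its module `V` -/

/-- The direct sum `⊕_n Tr (ℂ[S_n]-mod)`. -/
def V : Type 1 := DirectSum ℕ fun n => Tr ℂ (FGModuleCat.{0} (SymAlg n))

namespace V

instance : AddCommGroup V :=
  inferInstanceAs (AddCommGroup (DirectSum ℕ fun n => Tr ℂ (FGModuleCat.{0} (SymAlg n))))

instance : Module ℂ V :=
  inferInstanceAs (Module ℂ (DirectSum ℕ fun n => Tr ℂ (FGModuleCat.{0} (SymAlg n))))

/-- The inclusion of the `n`-th summand. -/
def lof (n : ℕ) : Tr ℂ (FGModuleCat.{0} (SymAlg n)) →ₗ[ℂ] V :=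
  DirectSum.lof ℂ ℕ (fun n => Tr ℂ (FGModuleCat.{0} (SymAlg n))) n

/-- The projection onto the `n`-th summand. -/
def component (n : ℕ) : V →ₗ[ℂ] Tr ℂ (FGModuleCat.{0} (SymAlg n)) :=
  DirectSum.component ℂ ℕ (fun n => Tr ℂ (FGModuleCat.{0} (SymAlg n))) n

theorem ext {x y : V} (h : ∀ n, component n x = component n y) : x = y :=
  DFinsupp.ext h

theorem component_lof_self (n : ℕ) (x : Tr ℂ (FGModuleCat.{0} (SymAlg n))) :
    component n (lof n x) = x :=
  DirectSum.component.lof_self (M := fun n => Tr ℂ (FGModuleCat.{0} (SymAlg n))) ℂ n x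

theorem component_lof_ne {m n : ℕ} (h : n ≠ m) (x : Tr ℂ (FGModuleCat.{0} (SymAlg n))) :
    component m (lof n x) = 0 :=
  DFinsupp.single_eq_of_ne h.symm

theorem hom_ext {M : Type*} [AddCommGroup M] [Module ℂ M] {φ ψ : V →ₗ[ℂ] M}
    (h : ∀ n x, φ (lof n x) = ψ (lof n x)) : φ = ψ :=
  DirectSum.linearMap_ext ℂ fun n => LinearMap.ext (h n)

end V

namespace SymMod

/-- A bound for the degrees in which `M` is nonzero. -/
def bound (M : SymMod) : ℕ := Classical.choose M.finite

theorem app_eq_zero {M N : SymMod} (f : M ⟶ N) {n : ℕ} (hn : M.bound ≤ n) : f n = 0 := by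
  have := Classical.choose_spec M.finite n hn
  exact zero_hom_ext _ _

/-- The linear map `f ↦ ∑_n [f_n]`. -/
def sumClass (M : SymMod) : (M ⟶ M) →ₗ[ℂ] V where
  toFun f := ∑ n ∈ Finset.range M.bound, V.lof n (Tr.of ℂ (f n))
  map_add' f g := by
    rw [← Finset.sum_add_distrib]
    exact Finset.sum_congr rfl fun n _ => by rw [add_app, Tr.of_add, map_add]
  map_smul' c f := by
    rw [RingHom.id_apply, Finset.smul_sum]
    exact Finset.sum_congr rfl fun n _ => by rw [smul_app, Tr.of_smul, map_smul]

theorem of_zero {C : Type*} [Category* C] [Preadditive C] [Linear ℂ C] (X : C) :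
    Tr.of ℂ (0 : X ⟶ X) = 0 := (Tr.ofₗ ℂ C X).map_zero

theorem component_sumClass {M : SymMod} (f : M ⟶ M) (n : ℕ) :
    V.component n (sumClass M f) = Tr.of ℂ (f n) := by
  change V.component n (∑ m ∈ Finset.range M.bound, V.lof m (Tr.of ℂ (f m))) = _
  rw [map_sum]
  by_cases hn : n < M.bound
  · rw [Finset.sum_eq_single n (fun m _ hm => V.component_lof_ne hm _)
      (fun h => absurd (Finset.mem_range.2 hn) h), V.component_lof_self]
  · rw [app_eq_zero f (not_lt.1 hn), of_zero]
    exact Finset.sum_eq_zero fun m hm => V.component_lof_ne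
      (fun h => hn (by rw [← h]; exact Finset.mem_range.1 hm)) _

theorem sumClass_comm {M N : SymMod} (f : M ⟶ N) (g : N ⟶ M) :
    sumClass M (f ≫ g) = sumClass N (g ≫ f) :=
  V.ext fun n => by
    rw [component_sumClass, component_sumClass, comp_app, comp_app, Tr.of_comp_comm]

/-- The linear map `Tr (⊕_n ℂ[S_n]-mod) → ⊕_n Tr (ℂ[S_n]-mod)`. -/
def toV : Tr ℂ SymMod →ₗ[ℂ] V := Tr.lift sumClass sumClass_comm

theorem toV_of {M : SymMod} (f : M ⟶ M) : toV (Tr.of ℂ f) = sumClass M f := by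
  rw [toV, Tr.lift_of]

variable {n : ℕ}

/-- The object which is `X` in degree `n` and zero in all other degrees. -/
def single (X : FGModuleCat.{0} (SymAlg n)) : SymMod where
  obj m := if h : m = n then h ▸ X else FGModuleCat.of (SymAlg m) PUnit
  finite := ⟨n + 1, fun m hm => by
    rw [dif_neg (by omega)]; exact inferInstanceAs (Subsingleton PUnit)⟩

theorem single_obj_self (X : FGModuleCat.{0} (SymAlg n)) : (single X).obj n = X := dif_pos rfl

theorem single_obj_ne (X : FGModuleCat.{0} (SymAlg n)) {m : ℕ} (h : m ≠ n) :
    Subsingleton ((single X).obj m) := by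
  rw [show (single X).obj m = FGModuleCat.of (SymAlg m) PUnit from dif_neg h]
  exact inferInstanceAs (Subsingleton PUnit)

/-- A morphism into a degree-`n` object from its component in degree `n`. -/
def homSingle (M : SymMod) {X : FGModuleCat.{0} (SymAlg n)} (g : M.obj n ⟶ X) : M ⟶ single X :=
  fun m => if h : m = n then by
    subst h; exact g ≫ eqToHom (single_obj_self X).symm else 0

/-- A morphism out of a degree-`n` object from its component in degree `n`. -/
def singleHom (M : SymMod) {X : FGModuleCat.{0} (SymAlg n)} (g : X ⟶ M.obj n) : single X ⟶ M :=
  fun m => if h : m = n then by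
    subst h; exact eqToHom (single_obj_self X) ≫ g else 0

theorem homSingle_self (M : SymMod) {X : FGModuleCat.{0} (SymAlg n)} (g : M.obj n ⟶ X) :
    homSingle M g n = g ≫ eqToHom (single_obj_self X).symm := by
  unfold homSingle; rw [dif_pos rfl]

theorem singleHom_self (M : SymMod) {X : FGModuleCat.{0} (SymAlg n)} (g : X ⟶ M.obj n) :
    singleHom M g n = eqToHom (single_obj_self X) ≫ g := by
  unfold singleHom; rw [dif_pos rfl]

theorem homSingle_ne (M : SymMod) {X : FGModuleCat.{0} (SymAlg n)} (g : M.obj n ⟶ X) {m : ℕ}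
    (h : m ≠ n) : homSingle M g m = 0 := by
  unfold homSingle; rw [dif_neg h]

/-- The morphism between degree-`n` objects given by a morphism of modules. -/
def singleMap {X Y : FGModuleCat.{0} (SymAlg n)} (g : X ⟶ Y) : single X ⟶ single Y :=
  singleHom (single Y) (g ≫ eqToHom (single_obj_self Y).symm)

theorem singleMap_self {X Y : FGModuleCat.{0} (SymAlg n)} (g : X ⟶ Y) :
    singleMap g n = eqToHom (single_obj_self X) ≫ g ≫ eqToHom (single_obj_self Y).symm :=
  singleHom_self _ _

theorem single_hom_ext {X Y : FGModuleCat.{0} (SymAlg n)} {f g : single X ⟶ single Y}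
    (h : f n = g n) : f = g := by
  refine SymMod.hom_ext fun m => ?_
  by_cases hm : m = n
  · subst hm; exact h
  · have := single_obj_ne X hm
    exact zero_hom_ext _ _

/-- The linear map `[g] ↦ [g placed in degree n]` on `End X`. -/
def singleClass (X : FGModuleCat.{0} (SymAlg n)) : (X ⟶ X) →ₗ[ℂ] Tr ℂ SymMod where
  toFun g := Tr.of ℂ (singleMap g)
  map_add' f g := by
    rw [← Tr.of_add]
    exact congrArg (Tr.of ℂ) (single_hom_ext (by
      rw [add_app, singleMap_self, singleMap_self, singleMap_self, Preadditive.add_comp,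
        Preadditive.comp_add]))
  map_smul' c f := by
    rw [RingHom.id_apply, ← Tr.of_smul]
    exact congrArg (Tr.of ℂ) (single_hom_ext (by
      rw [smul_app, singleMap_self, singleMap_self, Linear.smul_comp, Linear.comp_smul]))

theorem singleMap_comp {X Y Z : FGModuleCat.{0} (SymAlg n)} (f : X ⟶ Y) (g : Y ⟶ Z) :
    singleMap (f ≫ g) = singleMap f ≫ singleMap g :=
  single_hom_ext (by
    rw [comp_app, singleMap_self, singleMap_self, singleMap_self]; simp)

theorem singleClass_comm {X Y : FGModuleCat.{0} (SymAlg n)} (f : X ⟶ Y) (g : Y ⟶ X) :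
    singleClass X (f ≫ g) = singleClass Y (g ≫ f) := by
  change Tr.of ℂ (singleMap (f ≫ g)) = Tr.of ℂ (singleMap (g ≫ f))
  rw [singleMap_comp, singleMap_comp, Tr.of_comp_comm]

variable (n) in
/-- The linear map `Tr (ℂ[S_n]-mod) → Tr (⊕_n ℂ[S_n]-mod)`. -/
def singleTr : Tr ℂ (FGModuleCat.{0} (SymAlg n)) →ₗ[ℂ] Tr ℂ SymMod :=
  Tr.lift singleClass singleClass_comm

theorem singleTr_of {X : FGModuleCat.{0} (SymAlg n)} (g : X ⟶ X) :
    singleTr n (Tr.of ℂ g) = Tr.of ℂ (singleMap g) := by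
  rw [singleTr, Tr.lift_of]; rfl

/-- The linear map `⊕_n Tr (ℂ[S_n]-mod) → Tr (⊕_n ℂ[S_n]-mod)`. -/
def ofV : V →ₗ[ℂ] Tr ℂ SymMod := DirectSum.toModule ℂ ℕ (Tr ℂ SymMod) singleTr

theorem ofV_lof (x : Tr ℂ (FGModuleCat.{0} (SymAlg n))) : ofV (V.lof n x) = singleTr n x := by
  change DirectSum.toModule ℂ ℕ (Tr ℂ SymMod) singleTr
    (DirectSum.lof ℂ ℕ (fun n => Tr ℂ (FGModuleCat.{0} (SymAlg n))) n x) = _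
  rw [DirectSum.toModule_lof]

theorem toV_ofV : toV ∘ₗ ofV = LinearMap.id := by
  refine V.hom_ext fun n x => ?_
  rw [LinearMap.comp_apply, ofV_lof, LinearMap.id_apply]
  refine LinearMap.congr_fun (f := toV ∘ₗ singleTr n) (g := V.lof n) (Tr.hom_ext fun {X} g => ?_) x
  rw [LinearMap.comp_apply, singleTr_of, toV_of]
  refine V.ext fun m => ?_
  rw [component_sumClass]
  by_cases h : m = n
  · subst h
    rw [V.component_lof_self, singleMap_self]
    exact Tr.of_conj (eqToIso (single_obj_self X)) (by simp)
  · have := single_obj_ne X h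
    rw [V.component_lof_ne (Ne.symm h), zero_hom_ext (singleMap g m) 0, of_zero]

theorem sum_app {M N : SymMod} {ι : Type*} (s : Finset ι) (f : ι → (M ⟶ N)) (m : ℕ) :
    (∑ i ∈ s, f i) m = ∑ i ∈ s, f i m :=
  map_sum (⟨⟨fun f : M ⟶ N => f m, rfl⟩, fun _ _ => rfl⟩ : (M ⟶ N) →+ (M.obj m ⟶ N.obj m)) f s

theorem ofV_toV : ofV ∘ₗ toV = LinearMap.id := by
  refine Tr.hom_ext fun {M} f => ?_
  rw [LinearMap.comp_apply, toV_of, LinearMap.id_apply]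
  change ofV (∑ n ∈ Finset.range M.bound, V.lof n (Tr.of ℂ (f n))) = _
  have h₁ (n : ℕ) : ofV (V.lof n (Tr.of ℂ (f n))) =
      Tr.of ℂ ((f ≫ homSingle M (𝟙 (M.obj n))) ≫ singleHom M (𝟙 (M.obj n))) := by
    rw [ofV_lof, singleTr_of, Tr.of_comp_comm]
    refine congrArg (Tr.of ℂ) (single_hom_ext ?_)
    rw [singleMap_self, comp_app, comp_app, homSingle_self, singleHom_self]
    simp
  have h₂ : f = ∑ n ∈ Finset.range M.bound,
      ((f ≫ homSingle M (𝟙 (M.obj n))) ≫ singleHom M (𝟙 (M.obj n))) := by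
    refine SymMod.hom_ext fun m => ?_
    rw [sum_app]
    by_cases hm : m < M.bound
    · rw [Finset.sum_eq_single m]
      · rw [comp_app, comp_app, homSingle_self, singleHom_self]; simp
      · intro n _ hn
        rw [comp_app, comp_app, homSingle_ne _ _ (Ne.symm hn), Limits.comp_zero, Limits.zero_comp]
      · exact fun h => absurd (Finset.mem_range.2 hm) h
    · rw [app_eq_zero f (not_lt.1 hm)]
      exact (Finset.sum_eq_zero fun n _ => app_eq_zero _ (not_lt.1 hm)).symm
  rw [map_sum, Finset.sum_congr rfl fun n _ => h₁ n]
  conv_rhs => rw [h₂]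
  exact (map_sum (Tr.ofₗ ℂ SymMod M) _ _).symm

/-- The identification `Tr (⊕_n ℂ[S_n]-mod) = ⊕_n Tr (ℂ[S_n]-mod)`. -/
def trEquiv : Tr ℂ SymMod ≃ₗ[ℂ] V := LinearEquiv.ofLinearMap toV ofV toV_ofV ofV_toV

end SymMod

/-- Khovanov's Heisenberg category `H`, the Karoubi envelope of `H'`. -/
abbrev H : Type := Idempotents.Karoubi HPrime

/-- The action of `Tr H'` on `V` given by the categorical action of `H'` on `⊕_n ℂ[S_n]-mod`. -/
abbrev HPrime.traceModule : Module (Tr ℂ HPrime) V :=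
  letI := Tr.actionModule ℂ HPrime SymMod
  { smul := fun x v => SymMod.toV (x • SymMod.ofV v)
    one_smul := fun v => by
      change SymMod.toV ((1 : Tr ℂ HPrime) • SymMod.ofV v) = v
      rw [one_smul]
      exact LinearMap.congr_fun SymMod.toV_ofV v
    mul_smul := fun x y v => by
      change SymMod.toV ((x * y) • SymMod.ofV v) =
        SymMod.toV (x • SymMod.ofV (SymMod.toV (y • SymMod.ofV v)))
      rw [mul_smul]
      exact congrArg (fun z => SymMod.toV (x • z))
        (LinearMap.congr_fun SymMod.ofV_toV (y • SymMod.ofV v)).symm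
    smul_zero := fun x => by
      change SymMod.toV (x • SymMod.ofV 0) = 0
      rw [map_zero, smul_zero, map_zero]
    smul_add := fun x v w => by
      change SymMod.toV (x • SymMod.ofV (v + w)) =
        SymMod.toV (x • SymMod.ofV v) + SymMod.toV (x • SymMod.ofV w)
      rw [map_add, smul_add, map_add]
    add_smul := fun x y v => by
      change SymMod.toV ((x + y) • SymMod.ofV v) =
        SymMod.toV (x • SymMod.ofV v) + SymMod.toV (y • SymMod.ofV v)
      rw [add_smul, map_add]
    zero_smul := fun v => by
      change SymMod.toV ((0 : Tr ℂ HPrime) • SymMod.ofV v) = 0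
      rw [zero_smul, map_zero] }

/-- The action of `Tr H` on `V`, through the natural isomorphism `Tr H → Tr H'`. -/
instance : Module (Tr ℂ H) V :=
  letI := HPrime.traceModule
  Module.compHom V (KaroubiEnvelope.traceMap ℂ HPrime).toRingHom

end HeisenbergTrace
end

noncomputable section

open CategoryTheory MonoidalCategory
open scoped ModuleCat

namespace HeisenbergTrace

/-! ### The trace of the category of modules over `ℂ[S_n]` -/

section RegularModule

variable {n : ℕ}

/-! `V` is a Fock space: its degree `n` part is the cocentre `ℂ[S_n]/[ℂ[S_n], ℂ[S_n]]`, powers of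
`P` create from the vacuum (the class of the identity of `ℂ[S_0]`), and powers of `Q` annihilate
back to it. Irreducibility follows from two facts: the vacuum generates `V`, and every nonzero
submodule contains the vacuum.

The cocentre is handled without classifying irreducible representations. Since `ℂ[S_n]` is
semisimple, every module is a summand of a free one, so each trace class is the class of a right
multiplication on the regular module (`regClass_surjective`). Conversely, the functionals `[f] ↦
tr(f ∘ g)` for `g` in `S_n` separate trace classes: if they all vanish on `[x]`, the average of the
conjugates of `x` is zero, while each conjugate has the class `[x]` (`eq_zero_of_character`).

Generation: applied to the vacuum, `P^n` gives the regular module of `S_n`, and crossings of upward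
strands realize right multiplication by every permutation (`exists_powP_hom`). These classes span
each degree.

Descent to the vacuum: `Q^n` sends `M` to an object whose degree `0` part is the vector space `M_n`,
and crossings of downward strands realize the action of every permutation on it (`exists_powQ_hom`).
Let `n` be the highest degree in which `v` is nonzero, and choose `g` with `tr(· ∘ g)` nonzero on
that component. The endomorphism of `Q^n` attached to `g` kills all lower degrees of `v` and sends
the degree `n` component to degree `0`, which is the line through the vacuum. The resulting
coefficient is the chosen nonzero character value (`vacuum_mem`). -/

variable (n) in
/-- The regular module. -/
def reg : FGModuleCat.{0} (SymAlg n) := FGModuleCat.of (SymAlg n) (SymAlg n)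

/-- Right multiplication by `x` on the regular module. -/
def rmul (x : SymAlg n) : reg n ⟶ reg n :=
  FGModuleCat.ofHom (LinearMap.toSpanSingleton (SymAlg n) (SymAlg n) x)

/-- Composition `≫` is diagrammatic, so right multiplications compose in the order of the product
and no opposite algebra appears. -/
theorem rmul_mul (x y : SymAlg n) : rmul (x * y) = rmul x ≫ rmul y :=
  FGModuleCat.hom_ext (LinearMap.ext fun a : SymAlg n => (mul_assoc a x y).symm)

theorem rmul_one : rmul (1 : SymAlg n) = 𝟙 (reg n) :=
  FGModuleCat.hom_ext (LinearMap.ext fun a : SymAlg n => mul_one a)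

/-- The regular module is free on `1`, so an endomorphism is determined by the image of `1`. -/
theorem eq_rmul (f : reg n ⟶ reg n) : f = rmul (f.hom.hom (1 : SymAlg n)) :=
  FGModuleCat.hom_ext (LinearMap.ext fun a : SymAlg n =>
    (congrArg f.hom.hom (mul_one a).symm).trans (f.hom.hom.map_smul a (1 : SymAlg n)))

variable (n) in
/-- The linear map sending `x` to the class of right multiplication by `x`. -/
def regClass : SymAlg n →ₗ[ℂ] Tr ℂ (FGModuleCat.{0} (SymAlg n)) where
  toFun x := Tr.of ℂ (rmul x)
  map_add' x y := by
    rw [← Tr.of_add]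
    exact congrArg _ (FGModuleCat.hom_ext (LinearMap.ext fun a : SymAlg n => mul_add a x y))
  map_smul' c x := by
    rw [RingHom.id_apply, ← Tr.of_smul]
    refine congrArg _ (FGModuleCat.hom_ext (LinearMap.ext fun a : SymAlg n => ?_))
    -- The scalar `c` acts on morphisms of modules through its image in the centre of the group
    -- algebra.
    change a * (c • x) = algebraMap ℂ (SymAlg n) c * (a * x)
    rw [← Algebra.smul_def, mul_smul_comm]

theorem regClass_apply (x : SymAlg n) : regClass n x = Tr.of ℂ (rmul x) := rfl

theorem regClass_mul_comm (x y : SymAlg n) : regClass n (x * y) = regClass n (y * x) := by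
  rw [regClass_apply, regClass_apply, rmul_mul, rmul_mul, Tr.of_comp_comm]

/-- By Maschke's theorem `X` is projective; being finitely generated, it is a retract of a free
module of finite rank. Splitting the identity of that free module along its coordinates makes the
identity of `X` a sum of maps through the regular module. -/
theorem exists_finite_dual_basis (X : FGModuleCat.{0} (SymAlg n)) :
    ∃ (k : ℕ) (u : Fin k → (X ⟶ reg n)) (v : Fin k → (reg n ⟶ X)), 𝟙 X = ∑ i, u i ≫ v i := by
  obtain ⟨k, p, hp⟩ := Module.Finite.exists_fin' (SymAlg n) X
  have : Module.Projective (SymAlg n) X := Module.projective_of_isSemisimpleRing ..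
  obtain ⟨s, hs⟩ := p.exists_rightInverse_of_surjective (LinearMap.range_eq_top.2 hp)
  -- `u i` is the `i`-th coordinate of the section `s`, and `v i` is the surjection `p` restricted
  -- to the `i`-th free summand.
  refine ⟨k, fun i => FGModuleCat.ofHom (LinearMap.proj i ∘ₗ s),
    fun i => FGModuleCat.ofHom (p ∘ₗ LinearMap.single (SymAlg n) (fun _ => SymAlg n) i), ?_⟩
  refine FGModuleCat.hom_ext (LinearMap.ext fun x => ?_)
  have h₁ : (∑ i, FGModuleCat.ofHom (LinearMap.proj i ∘ₗ s) ≫ FGModuleCat.ofHom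
      (p ∘ₗ LinearMap.single (SymAlg n) (fun _ => SymAlg n) i) : X ⟶ X).hom.hom x =
      ∑ i, p (Pi.single i (s x i)) :=
    map_sum (⟨⟨fun f : X ⟶ X => f.hom.hom x, rfl⟩, fun _ _ => rfl⟩ : (X ⟶ X) →+ X) _ _
  refine Eq.trans ?_ h₁.symm
  rw [← map_sum, Finset.univ_sum_single]
  exact (LinearMap.congr_fun hs x).symm

theorem regClass_surjective : Function.Surjective (regClass n) := by
  rw [← LinearMap.range_eq_top, eq_top_iff]
  rintro z -
  induction z using Tr.induction with
  | hzero => exact Submodule.zero_mem _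
  | hadd x y hx hy => exact Submodule.add_mem _ hx hy
  | @hof X f =>
    obtain ⟨k, u, v, h⟩ := exists_finite_dual_basis X
    rw [← Category.comp_id f, h, Preadditive.comp_sum,
      show Tr.of ℂ (∑ i, f ≫ u i ≫ v i) = ∑ i, Tr.of ℂ (f ≫ u i ≫ v i) from
        map_sum (Tr.ofₗ ℂ _ X) _ _]
    refine Submodule.sum_mem _ fun i _ => ?_
    -- The trace relation turns the endomorphism `f ≫ u i ≫ v i` of `X` into the endomorphism `v i ≫
    -- f ≫ u i` of the regular module, which is a right multiplication.
    rw [← Category.assoc, Tr.of_comp_comm, eq_rmul (v i ≫ f ≫ u i)]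
    exact ⟨_, rfl⟩

/-! ### Character functionals on the trace. -/

instance (X : FGModuleCat.{0} (SymAlg n)) : Module.Finite ℂ X :=
  Module.Finite.trans (SymAlg n) X

/-- The linear map `f ↦ tr (f ∘ a)` on endomorphisms of a module. -/
def charFun (a : SymAlg n) (X : FGModuleCat.{0} (SymAlg n)) : (X ⟶ X) →ₗ[ℂ] ℂ where
  -- Finite dimension of `X` over `ℂ` matters here: without a finite basis `LinearMap.trace` is zero
  -- by default.
  toFun f := LinearMap.trace ℂ X (f.hom.hom.restrictScalars ℂ ∘ₗ Algebra.lsmul ℂ ℂ X a)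
  map_add' f g := by rw [← map_add]; rfl
  map_smul' c f := by rw [RingHom.id_apply, ← map_smul]; rfl

theorem charFun_apply (a : SymAlg n) {X : FGModuleCat.{0} (SymAlg n)} (f : X ⟶ X) :
    charFun a X f =
      LinearMap.trace ℂ X (f.hom.hom.restrictScalars ℂ ∘ₗ Algebra.lsmul ℂ ℂ X a) := rfl

/-- Cyclicity of the linear trace gives `tr(g f a) = tr(f a g)`; then `a g = g a` because `g` is a
module map. -/
theorem charFun_comm (a : SymAlg n) {X Y : FGModuleCat.{0} (SymAlg n)} (f : X ⟶ Y) (g : Y ⟶ X) :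
    charFun a X (f ≫ g) = charFun a Y (g ≫ f) := by
  rw [charFun_apply, charFun_apply]
  have h := LinearMap.trace_comp_comm' (R := ℂ) (f.hom.hom.restrictScalars ℂ ∘ₗ
    Algebra.lsmul ℂ ℂ X a) (g.hom.hom.restrictScalars ℂ)
  refine h.trans (congrArg (LinearMap.trace ℂ Y) (LinearMap.ext fun y => ?_))
  exact congrArg f.hom.hom (g.hom.hom.map_smul a y).symm

/-- The functional `[f] ↦ tr (f ∘ a)` on the trace. -/
def character (a : SymAlg n) : Tr ℂ (FGModuleCat.{0} (SymAlg n)) →ₗ[ℂ] ℂ :=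
  Tr.lift (charFun a) (charFun_comm a)

theorem character_of (a : SymAlg n) {X : FGModuleCat.{0} (SymAlg n)} (f : X ⟶ X) :
    character a (Tr.of ℂ f) =
      LinearMap.trace ℂ X (f.hom.hom.restrictScalars ℂ ∘ₗ Algebra.lsmul ℂ ℂ X a) := by
  rw [character, Tr.lift_of, charFun_apply]

variable (n) in
/-- The regular module with the standard scalar multiplication. -/
def regEquiv : reg n ≃ₗ[ℂ] SymAlg n where
  __ := AddEquiv.refl (SymAlg n)
  map_smul' c x := (Algebra.smul_def (A := SymAlg n) c x).symm

/-- The trace is that of `y ↦ g y x` on `ℂ[S_n]`. In the basis of group elements, the diagonal entry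
at `h` is the coefficient of `h` in `g h x`, which is the coefficient of `(g h)⁻¹ h` in `x`. -/
theorem character_regClass (g : Equiv.Perm (Fin n)) (x : SymAlg n) :
    character (elt g) (regClass n x) = ∑ h, x.coeff (h⁻¹ * g⁻¹ * h) := by
  rw [regClass_apply, character_of]
  -- On `reg n` complex scalars act through `algebraMap`, on `SymAlg n` coefficientwise; conjugation
  -- by `regEquiv` passes from one structure to the other.
  have : LinearMap.trace ℂ (reg n) ((rmul x).hom.hom.restrictScalars ℂ ∘ₗ
      Algebra.lsmul ℂ ℂ (reg n) (elt g)) = LinearMap.trace ℂ (SymAlg n)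
        (LinearMap.mulRight ℂ x ∘ₗ LinearMap.mulLeft ℂ (elt g)) :=
    (LinearMap.trace_conj' _ (regEquiv n)).symm
  rw [this, LinearMap.trace_eq_matrix_trace ℂ (MonoidAlgebra.basis (Equiv.Perm (Fin n)) ℂ),
    Matrix.trace]
  refine Finset.sum_congr rfl fun h _ => ?_
  rw [Matrix.diag_apply, LinearMap.toMatrix_apply, MonoidAlgebra.basis_apply]
  change (elt g * elt h * x).coeff h = _
  rw [elt_mul, MonoidAlgebra.coeff_single_mul_apply, one_mul, mul_inv_rev]

/-- Up to inversion of the group element, the character values of `[x]` are the coefficients of `∑ g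
x g⁻¹`. If they vanish, so does this sum; but its class is `n!` times `[x]`. -/
theorem regClass_eq_zero (x : SymAlg n)
    (h : ∀ g : Equiv.Perm (Fin n), character (elt g) (regClass n x) = 0) : regClass n x = 0 := by
  have hz : ∑ g : Equiv.Perm (Fin n), elt g * x * elt g⁻¹ = 0 := by
    ext k
    -- The inverse cancels the one in `character_regClass`, leaving `∑ x.coeff (h⁻¹ k h)`, the
    -- coefficient of the averaged element at `k`.
    have := h k⁻¹
    rw [character_regClass, inv_inv] at this
    rw [MonoidAlgebra.coeff_sum, Finsupp.finsetSum_apply]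
    refine Eq.trans (Finset.sum_congr rfl fun g _ => ?_) this
    rw [MonoidAlgebra.coeff_mul_single_apply, MonoidAlgebra.coeff_single_mul_apply]
    simp [mul_assoc]
  have h₂ : ∑ g : Equiv.Perm (Fin n), regClass n (elt g * x * elt g⁻¹) = 0 := by
    rw [← map_sum, hz, map_zero]
  have h₃ (g : Equiv.Perm (Fin n)) : regClass n (elt g * x * elt g⁻¹) = regClass n x := by
    rw [regClass_mul_comm, ← mul_assoc, elt_mul, inv_mul_cancel]
    exact congrArg _ (one_mul x)
  simp only [h₃, Finset.sum_const] at h₂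
  rw [← Nat.cast_smul_eq_nsmul ℂ] at h₂
  -- The order of the group is invertible in `ℂ`.
  exact (smul_eq_zero.1 h₂).resolve_left (by simp)

theorem eq_zero_of_character (z : Tr ℂ (FGModuleCat.{0} (SymAlg n)))
    (h : ∀ g : Equiv.Perm (Fin n), character (elt g) z = 0) : z = 0 := by
  obtain ⟨x, rfl⟩ := regClass_surjective z
  exact regClass_eq_zero x h

/-- `S_0` is trivial, so `ℂ[S_0] = ℂ` and its trace is the line spanned by the identity class; the
character at `1` reads off the coordinate on this line. -/
theorem eq_character_smul (z : Tr ℂ (FGModuleCat.{0} (SymAlg 0))) :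
    z = character 1 z • Tr.of ℂ (𝟙 (reg 0)) := by
  obtain ⟨x, rfl⟩ := regClass_surjective z
  have hx : x = x.coeff 1 • 1 := by
    refine MonoidAlgebra.ext (Finsupp.ext fun g => ?_)
    rw [Subsingleton.elim g 1]
    simp
  have h := character_regClass (1 : Equiv.Perm (Fin 0)) x
  rw [Fintype.sum_unique, Subsingleton.elim (_ * _) (1 : Equiv.Perm (Fin 0))] at h
  rw [one_def', h, ← rmul_one, ← regClass_apply, ← map_smul, ← hx]

end RegularModule

/-! ### The action of `Tr H'` on `V` as a bilinear map -/

namespace HPrime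

open SymMod

/-- The action of an element of `Tr H'` on `V`. -/
def act : Tr ℂ HPrime →ₗ[ℂ] V →ₗ[ℂ] V :=
  (LinearMap.llcomp ℂ _ _ _ toV ∘ₗ (LinearMap.lcomp ℂ _ ofV)) ∘ₗ Tr.actₗ ℂ HPrime SymMod

theorem act_apply (x : Tr ℂ HPrime) (v : V) :
    act x v = toV (Tr.actₗ ℂ HPrime SymMod x (ofV v)) := rfl

theorem act_of_toV {X : HPrime} (f : X ⟶ X) {M : SymMod} (ψ : M ⟶ M) :
    act (Tr.of ℂ f) (toV (Tr.of ℂ ψ)) =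
      toV (Tr.of ℂ ((natTrans f).app M ≫ (functor X).map ψ)) := by
  rw [act_apply, show ofV (toV (Tr.of ℂ ψ)) = Tr.of ℂ ψ from LinearMap.congr_fun ofV_toV _,
    Tr.actₗ_of]
  rfl

/-- This degreewise form of the action formula is the one used for computing: classes of `V` are
compared component by component. -/
theorem component_act_of_toV {X : HPrime} (f : X ⟶ X) {M : SymMod} (ψ : M ⟶ M) (n : ℕ) :
    V.component n (act (Tr.of ℂ f) (toV (Tr.of ℂ ψ))) =
      Tr.of ℂ ((natTrans f).app M n ≫ (functor X).map ψ n) := by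
  rw [act_of_toV, toV_of, component_sumClass]
  rfl

theorem smul_eq_act (x : Tr ℂ H) (v : V) :
    x • v = act (KaroubiEnvelope.traceMap ℂ HPrime x) v := rfl

/-- The class of `f` on `X` is the image of the class of `f` on `(X, 𝟙)`. Only this half of the
isomorphism `Tr H ≅ Tr H'` is needed: it makes submodules over `Tr H` stable under `Tr H'`. -/
theorem traceMap_surjective : Function.Surjective (KaroubiEnvelope.traceMap ℂ HPrime) := by
  intro z
  induction z using Tr.induction with
  | hof f =>
    exact ⟨Tr.of ℂ ((Idempotents.toKaroubi HPrime).map f), KaroubiEnvelope.traceMapₗ_of _⟩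
  | hzero => exact ⟨0, map_zero _⟩
  | hadd x y hx hy =>
    obtain ⟨x, rfl⟩ := hx
    obtain ⟨y, rfl⟩ := hy
    exact ⟨x + y, map_add _ _ _⟩

theorem toV_surjective : Function.Surjective toV := fun v =>
  ⟨ofV v, LinearMap.congr_fun toV_ofV v⟩

theorem act_mem (N : Submodule (Tr ℂ H) V) (x : Tr ℂ HPrime) {v : V} (hv : v ∈ N) :
    act x v ∈ N := by
  obtain ⟨x, rfl⟩ := traceMap_surjective x
  exact N.smul_mem x hv

theorem act_one (v : V) : act 1 v = v := by
  have h : (1 : Tr ℂ H) • v = v := one_smul _ v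
  rwa [smul_eq_act, map_one] at h

/-- A submodule over `Tr H` is a complex subspace because `c` acts as the algebra element `c • 1`.
-/
theorem smul_mem' (N : Submodule (Tr ℂ H) V) (c : ℂ) {v : V} (hv : v ∈ N) : c • v ∈ N := by
  have h := act_mem N (c • 1) hv
  rwa [map_smul, LinearMap.smul_apply, act_one] at h

/-! ### Powers of `Q` -/

/-- The `n`-th tensor power of `Q`. -/
def powQ : ℕ → HPrime
  | 0 => unit
  -- The rightmost factor acts first, so `Q^(n+1)` sends `M` to `Q^n` of its restriction; inductions
  -- on `n` therefore generalize over `M`.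
  | n + 1 => tensor (powQ n) Q

/-- `Q^n` lowers degrees by `n`: its value on `M` in degree `k` has the underlying space of `M` in
degree `k + n`. -/
theorem powQ_subsingleton (n k : ℕ) (M : SymMod) (h : Subsingleton (M.obj (k + n))) :
    Subsingleton (((functor (powQ n)).obj M).obj k) := by
  induction n generalizing M with
  | zero => exact h
  | succ n ih => exact ih (res.obj M) h

/-- The restriction of a module, with its scalar multiplication forgotten. -/
def resEquiv (n : ℕ) (M : SymMod) : (res.obj M).obj n ≃ₗ[ℂ] M.obj (n + 1) where
  __ := AddEquiv.refl (M.obj (n + 1))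
  map_smul' c x := by
    have h := Res.un_smul (M := M.obj (n + 1)) (incl n) (algebraMap ℂ (SymAlg n) c) x
    rw [incl_algebraMap] at h
    exact h

/-- The iterated restriction of `M` to degree `0` is the vector space `M n`. -/
def powQEquiv : ∀ (n : ℕ) (M : SymMod), ((functor (powQ n)).obj M).obj 0 ≃ₗ[ℂ] M.obj n
  | 0, M => LinearEquiv.refl ℂ (M.obj 0)
  | n + 1, M => (powQEquiv n (res.obj M)).trans (resEquiv n M)

theorem powQEquiv_map (n : ℕ) {M N : SymMod} (f : M ⟶ N)
    (x : ((functor (powQ n)).obj M).obj 0) :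
    powQEquiv n N (((functor (powQ n)).map f 0).hom.hom x) =
      (f n).hom.hom (powQEquiv n M x) := by
  induction n generalizing M N with
  | zero => rfl
  | succ n ih => exact congrArg (resEquiv n N) (ih (res.map f) x)

/-- The permutations of `n` letters that are realized by endomorphisms of the `n`-th power of
`Q`. -/
def powQSubmonoid (n : ℕ) : Submonoid (Equiv.Perm (Fin n)) where
  carrier := {g | ∃ f : powQ n ⟶ powQ n, ∀ (M : SymMod) (x : ((functor (powQ n)).obj M).obj 0),
    powQEquiv n M (((natTrans f).app M 0).hom.hom x) = elt g • powQEquiv n M x}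
  one_mem' := ⟨𝟙 _, fun M x => (one_smul (SymAlg n) (powQEquiv n M x)).symm⟩
  mul_mem' := by
    rintro g h ⟨f, hf⟩ ⟨f', hf'⟩
    -- Permutations act on the left here, so in the product `g * h` the factor `h`, realized by
    -- `f'`, acts first.
    refine ⟨f' ≫ f, fun M x => ?_⟩
    have e : (natTrans (f' ≫ f)).app M = (natTrans f').app M ≫ (natTrans f).app M := by
      obtain ⟨f, rfl⟩ := toHom_surjective f
      obtain ⟨f', rfl⟩ := toHom_surjective f'
      rfl
    rw [e]
    refine (hf M _).trans ((congrArg (elt g • ·) (hf' M x)).trans ?_)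
    rw [smul_smul, elt_mul]

/-- The crossing of two downward strands. -/
def crossQQ : tensor Q Q ⟶ tensor Q Q := toHom (Diag.rotR Diag.crossPQ)

/-- Evaluating the crossing rotated twice on a doubly restricted module leaves the action of the
transposition of the two letters that were removed; this is the module computation `cyclic_right`.
-/
theorem crossQQ_apply (n : ℕ) (M : SymMod) (x : (res.obj (res.obj M)).obj n) :
    resEquiv (n + 1) M (resEquiv n (res.obj M)
      (((natTrans crossQQ).app M n).hom.hom x)) =
      lastSwap n • resEquiv (n + 1) M (resEquiv n (res.obj M) x) := by
  have h : (natTrans crossQQ).app M = cupQP.app (res.obj (res.obj M)) ≫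
      res.map (crossR (res.obj M) ≫ res.map (capPQ.app M)) := by
    refine (eval_rotR_app Diag.crossPQ M).trans ?_
    rw [eval_crossPQ_app]
    rfl
  rw [h]
  exact cyclic_right (n := n) (M := M.obj (n + 2)) x

/-- A downward strand added on the right restricts the module first. On a restricted module `g` acts
through the embedding of `S_n` fixing the last letter. -/
theorem incl_mem_powQSubmonoid {n : ℕ} {g : Equiv.Perm (Fin n)} (hg : g ∈ powQSubmonoid n) :
    permIncl n g ∈ powQSubmonoid (n + 1) := by
  obtain ⟨f, hf⟩ := hg
  refine ⟨f ▷ Q, fun M x => ?_⟩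
  have e : (natTrans (f ▷ Q)).app M = (natTrans f).app (res.obj M) := by
    obtain ⟨f, rfl⟩ := toHom_surjective f
    rfl
  refine (congrArg (fun t : (functor (powQ (n + 1))).obj M ⟶ (functor (powQ (n + 1))).obj M =>
    powQEquiv (n + 1) M ((t 0).hom.hom x)) e).trans ?_
  refine (congrArg (resEquiv n M) (hf (res.obj M) x)).trans ?_
  have h := Res.un_smul (M := M.obj (n + 1)) (incl n) (elt g) (powQEquiv n (res.obj M) x)
  rw [incl_single] at h
  exact h

/-- The last two letters belong to the two rightmost strands, where `crossQQ` acts as their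
transposition. Naturality of `powQEquiv` carries this through the remaining `n` restrictions; the
associators act as identities. -/
theorem lastSwap_mem_powQSubmonoid (n : ℕ) :
    Equiv.swap (Fin.last n).castSucc (Fin.last (n + 1)) ∈ powQSubmonoid (n + 2) := by
  refine ⟨(α_ (powQ n) Q Q).hom ≫ powQ n ◁ crossQQ ≫ (α_ (powQ n) Q Q).inv, fun M x => ?_⟩
  have e : (natTrans ((α_ (powQ n) Q Q).hom ≫ powQ n ◁ crossQQ ≫ (α_ (powQ n) Q Q).inv)).app M =
      (functor (powQ n)).map ((natTrans crossQQ).app M) := by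
    change 𝟙 _ ≫ (functor (powQ n)).map ((natTrans crossQQ).app M) ≫ 𝟙 _ = _
    rw [Category.id_comp, Category.comp_id]
  refine (congrArg (fun t : (functor (powQ (n + 2))).obj M ⟶ (functor (powQ (n + 2))).obj M =>
    powQEquiv (n + 2) M ((t 0).hom.hom x)) e).trans ?_
  refine (congrArg (fun y => resEquiv (n + 1) M (resEquiv n (res.obj M) y))
    (powQEquiv_map n ((natTrans crossQQ).app M) x)).trans ?_
  exact crossQQ_apply n M _

/-! ### Generation of all symmetric groups by inclusions and last transpositions. -/

theorem permIncl_swap {n : ℕ} (i j : Fin n) :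
    permIncl n (Equiv.swap i j) = Equiv.swap i.castSucc j.castSucc := by
  ext k
  induction k using Fin.lastCases with
  | last =>
    rw [permIncl_last, Equiv.swap_apply_of_ne_of_ne (Fin.castSucc_lt_last _).ne'
      (Fin.castSucc_lt_last _).ne']
  | cast k =>
    rw [permIncl_castSucc, Equiv.swap_apply_def, Equiv.swap_apply_def]
    simp only [Fin.castSucc_inj]
    split_ifs <;> rfl

/-- A submonoid of each symmetric group is everything as soon as the family is stable under the
inclusions and contains the last simple transpositions. -/
theorem eq_top_of_lastSwap_mem (S : ∀ n, Submonoid (Equiv.Perm (Fin n)))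
    (h₁ : ∀ {n} {g : Equiv.Perm (Fin n)}, g ∈ S n → permIncl n g ∈ S (n + 1))
    (h₂ : ∀ n, Equiv.swap (Fin.last n).castSucc (Fin.last (n + 1)) ∈ S (n + 2)) (n : ℕ) :
    S n = ⊤ := by
  -- An adjacent transposition is either the last one or included from the previous symmetric group.
  have key : ∀ (n : ℕ) (i : Fin n), Equiv.swap i.castSucc i.succ ∈ S (n + 1) := by
    intro n
    induction n with
    | zero => exact fun i => i.elim0
    | succ n ih =>
      intro i
      induction i using Fin.lastCases with
      | last => exact h₂ n
      | cast i =>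
        have := h₁ (ih i)
        rwa [permIncl_swap] at this
  cases n with
  | zero =>
    rw [eq_top_iff]
    intro g _
    rw [Subsingleton.elim g 1]
    exact Submonoid.one_mem _
  | succ n =>
    -- Adjacent transpositions generate the symmetric group already as a monoid.
    rw [eq_top_iff, ← Equiv.Perm.mclosure_swap_castSucc_succ n, Submonoid.closure_le]
    rintro _ ⟨i, rfl⟩
    exact key n i

theorem powQSubmonoid_eq_top (n : ℕ) : powQSubmonoid n = ⊤ :=
  eq_top_of_lastSwap_mem powQSubmonoid incl_mem_powQSubmonoid lastSwap_mem_powQSubmonoid n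

/-! ### Powers of `Q` as detectors of homogeneous components. -/

/-- The endomorphism of the `n`-th power of `Q` attached to a permutation of `n` letters. -/
theorem exists_powQ_hom {n : ℕ} (g : Equiv.Perm (Fin n)) : ∃ f : powQ n ⟶ powQ n,
    ∀ v : V, character 1 (V.component 0 (act (Tr.of ℂ f) v)) =
      character (elt g) (V.component n v) := by
  obtain ⟨f, hf⟩ : g ∈ powQSubmonoid n := powQSubmonoid_eq_top n ▸ Submonoid.mem_top g
  refine ⟨f, fun v => ?_⟩
  obtain ⟨z, rfl⟩ := toV_surjective v
  -- Both sides are linear in the class, so it suffices to treat `[ψ]` for `ψ : M ⟶ M`. There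
  -- `powQEquiv` carries the degree `0` endomorphism to `ψ_n ∘ g` on `M_n`, whose trace is the
  -- character value on the right.
  refine LinearMap.congr_fun (f := character 1 ∘ₗ V.component 0 ∘ₗ act (Tr.of ℂ f) ∘ₗ toV)
    (g := character (elt g) ∘ₗ V.component n ∘ₗ toV) (Tr.hom_ext fun {M} ψ => ?_) z
  simp only [LinearMap.comp_apply]
  rw [component_act_of_toV, toV_of, component_sumClass, character_of, character_of,
    ← LinearMap.trace_conj' _ (powQEquiv n M)]
  congr 1
  refine LinearMap.ext fun x => ?_
  obtain ⟨x, rfl⟩ := (powQEquiv n M).surjective x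
  rw [LinearEquiv.conj_apply_apply, LinearEquiv.symm_apply_apply]
  refine (powQEquiv_map n ψ _).trans (congrArg (ψ n).hom.hom ((hf M _).trans ?_))
  refine congrArg (fun y => elt g • powQEquiv n M y) ?_
  exact one_smul (SymAlg 0) x

/-- The degree `k` part of `Q^n` sees only degree `k + n`, where an object concentrated in degree
`m` vanishes. Thus `Q^n` kills degrees below `n` and sends degree `n` into degree `0` alone. -/
theorem component_act_powQ {n k m : ℕ} (f : powQ n ⟶ powQ n) (h : m < k + n)
    (y : Tr ℂ (FGModuleCat.{0} (SymAlg m))) :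
    V.component k (act (Tr.of ℂ f) (V.lof m y)) = 0 := by
  refine LinearMap.congr_fun (f := V.component k ∘ₗ act (Tr.of ℂ f) ∘ₗ V.lof m)
    (g := 0) (Tr.hom_ext fun {X} ψ => ?_) y
  simp only [LinearMap.comp_apply, LinearMap.zero_apply]
  have e : V.lof m (Tr.of ℂ ψ) = toV (Tr.of ℂ (singleMap ψ)) := by
    rw [← singleTr_of, ← ofV_lof]
    exact (LinearMap.congr_fun toV_ofV _).symm
  rw [e, component_act_of_toV]
  have := powQ_subsingleton n k (single X) (single_obj_ne X h.ne')
  rw [zero_hom_ext ((natTrans f).app (single X) k ≫ (functor (powQ n)).map (singleMap ψ) k) 0]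
  exact of_zero _

end HPrime

/-! ### Powers of `P` and the vacuum -/

section Induced

variable {n : ℕ}

/-- Induction of linear equivalences. -/
def Ind.mapEquiv {M N : Type} [AddCommGroup M] [AddCommGroup N] [Module (SymAlg n) M]
    [Module (SymAlg n) N] (e : M ≃ₗ[SymAlg n] N) :
    Ind (incl n) M ≃ₗ[SymAlg (n + 1)] Ind (incl n) N :=
  LinearEquiv.ofLinearMap (Ind.map (incl n) e.toLinearMap) (Ind.map (incl n) e.symm.toLinearMap)
    (by rw [← Ind.map_comp, LinearEquiv.comp_symm, Ind.map_id])
    (by rw [← Ind.map_comp, LinearEquiv.symm_comp, Ind.map_id])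

variable (n) in
/-- The regular module is induced from the regular module. -/
def indRegEquiv : Ind (incl n) (SymAlg n) ≃ₗ[SymAlg (n + 1)] SymAlg (n + 1) :=
  LinearEquiv.ofLinearMap
    (Ind.liftₗ (incl n) (incl n).toAddMonoidHom (fun b m => map_mul (incl n) b m))
    -- The inverse of `a ⊗ b ↦ a b` sends `a` to `a • (1 ⊗ 1)`.
    (LinearMap.toSpanSingleton (SymAlg (n + 1)) (Ind (incl n) (SymAlg n)) (Ind.mk (incl n) 1 1))
    (LinearMap.ext fun a => by
      simp [Ind.liftₗ_mk, Ind.smul_mk])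
    (Ind.hom_ext fun a m => by
      rw [LinearMap.comp_apply, Ind.liftₗ_mk, LinearMap.toSpanSingleton_apply, Ind.smul_mk,
        mul_one]
      change Ind.mk (incl n) (a * incl n m) 1 = Ind.mk (incl n) a m
      rw [← Ind.mk_smul, smul_eq_mul, mul_one])

end Induced

/-! ### The vacuum and the regular modules induced from it. -/

namespace SymMod

/-- The regular module of `ℂ[S_0]`, placed in degree `0`. -/
def vac : SymMod where
  -- Matching on the degree, instead of using `single`, makes the degree `0` component equal to `reg
  -- 0` by definition, so no transport along an equality is needed.
  obj n := match n with
    | 0 => reg 0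
    | n + 1 => FGModuleCat.of (SymAlg (n + 1)) PUnit
  finite := ⟨1, fun n hn => by
    obtain ⟨n, rfl⟩ : ∃ k, n = k + 1 := ⟨n - 1, by omega⟩
    exact inferInstanceAs (Subsingleton PUnit)⟩

theorem vac_subsingleton {n : ℕ} (h : n ≠ 0) : Subsingleton (vac.obj n) := by
  obtain ⟨n, rfl⟩ := Nat.exists_eq_succ_of_ne_zero h
  exact inferInstanceAs (Subsingleton PUnit)

end SymMod

namespace HPrime

open SymMod

/-- The `n`-th tensor power of `P`. -/
def powP : ℕ → HPrime
  | 0 => unit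
  -- The new factor stands on the left and acts last: `P^(n+1)` of the vacuum is the induction of
  -- `P^n` of the vacuum.
  | n + 1 => tensor P (powP n)

/-- The `n`-th power of `P` applied to the vacuum. -/
abbrev powPVac (n : ℕ) : SymMod := (functor (powP n)).obj vac

/-- Each induction raises degrees by one, and the vacuum sits in degree `0`. -/
theorem powPVac_subsingleton {n k : ℕ} (h : k ≠ n) : Subsingleton ((powPVac n).obj k) := by
  induction n generalizing k with
  | zero => exact vac_subsingleton h
  | succ n ih =>
    cases k with
    | zero => exact inferInstanceAs (Subsingleton (indObj (powPVac n) 0))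
    | succ k =>
      have := ih (k := k) (by omega)
      exact inferInstanceAs (Subsingleton (Ind (incl k) ((powPVac n).obj k)))

/-- The `n`-th power of `P` applied to the vacuum is the regular module in degree `n`. -/
def powPEquiv : ∀ n : ℕ, (powPVac n).obj n ≃ₗ[SymAlg n] SymAlg n
  | 0 => LinearEquiv.refl (SymAlg 0) (SymAlg 0)
  | n + 1 => (Ind.mapEquiv (powPEquiv n)).trans (indRegEquiv n)

theorem powPEquiv_mk (n : ℕ) (a : SymAlg (n + 1)) (x : (powPVac n).obj n) :
    powPEquiv (n + 1) (Ind.mk (incl n) a x) = a * incl n (powPEquiv n x) := by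
  change indRegEquiv n (Ind.map (incl n) (powPEquiv n).toLinearMap (Ind.mk (incl n) a x)) = _
  rw [Ind.map_mk]
  rfl

/-- The permutations `g` of `n` letters for which right multiplication by `g` is realized by an
endomorphism of the `n`-th power of `P`. -/
def powPSubmonoid (n : ℕ) : Submonoid (Equiv.Perm (Fin n)) where
  carrier := {g | ∃ f : powP n ⟶ powP n, ∀ x : (powPVac n).obj n,
    powPEquiv n (((natTrans f).app vac n).hom.hom x) = powPEquiv n x * elt g}
  one_mem' := ⟨𝟙 _, fun x => (mul_one (powPEquiv n x)).symm⟩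
  mul_mem' := by
    rintro g h ⟨f, hf⟩ ⟨f', hf'⟩
    -- The order is opposite to the one for `powQSubmonoid`, because the permutations multiply on
    -- the right.
    refine ⟨f ≫ f', fun x => ?_⟩
    have e : (natTrans (f ≫ f')).app vac = (natTrans f).app vac ≫ (natTrans f').app vac := by
      obtain ⟨f, rfl⟩ := toHom_surjective f
      obtain ⟨f', rfl⟩ := toHom_surjective f'
      rfl
    rw [e]
    refine (hf' _).trans ((congrArg (· * elt h) (hf x)).trans ?_)
    rw [mul_assoc, elt_mul]

/-- An upward strand added on the left induces the morphism. Under `a ⊗ x ↦ a · incl x`, inducing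
right multiplication by `g` gives right multiplication by `incl g`. -/
theorem incl_mem_powPSubmonoid {n : ℕ} {g : Equiv.Perm (Fin n)} (hg : g ∈ powPSubmonoid n) :
    permIncl n g ∈ powPSubmonoid (n + 1) := by
  obtain ⟨f, hf⟩ := hg
  refine ⟨P ◁ f, fun x => ?_⟩
  have e : (natTrans (P ◁ f)).app vac = ind.map ((natTrans f).app vac) := by
    obtain ⟨f, rfl⟩ := toHom_surjective f
    rfl
  refine (congrArg (fun t : powPVac (n + 1) ⟶ powPVac (n + 1) =>
    powPEquiv (n + 1) ((t (n + 1)).hom.hom x)) e).trans ?_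
  change powPEquiv (n + 1) (Ind.map (incl n) ((natTrans f).app vac n).hom.hom x) = _
  change Ind (incl n) ((powPVac n).obj n) at x
  induction x using Ind.induction with
  | h a m =>
    rw [Ind.map_mk, powPEquiv_mk, powPEquiv_mk,
      show elt (permIncl n g) = incl n (elt g) from (incl_single g 1).symm, mul_assoc, ← map_mul]
    exact congrArg (fun y => a * incl n y) (hf m)
  | hadd x y hx hy =>
    rw [map_add]
    exact (map_add (powPEquiv (n + 1)) _ _).trans ((congrArg₂ (· + ·) hx hy).trans
      ((add_mul _ _ _).symm.trans (congrArg (· * _) (map_add (powPEquiv (n + 1)) x y).symm)))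

/-- Crossing the two leftmost strands sends `a ⊗ 1 ⊗ m` to `a s ⊗ 1 ⊗ m`. In the regular module this
becomes right multiplication by `s`, because `s` commutes with the image of `ℂ[S_n]` in
`ℂ[S_{n+2}]`. -/
theorem lastSwap_mem_powPSubmonoid (n : ℕ) :
    Equiv.swap (Fin.last n).castSucc (Fin.last (n + 1)) ∈ powPSubmonoid (n + 2) := by
  refine ⟨(α_ P P (powP n)).inv ≫ toHom Diag.cross ▷ powP n ≫ (α_ P P (powP n)).hom,
    fun x => ?_⟩
  have e : (natTrans ((α_ P P (powP n)).inv ≫ toHom Diag.cross ▷ powP n ≫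
      (α_ P P (powP n)).hom)).app vac = SymMod.cross.app (powPVac n) := by
    change 𝟙 _ ≫ SymMod.cross.app (powPVac n) ≫ 𝟙 _ = _
    rw [Category.id_comp, Category.comp_id]
  refine (congrArg (fun t : powPVac (n + 2) ⟶ powPVac (n + 2) =>
    powPEquiv (n + 2) ((t (n + 2)).hom.hom x)) e).trans ?_
  -- With the domain displayed as an iterated induction, `ind_ind_hom_ext` reduces the comparison to
  -- tensors whose middle factor is `1`.
  let l : Ind (incl (n + 1)) (Ind (incl n) ((powPVac n).obj n)) →ₗ[SymAlg (n + 2)]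
    SymAlg (n + 2) := (powPEquiv (n + 2)).toLinearMap
  refine LinearMap.congr_fun (f := l ∘ₗ crossMap ((powPVac n).obj n))
    (g := LinearMap.toSpanSingleton (SymAlg (n + 2)) (SymAlg (n + 2)) (lastSwap n) ∘ₗ l)
    (ind_ind_hom_ext fun a m => ?_) x
  have hl (a : SymAlg (n + 2)) (m : (powPVac n).obj n) : l (Ind.mk (incl (n + 1)) a
      (Ind.mk (incl n) 1 m)) = a * incl (n + 1) (incl n (powPEquiv n m)) := by
    refine (powPEquiv_mk (n + 1) a (Ind.mk (incl n) 1 m)).trans ?_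
    refine congrArg (fun y => a * incl (n + 1) y) ((powPEquiv_mk n 1 m).trans (one_mul _))
  rw [LinearMap.comp_apply, LinearMap.comp_apply, crossMap_mk, hl, hl, map_one, mul_one,
    LinearMap.toSpanSingleton_apply, smul_eq_mul, mul_assoc, mul_assoc, lastSwap_comm]

theorem powPSubmonoid_eq_top (n : ℕ) : powPSubmonoid n = ⊤ :=
  eq_top_of_lastSwap_mem powPSubmonoid incl_mem_powPSubmonoid lastSwap_mem_powPSubmonoid n

/-- The class of the vacuum. -/
def vacuum : V := V.lof 0 (Tr.of ℂ (𝟙 (reg 0)))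

/-- This presents the vacuum as the class of an endomorphism in the total category, the form in
which the categorical action can be evaluated. -/
theorem vacuum_eq : vacuum = toV (Tr.of ℂ (𝟙 vac)) := by
  refine V.ext fun n => ?_
  rw [toV_of, component_sumClass, vacuum]
  by_cases h : n = 0
  · subst h
    exact V.component_lof_self _ _
  · have := vac_subsingleton h
    rw [V.component_lof_ne (Ne.symm h), zero_hom_ext ((𝟙 vac : vac ⟶ vac) n) 0, of_zero]

/-- Acting on the class of an identity leaves the class of `f` evaluated at the vacuum object. In
degree `n` it is conjugate, through `powPEquiv`, to right multiplication by `g`; the other degrees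
are zero. -/
theorem exists_powP_hom {n : ℕ} (g : Equiv.Perm (Fin n)) : ∃ f : powP n ⟶ powP n,
    act (Tr.of ℂ f) vacuum = V.lof n (regClass n (elt g)) := by
  obtain ⟨f, hf⟩ : g ∈ powPSubmonoid n := powPSubmonoid_eq_top n ▸ Submonoid.mem_top g
  refine ⟨f, V.ext fun k => ?_⟩
  rw [vacuum_eq, component_act_of_toV, CategoryTheory.Functor.map_id, id_app, Category.comp_id]
  by_cases h : k = n
  · subst h
    rw [V.component_lof_self, regClass_apply]
    let e : (powPVac k).obj k ≅ reg k :=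
      (powPEquiv k : (powPVac k).obj k ≃ₗ[SymAlg k] reg k).toFGModuleCatIso
    exact Tr.of_conj e (FGModuleCat.hom_ext (LinearMap.ext fun x => hf x))
  · have := powPVac_subsingleton h
    rw [V.component_lof_ne (Ne.symm h), zero_hom_ext ((natTrans f).app vac k) 0, of_zero]

end HPrime

/-! ### Finite support of the elements of `V`. -/

namespace V

theorem exists_bound (v : V) : ∃ B, ∀ n, B ≤ n → component n v = 0 := by
  obtain ⟨z, rfl⟩ := HPrime.toV_surjective v
  induction z using Tr.induction with
  | hzero => exact ⟨0, fun n _ => by rw [map_zero, map_zero]⟩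
  | @hof M f =>
    refine ⟨M.bound, fun n hn => ?_⟩
    rw [SymMod.toV_of, SymMod.component_sumClass, SymMod.app_eq_zero f hn, SymMod.of_zero]
  | hadd x y hx hy =>
    obtain ⟨B, hB⟩ := hx
    obtain ⟨B', hB'⟩ := hy
    refine ⟨max B B', fun n hn => ?_⟩
    rw [map_add, map_add, hB n (by omega), hB' n (by omega), add_zero]

theorem eq_sum (v : V) {B : ℕ} (h : ∀ n, B ≤ n → component n v = 0) :
    v = ∑ m ∈ Finset.range B, lof m (component m v) := by
  refine ext fun n => ?_
  rw [map_sum]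
  by_cases hn : n < B
  · rw [Finset.sum_eq_single n (fun m _ hm => component_lof_ne hm _)
      (fun h => absurd (Finset.mem_range.2 hn) h), component_lof_self]
  · rw [h n (not_lt.1 hn)]
    refine (Finset.sum_eq_zero fun m hm => component_lof_ne ?_ _).symm
    have := Finset.mem_range.1 hm
    omega

end V

/-! ### Irreducibility -/

open HPrime

/-- The vacuum generates `V`. -/
theorem eq_top_of_vacuum_mem (N : Submodule (Tr ℂ H) V) (h : vacuum ∈ N) : N = ⊤ := by
  rw [eq_top_iff]
  rintro v -
  obtain ⟨B, hB⟩ := V.exists_bound v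
  rw [V.eq_sum v hB]
  refine Submodule.sum_mem _ fun n _ => ?_
  -- Each homogeneous component is a combination of classes of right multiplications by
  -- permutations, and those are obtained from the vacuum by endomorphisms of `P^n`.
  obtain ⟨x, hx⟩ := regClass_surjective (V.component n v)
  rw [← hx]
  clear hx
  induction x using symAlg_induction with
  | hadd x y hx hy =>
    rw [map_add, map_add]
    exact N.add_mem hx hy
  | h g c =>
    obtain ⟨f, hf⟩ := exists_powP_hom g
    have h' := smul_mem' N c (act_mem N (Tr.of ℂ f) h)
    rwa [hf, ← map_smul, ← map_smul, MonoidAlgebra.smul_single, smul_eq_mul, mul_one] at h'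

/-- A nonzero submodule contains the vacuum. -/
theorem vacuum_mem (N : Submodule (Tr ℂ H) V) (B : ℕ) (v : V) (hv : v ∈ N) (h₀ : v ≠ 0)
    (hB : ∀ n, B ≤ n → V.component n v = 0) : vacuum ∈ N := by
  -- The bound is exclusive: for `B = n + 1` either the degree `n` component vanishes and the bound
  -- drops, or `n` is the top degree of `v`.
  induction B with
  | zero => exact absurd (V.ext fun n => (hB n n.zero_le).trans (map_zero _).symm) h₀
  | succ n ih =>
    by_cases hn : V.component n v = 0
    · refine ih fun m hm => ?_
      obtain rfl | hm := hm.eq_or_lt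
      · exact hn
      · exact hB m hm
    · obtain ⟨g, hg⟩ : ∃ g : Equiv.Perm (Fin n), character (elt g) (V.component n v) ≠ 0 := by
        by_contra! h
        exact hn (eq_zero_of_character _ h)
      obtain ⟨f, hf⟩ := exists_powQ_hom g
      -- Degree `0` of the result lies on the line of the vacuum, with coordinate the chosen
      -- character value. A degree `k > 0` would require a component of `v` in degree `k + n > n`,
      -- and there is none.
      have key : act (Tr.of ℂ f) v = character (elt g) (V.component n v) • vacuum := by
        refine V.ext fun k => ?_
        rw [map_smul, vacuum]
        by_cases hk : k = 0
        · subst hk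
          rw [V.component_lof_self, ← hf]
          exact eq_character_smul _
        · rw [V.component_lof_ne (Ne.symm hk), smul_zero, V.eq_sum v hB, map_sum, map_sum]
          refine Finset.sum_eq_zero fun m hm => component_act_powQ f ?_ _
          have := Finset.mem_range.1 hm
          omega
      -- The coefficient is nonzero by the choice of `g`, so rescaling recovers the vacuum itself.
      have h := smul_mem' N (character (elt g) (V.component n v))⁻¹ (act_mem N (Tr.of ℂ f) hv)
      rwa [key, smul_smul, inv_mul_cancel₀ hg, one_smul] at h

/-- The character at `1` takes the value `dim ℂ[S_0] = 1` on the vacuum. -/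
theorem vacuum_ne_zero : vacuum ≠ 0 := fun h => by
  have h₁ := character_regClass (1 : Equiv.Perm (Fin 0)) 1
  rw [regClass_apply, rmul_one, ← V.component_lof_self 0 (Tr.of ℂ (𝟙 (reg 0))),
    show V.lof 0 (Tr.of ℂ (𝟙 (reg 0))) = 0 from h, map_zero, map_zero, Fintype.sum_unique,
    Subsingleton.elim (_ * _) (1 : Equiv.Perm (Fin 0))] at h₁
  simp at h₁

end HeisenbergTrace
end

theorem mainTheorem7 : IsSimpleModule (HeisenbergTrace.Tr ℂ HeisenbergTrace.H) HeisenbergTrace.V := by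
  have : Nontrivial HeisenbergTrace.V := ⟨_, _, HeisenbergTrace.vacuum_ne_zero⟩
  rw [isSimpleModule_iff]
  refine { eq_bot_or_eq_top := fun N => or_iff_not_imp_left.2 fun hN => ?_ }
  obtain ⟨v, hv, h₀⟩ := N.ne_bot_iff.1 hN
  obtain ⟨B, hB⟩ := HeisenbergTrace.V.exists_bound v
  exact HeisenbergTrace.eq_top_of_vacuum_mem N (HeisenbergTrace.vacuum_mem N B v hv h₀ hB)
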